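/- **Setting.** Let $d\ge 2$, let $\Theta\subset\mathbb R^m$ be compact and convex, and let $g:\mathbb R^m\times\mathbb R^d\to\mathbb R$. Write $\mathcal S(\theta)=\arg\min_{x\in\mathbb R^d} g(\theta,x)$. A function $h:\mathbb R^d\to\mathbb R$ satisfies the *PŁ° condition* if, with $\mathcal M$ the set of all its local minima, (i) $h$ is $C^2$ and there are $\mu>0$ and, for every connected component $\mathcal M'$ of $\mathcal M$, an open set $\mathcal N(\mathcal M')\supset\mathcal M'$ on which $h$ is $C^4$, attains its minimum, and satisfies $h(x)-\min_{\mathcal N(\mathcal M')}h\le(2\mu)^{-1}\|\nabla h(x)\|^2$; (ii) every critical point $x\notin\bigcup_{\mathcal M'}\mathcal N(\mathcal M')$ of $h$ satisfies $\nabla^2h(x)\prec0$; (iii) $\mathcal M$ is contained in a compact set. **Assumptions.** 1. For every $\theta\in\Theta$, $g(\theta,\cdot)$ satisfies the PŁ° condition. 2. $g$ is $C^2$ in a neighbourhood of every point of $\Theta\times\mathbb R^d$. There is $L$ such that $\theta\mapsto\partial_\theta g(\theta,x)$ is $L$-Lipschitz on $\Theta$ for every $x$. There are $C,B\ge0$ and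 an integer $n\ge1$ with $\|\partial_\theta g(\theta,x)\|\le C\|x\|^n+B$ for all $\theta\in\Theta$, $x\in\mathbb R^d$. The Hessian $\partial_x^2g$ is continuous on $\Theta\times\mathbb R^d$. There is $\mu_{\rm qg}>0$ such that for every $\theta\in\Theta$ the function $g(\theta,\cdot)$ attains its minimum and, for some $D>0$, $\tfrac{\mu_{\rm qg}}2\,\mathrm{dist}^2(x,\mathcal S(\theta))\le g(\theta,x)-\min_z g(\theta,z)$ whenever $\|x\|\ge D$. **Proposition.** There are an integer $k\ge 0$ and a constant $\kappa>0$, both independent of $\theta$, such that for every $\theta\in\Theta$ the following holds. The set $\mathcal S(\theta)$ is a $k$-dimensional $C^2$ embedded submanifold of $\mathbb R^d$ without boundary; let $\mathcal M_\theta$ be its Riemannian volume measure for the metric induced from $\mathbb R^d$. The measures $\mu_\theta^\lambda(dx)=e^{-g(\theta,x)/\lambda}\,dx\,/\int_{\mathbb R^d} e^{-g(\theta,z)/\lambda}\,dz$, $\lambda>0$, are probability measures that converge weakly, as $\lambda\downarrow0$, to a probability measure $\mu_\theta^0$ (the limiting Gibbs measure), and $\mu^0_\theta(dx)=\rho_\theta(x)\,\mathcal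 M_\theta(dx)$ with $$\rho_\theta(x)=\frac{\det\!\big(\partial_t^2\, g(\theta,y(x,t))|_{t=0}\big)^{-1/2}}{\int_{\mathcal S(\theta)}\det\!\big(\partial_t^2\, g(\theta,y(v,t))|_{t=0}\big)^{-1/2}\,d\mathcal M_\theta(v)},\qquad y(x,t)=x+\sum_{j=1}^{d-k}t_je^{(j)}(x),$$ where $e^{(1)}(x),\dots,e^{(d-k)}(x)$ is any orthonormal basis of the normal space $(T_x\mathcal S(\theta))^\perp$. Moreover $$\kappa\le\rho_\theta(x)\le 1/\kappa\qquad\text{for all }x\in\mathcal S(\theta),\ \theta\in\Theta .$$ -/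

import Mathlib

open MeasureTheory Set Filter Topology

noncomputable section

/-! ### The local Polyak-Lojasiewicz condition -/

/-- The Hessian `∇²h(x)` of `h`, as a bilinear form. -/
def hess {E : Type*} [NormedAddCommGroup E] [NormedSpace ℝ E] (h : E → ℝ) (x : E) :
    E →L[ℝ] E →L[ℝ] ℝ :=
  fderiv ℝ (fderiv ℝ h) x

/-- The set of all local minima of `h`. -/
def localMinima {d : ℕ} (h : EuclideanSpace ℝ (Fin d) → ℝ) : Set (EuclideanSpace ℝ (Fin d)) :=
  {x | IsLocalMin h x}

/-- The connected components of a set `A`. -/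
def componentsOf {X : Type*} [TopologicalSpace X] (A : Set X) : Set (Set X) :=
  {C | ∃ x ∈ A, C = connectedComponentIn A x}

/-- `h - min_N h ≤ (2μ)⁻¹ ‖∇h‖²` on the set `N`, where the minimum over `N` is attained. -/
def PLInequalityOn {d : ℕ} (h : EuclideanSpace ℝ (Fin d) → ℝ) (μ : ℝ)
    (N : Set (EuclideanSpace ℝ (Fin d))) : Prop :=
  ∃ c : ℝ, IsLeast (h '' N) c ∧ ∀ x ∈ N, h x - c ≤ (2 * μ)⁻¹ * ‖gradient h x‖ ^ 2

/-- The `PL°` condition for `h : ℝᵈ → ℝ`. Here `N C` is the open neighbourhood attached to the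
connected component `C` of the set of local minima. -/
def PLCirc {d : ℕ} (h : EuclideanSpace ℝ (Fin d) → ℝ) : Prop :=
  ContDiff ℝ 2 h ∧
  (∃ μ : ℝ, 0 < μ ∧ ∃ N : Set (EuclideanSpace ℝ (Fin d)) → Set (EuclideanSpace ℝ (Fin d)),
    (∀ C ∈ componentsOf (localMinima h),
      IsOpen (N C) ∧ C ⊆ N C ∧ PLInequalityOn h μ (N C) ∧ ContDiffOn ℝ 4 h (N C)) ∧
    (∀ x, x ∉ ⋃ C ∈ componentsOf (localMinima h), N C → gradient h x = 0 →
      ∀ v, v ≠ 0 → hess h x v v < 0)) ∧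
  (∃ K : Set (EuclideanSpace ℝ (Fin d)), IsCompact K ∧ localMinima h ⊆ K)

/-! ### The parametrized lower-level objective -/

/-- The set of global minimizers of `h`. -/
def argminSet {E : Type*} (h : E → ℝ) : Set E := {x | ∀ z, h x ≤ h z}

/-- The regularity assumptions on the lower-level objective `g(θ, x)`, `θ ∈ Θ`, `x ∈ ℝᵈ`. -/
structure LowerLevelRegular {m d : ℕ} (Θ : Set (EuclideanSpace ℝ (Fin m)))
    (g : EuclideanSpace ℝ (Fin m) → EuclideanSpace ℝ (Fin d) → ℝ) : Prop where
  /-- `g` is jointly `C²` (near every point of `Θ × ℝᵈ`). -/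
  contDiffAt : ∀ θ ∈ Θ, ∀ x, ContDiffAt ℝ 2 (Function.uncurry g) (θ, x)
  /-- `g(·, x)` is `L`-smooth on `Θ`, with `L` independent of `x`. -/
  smooth_theta : ∃ L : ℝ, ∀ x, ∀ θ₁ ∈ Θ, ∀ θ₂ ∈ Θ,
    ‖gradient (fun τ => g τ x) θ₁ - gradient (fun τ => g τ x) θ₂‖ ≤ L * ‖θ₁ - θ₂‖
  /-- `∂_θ g` grows at most polynomially in `x`. -/
  growth_theta : ∃ (C B : ℝ) (n : ℕ), 0 ≤ C ∧ 0 ≤ B ∧ 1 ≤ n ∧ ∀ θ ∈ Θ, ∀ x,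
    ‖gradient (fun τ => g τ x) θ‖ ≤ C * ‖x‖ ^ n + B
  /-- The Hessian `∂ₓ²g` is continuous in `(θ, x)`. -/
  continuousOn_hess : ContinuousOn
    (fun p : EuclideanSpace ℝ (Fin m) × EuclideanSpace ℝ (Fin d) => hess (g p.1) p.2)
    (Θ ×ˢ univ)
  /-- `g(θ, ·)` attains its minimum `c`, and grows quadratically outside a ball. -/
  quadratic_growth : ∃ μ : ℝ, 0 < μ ∧ ∀ θ ∈ Θ, ∃ c : ℝ, IsLeast (range (g θ)) c ∧
    ∃ D : ℝ, 0 < D ∧ ∀ x, D ≤ ‖x‖ →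
      μ * Metric.infDist x (argminSet (g θ)) ^ 2 / 2 ≤ g θ x - c

/-! ### Embedded submanifolds of `ℝᵈ` and their Riemannian volume -/

/-- `ψ` restricted to the open set `U ⊆ ℝᵏ` is a `C²` local parametrization of `S ⊆ ℝᵈ`:
a `C²` immersion, and a homeomorphism onto a relatively open subset of `S`. -/
structure IsLocalParam {k d : ℕ} (S : Set (EuclideanSpace ℝ (Fin d)))
    (U : Set (EuclideanSpace ℝ (Fin k)))
    (ψ : EuclideanSpace ℝ (Fin k) → EuclideanSpace ℝ (Fin d)) : Prop where
  isOpen : IsOpen U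
  contDiffOn : ContDiffOn ℝ 2 ψ U
  immersion : ∀ u ∈ U, Function.Injective (fderiv ℝ ψ u)
  isEmbedding : IsEmbedding (fun u : U => ψ u)
  image_eq : ∃ V : Set (EuclideanSpace ℝ (Fin d)), IsOpen V ∧ ψ '' U = S ∩ V

/-- `S` is a `k`-dimensional `C²` embedded submanifold of `ℝᵈ` without boundary. -/
def IsEmbeddedSubmanifold {d : ℕ} (k : ℕ) (S : Set (EuclideanSpace ℝ (Fin d))) : Prop :=
  ∀ x ∈ S, ∃ (U : Set (EuclideanSpace ℝ (Fin k)))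
    (ψ : EuclideanSpace ℝ (Fin k) → EuclideanSpace ℝ (Fin d)),
    IsLocalParam S U ψ ∧ x ∈ ψ '' U

/-- The matrix, in the coordinates given by `ψ`, of the metric induced by the Euclidean one. -/
def inducedMetric {k d : ℕ} (ψ : EuclideanSpace ℝ (Fin k) → EuclideanSpace ℝ (Fin d))
    (u : EuclideanSpace ℝ (Fin k)) : Matrix (Fin k) (Fin k) ℝ :=
  Matrix.of fun i j =>
    inner ℝ (fderiv ℝ ψ u (EuclideanSpace.single i 1)) (fderiv ℝ ψ u (EuclideanSpace.single j 1))

/-- `M` is the Riemannian volume of the `k`-dimensional submanifold `S ⊆ ℝᵈ` with the induced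
metric, as a Borel measure on `ℝᵈ` carried by `S`: in every local parametrization it is
`√(det 𝗀(u)) du`. Since `S` is covered by countably many coordinate patches, this determines `M`. -/
structure IsRiemannianVolume {d : ℕ} (k : ℕ) (S : Set (EuclideanSpace ℝ (Fin d)))
    (M : Measure (EuclideanSpace ℝ (Fin d))) : Prop where
  compl_eq_zero : M Sᶜ = 0
  apply_image : ∀ (U : Set (EuclideanSpace ℝ (Fin k)))
    (ψ : EuclideanSpace ℝ (Fin k) → EuclideanSpace ℝ (Fin d)), IsLocalParam S U ψ →
    ∀ A : Set (EuclideanSpace ℝ (Fin k)), MeasurableSet A → A ⊆ U →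
      M (ψ '' A) = ∫⁻ u in A, ENNReal.ofReal √(inducedMetric ψ u).det

/-! ### The Gibbs measures and the density of their limit -/

/-- The tangent space of the submanifold `S` at `x` (for a submanifold the tangent cone is already
a linear subspace). -/
def tangentSpaceOf {d : ℕ} (S : Set (EuclideanSpace ℝ (Fin d))) (x : EuclideanSpace ℝ (Fin d)) :
    Submodule ℝ (EuclideanSpace ℝ (Fin d)) :=
  Submodule.span ℝ (tangentConeAt ℝ S x)

/-- The normal space of the submanifold `S` at `x`. -/
def normalSpaceOf {d : ℕ} (S : Set (EuclideanSpace ℝ (Fin d))) (x : EuclideanSpace ℝ (Fin d)) :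
    Submodule ℝ (EuclideanSpace ℝ (Fin d)) :=
  (tangentSpaceOf S x)ᗮ

/-- Normal coordinates at `x ∈ S`: `y(x, t) = x + ∑ⱼ tⱼ eⱼ(x)`, where the `eⱼ(x)` form an
orthonormal basis of the normal space. -/
def normalCoord {d : ℕ} (S : Set (EuclideanSpace ℝ (Fin d))) (x : EuclideanSpace ℝ (Fin d))
    (t : EuclideanSpace ℝ (Fin (Module.finrank ℝ (normalSpaceOf S x)))) :
    EuclideanSpace ℝ (Fin d) :=
  x + ∑ j, t j • (stdOrthonormalBasis ℝ (normalSpaceOf S x) j : EuclideanSpace ℝ (Fin d))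

/-- The determinant of the normal Hessian `∂ₜ² h(y(x, t))` at `t = 0`; it does not depend on the
choice of the orthonormal basis. -/
def normalHessianDet {d : ℕ} (h : EuclideanSpace ℝ (Fin d) → ℝ)
    (S : Set (EuclideanSpace ℝ (Fin d))) (x : EuclideanSpace ℝ (Fin d)) : ℝ :=
  (Matrix.of fun i j : Fin (Module.finrank ℝ (normalSpaceOf S x)) =>
    hess (fun t => h (normalCoord S x t)) 0
      (EuclideanSpace.single i 1) (EuclideanSpace.single j 1)).det

/-- The limiting Gibbs density at `x ∈ S` with respect to the volume measure `M` of `S`. -/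
def limitDensity {d : ℕ} (h : EuclideanSpace ℝ (Fin d) → ℝ)
    (S : Set (EuclideanSpace ℝ (Fin d))) (M : Measure (EuclideanSpace ℝ (Fin d)))
    (x : EuclideanSpace ℝ (Fin d)) : ℝ :=
  normalHessianDet h S x ^ (-(1 / 2) : ℝ) /
    ∫ v in S, normalHessianDet h S v ^ (-(1 / 2) : ℝ) ∂M

/-- The Gibbs measure at temperature `lam`, with Lebesgue density
`exp (-h / lam) / ∫ exp (-h / lam)`. -/
def gibbsMeasure {d : ℕ} (h : EuclideanSpace ℝ (Fin d) → ℝ) (lam : ℝ) :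
    Measure (EuclideanSpace ℝ (Fin d)) :=
  volume.withDensity fun x =>
    ENNReal.ofReal (Real.exp (-h x / lam) / ∫ z, Real.exp (-h z / lam))

/-- The probability measure `ν` is the weak limit, as `lam ↓ 0`, of the Gibbs measures of `h`,
which are probability measures. -/
structure IsLimitGibbsMeasure {d : ℕ} (h : EuclideanSpace ℝ (Fin d) → ℝ)
    (ν : Measure (EuclideanSpace ℝ (Fin d))) : Prop where
  isProbabilityMeasure : IsProbabilityMeasure ν
  isProbabilityMeasure_gibbs : ∀ lam : ℝ, 0 < lam → IsProbabilityMeasure (gibbsMeasure h lam)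
  tendsto : ∀ φ : BoundedContinuousFunction (EuclideanSpace ℝ (Fin d)) ℝ,
    Tendsto (fun lam : ℝ => ∫ x, φ x ∂(gibbsMeasure h lam)) (𝓝[>] 0) (𝓝 (∫ x, φ x ∂ν))

end

set_option maxSynthPendingDepth 3

noncomputable section

/-! ### Second-order Taylor expansion -/

section Taylor

variable {E : Type*} [NormedAddCommGroup E] [NormedSpace ℝ E] {f : E → ℝ}

/-! Fix `θ` and put `f = g θ`. A critical point in one of the PŁ neighbourhoods is a local minimum,
because the inequality makes it minimal there; every other critical point is a nondegenerate
maximum, hence isolated. Since `d ≥ 2`, the complement of these countably many maxima is path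
connected. A small-step gradient descent, applied to a path between two separated pieces of the set
of local minima, would split the path into two disjoint open basins; so the set of local minima is
connected (`isPreconnected_setOf_isLocalMin`). The PŁ inequality makes `f` locally constant on it,
so all local minima are global (`PLCirc.exists_isPLMin`).

To second order, the PŁ inequality says that a Hessian eigenvalue at a minimizer is either zero or
at least a fixed positive constant (`IsPLMin.gap`). Solving for the vanishing of the partial
gradient in the positive directions gives a graph; along it the reduced function has a gradient with
small Lipschitz constant, and the PŁ inequality forces it to be constant (`exists_graph_of_PL`). So
the minimizers form a submanifold whose tangent space is the kernel of the Hessian, with dimension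
constant by connectedness.

Laplace's method is carried out fibre by fibre over such graphs, with `σ = √λ`. It produces the
determinant of the Hessian in the fibre directions; `det_bilinMatrix_eq_mul` relates it to the
normal Hessian determinant by exactly the Gram determinant of the chart, so the limit is an integral
against the Riemannian volume. Taking the quotient with the case `φ = 1` gives the limiting Gibbs
measure.

Uniformity in `θ` is local by compactness. Let `f₀ = g θ₀`, with minimizers `S₀`, and let `f` be
close to `f₀` near `S₀` in value and Hessian (`NearMin`). The determinants are controlled by Hessian
bounds, so what remains is the normalizing constant, which is itself a limit of rescaled Laplace
integrals. An upper bound follows from uniform convexity in the normal directions. A lower bound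
needs `f` to have enough minimizers: maximize over `p ∈ S₀` the minimum of `f` on the normal disk at
`p`. The extremal point is critical for `f` and has a direction of positive curvature, so it is a
global minimizer; as the largest disk minimum is then `min f`, every normal disk contains a
minimizer (`NearMin.exists_mem_disk`). The lower bound also excludes a drop of dimension, since a
smaller kernel would make the integrals decay faster. Hence the dimension is locally constant in
`θ`, and constant because `Θ` is convex. -/

theorem hasFDerivAt_fderiv_of_contDiff_two (hf : ContDiff ℝ 2 f) (x : E) :
    HasFDerivAt (fderiv ℝ f) (hess f x) x :=
  (((hf.fderiv_right (m := 1) (by norm_num)).differentiable (by norm_num)) x).hasFDerivAt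

theorem continuous_hess (hf : ContDiff ℝ 2 f) : Continuous (hess f) :=
  (hf.fderiv_right (m := 1) (by norm_num)).continuous_fderiv (by norm_num)

theorem hess_comm (hf : ContDiff ℝ 2 f) (x v w : E) : hess f x v w = hess f x w v :=
  (hf.contDiffAt.isSymmSndFDerivAt (by simp)) v w

theorem hasDerivAt_comp_add_smul (hf : Differentiable ℝ f) (x z : E) (t : ℝ) :
    HasDerivAt (fun s : ℝ => f (x + s • z)) (fderiv ℝ f (x + t • z) z) t := by
  have h1 : HasDerivAt (fun s : ℝ => x + s • z) z t := by
    simpa using ((hasDerivAt_id t).smul_const z).const_add x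
  exact (hf (x + t • z)).hasFDerivAt.comp_hasDerivAt t h1

/-- Taylor's formula of order two with the Lagrange remainder. -/
theorem exists_taylor_two (hf : ContDiff ℝ 2 f) (x z : E) :
    ∃ ξ ∈ Ioo (0 : ℝ) 1,
      f (x + z) = f x + fderiv ℝ f x z + (1 / 2) * hess f (x + ξ • z) z z := by
  have hd : Differentiable ℝ f := hf.differentiable (by norm_num)
  have h1 := hasDerivAt_comp_add_smul hd x z
  have h2 : ∀ t : ℝ, HasDerivAt (fun s : ℝ => fderiv ℝ f (x + s • z) z)
      (hess f (x + t • z) z z) t := by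
    intro t
    have h3 : HasDerivAt (fun s : ℝ => x + s • z) z t := by
      simpa using ((hasDerivAt_id t).smul_const z).const_add x
    have h4 := (hasFDerivAt_fderiv_of_contDiff_two hf (x + t • z)).comp_hasDerivAt t h3
    exact (ContinuousLinearMap.apply ℝ ℝ z).hasFDerivAt.comp_hasDerivAt t h4
  set A : ℝ := f (x + z) - f x - fderiv ℝ f x z with hA
  -- Rolle's theorem is applied to this function of `s`: the choice of `A` makes it take the value
  -- `f (x + z)` at both `0` and `1`.
  have h5 : ∀ t : ℝ, HasDerivAt
      (fun s : ℝ => f (x + s • z) + fderiv ℝ f (x + s • z) z * (1 - s) + A * (1 - s) ^ 2)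
      (hess f (x + t • z) z z * (1 - t) - 2 * A * (1 - t)) t := by
    intro t
    have h6 : HasDerivAt (fun s : ℝ => 1 - s) (-1) t := by
      simpa using (hasDerivAt_id t).const_sub 1
    have h7 := ((h1 t).add ((h2 t).mul h6)).add ((h6.pow 2).const_mul A)
    convert! h7 using 1
    ring
  obtain ⟨ξ, hξ, h0⟩ := exists_hasDerivAt_eq_zero (a := 0) (b := 1) one_pos
    (fun t _ => (h5 t).continuousAt.continuousWithinAt) (by simp [hA]) (fun t _ => h5 t)
  refine ⟨ξ, hξ, ?_⟩
  have h8 : (1 - ξ) ≠ 0 := by linarith [hξ.2]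
  have h9 : hess f (x + ξ • z) z z = 2 * A := by
    apply mul_right_cancel₀ h8; linarith
  rw [h9, hA]; ring

theorem add_smul_mem_of_convex {s : Set E} (hs : Convex ℝ s) {x z : E} (hx : x ∈ s)
    (hz : x + z ∈ s) {ξ : ℝ} (hξ : ξ ∈ Ioo (0 : ℝ) 1) : x + ξ • z ∈ s := by
  have := hs.add_smul_mem hx hz ⟨hξ.1.le, hξ.2.le⟩
  simpa using this

theorem taylor_two_lower (hf : ContDiff ℝ 2 f) {x z : E} {m : ℝ}
    (h : ∀ ξ ∈ Ioo (0 : ℝ) 1, m ≤ hess f (x + ξ • z) z z) :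
    f x + fderiv ℝ f x z + m / 2 ≤ f (x + z) := by
  obtain ⟨ξ, hξ, h1⟩ := exists_taylor_two hf x z
  linarith [h ξ hξ]

theorem taylor_two_upper (hf : ContDiff ℝ 2 f) {x z : E} {m : ℝ}
    (h : ∀ ξ ∈ Ioo (0 : ℝ) 1, hess f (x + ξ • z) z z ≤ m) :
    f (x + z) ≤ f x + fderiv ℝ f x z + m / 2 := by
  obtain ⟨ξ, hξ, h1⟩ := exists_taylor_two hf x z
  linarith [h ξ hξ]

theorem hess_apply_le (x v w : E) : hess f x v w ≤ ‖hess f x‖ * ‖v‖ * ‖w‖ :=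
  (le_abs_self _).trans ((hess f x).le_opNorm₂ v w)

/-- The quotient `(f (x + σ z) - f x) / σ²` tends to half the second derivative at a critical
point. -/
theorem tendsto_taylor_quotient (hf : ContDiff ℝ 2 f) {x : E} (hx : fderiv ℝ f x = 0) (z : E) :
    Tendsto (fun σ : ℝ => (f (x + σ • z) - f x) / σ ^ 2) (𝓝[>] 0)
      (𝓝 ((1 / 2) * hess f x z z)) := by
  choose ξ hξ h1 using fun σ : ℝ => exists_taylor_two hf x (σ • z)
  have h2 : Tendsto (fun σ : ℝ => x + ξ σ • σ • z) (𝓝[>] 0) (𝓝 x) := by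
    have h3 : Tendsto (fun σ : ℝ => ξ σ • σ • z) (𝓝[>] 0) (𝓝 0) := by
      have h4 : Tendsto (fun σ : ℝ => |σ| * ‖z‖) (𝓝[>] 0) (𝓝 0) := by
        have : Continuous (fun σ : ℝ => |σ| * ‖z‖) := by fun_prop
        simpa using (this.tendsto 0).mono_left nhdsWithin_le_nhds
      refine squeeze_zero_norm (fun σ => ?_) h4
      rw [norm_smul, norm_smul, Real.norm_eq_abs, Real.norm_eq_abs, abs_of_pos (hξ σ).1]
      exact mul_le_of_le_one_left (by positivity) (hξ σ).2.le
    simpa using h3.const_add x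
  have h5 : Tendsto (fun σ : ℝ => (1 / 2) * hess f (x + ξ σ • σ • z) z z) (𝓝[>] 0)
      (𝓝 ((1 / 2) * hess f x z z)) := by
    have h6 := ((continuous_hess hf).tendsto x).comp h2
    have h7 := ((ContinuousLinearMap.apply ℝ (E →L[ℝ] ℝ) z).continuous.tendsto _).comp h6
    have h8 := ((ContinuousLinearMap.apply ℝ ℝ z).continuous.tendsto _).comp h7
    exact h8.const_mul (1 / 2)
  refine h5.congr' ?_
  filter_upwards [self_mem_nhdsWithin] with σ hσ
  have hσ : 0 < σ := hσ
  rw [h1 σ, hx]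
  simp
  field_simp

end Taylor

/-! ### Orthogonal frames -/

/-- An isometric splitting of `ℝᵈ` as an orthogonal sum of `ℝᵏ` and `ℝⁿ`: the embeddings `I`, `J`
and their adjoints. -/
structure OrthFrame (k n d : ℕ) where
  I : EuclideanSpace ℝ (Fin k) →L[ℝ] EuclideanSpace ℝ (Fin d)
  J : EuclideanSpace ℝ (Fin n) →L[ℝ] EuclideanSpace ℝ (Fin d)
  I' : EuclideanSpace ℝ (Fin d) →L[ℝ] EuclideanSpace ℝ (Fin k)
  J' : EuclideanSpace ℝ (Fin d) →L[ℝ] EuclideanSpace ℝ (Fin n)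
  I'_I : ∀ u, I' (I u) = u
  J'_J : ∀ v, J' (J v) = v
  I'_J : ∀ v, I' (J v) = 0
  J'_I : ∀ u, J' (I u) = 0
  sum_eq : ∀ x, I (I' x) + J (J' x) = x
  inner_I : ∀ u x, inner ℝ (I u) x = inner ℝ u (I' x)
  inner_J : ∀ v x, inner ℝ (J v) x = inner ℝ v (J' x)

namespace OrthFrame

variable {k n d : ℕ} (F : OrthFrame k n d)

theorem norm_I (u : EuclideanSpace ℝ (Fin k)) : ‖F.I u‖ = ‖u‖ := by
  have : ‖F.I u‖ ^ 2 = ‖u‖ ^ 2 := by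
    rw [← real_inner_self_eq_norm_sq, ← real_inner_self_eq_norm_sq, F.inner_I, F.I'_I]
  exact (pow_left_inj₀ (norm_nonneg _) (norm_nonneg _) two_ne_zero).1 this

theorem norm_J (v : EuclideanSpace ℝ (Fin n)) : ‖F.J v‖ = ‖v‖ := by
  have : ‖F.J v‖ ^ 2 = ‖v‖ ^ 2 := by
    rw [← real_inner_self_eq_norm_sq, ← real_inner_self_eq_norm_sq, F.inner_J, F.J'_J]
  exact (pow_left_inj₀ (norm_nonneg _) (norm_nonneg _) two_ne_zero).1 this

theorem norm_sq (x : EuclideanSpace ℝ (Fin d)) : ‖x‖ ^ 2 = ‖F.I' x‖ ^ 2 + ‖F.J' x‖ ^ 2 := by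
  rw [← real_inner_self_eq_norm_sq x]
  conv_lhs => rw [← F.sum_eq x]
  rw [inner_add_left, F.inner_I, F.inner_J, F.sum_eq, real_inner_self_eq_norm_sq,
    real_inner_self_eq_norm_sq]

theorem norm_I'_le (x : EuclideanSpace ℝ (Fin d)) : ‖F.I' x‖ ≤ ‖x‖ :=
  abs_le_of_sq_le_sq' (by linarith [F.norm_sq x, sq_nonneg ‖F.J' x‖]) (norm_nonneg _) |>.2

theorem norm_J'_le (x : EuclideanSpace ℝ (Fin d)) : ‖F.J' x‖ ≤ ‖x‖ :=
  abs_le_of_sq_le_sq' (by linarith [F.norm_sq x, sq_nonneg ‖F.I' x‖]) (norm_nonneg _) |>.2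

theorem dim_eq {k n d : ℕ} (F : OrthFrame k n d) : k + n = d := by
  let e : (EuclideanSpace ℝ (Fin k) × EuclideanSpace ℝ (Fin n)) ≃ₗ[ℝ] EuclideanSpace ℝ (Fin d) :=
    { toFun := fun p => F.I p.1 + F.J p.2
      invFun := fun x => (F.I' x, F.J' x)
      map_add' := fun p q => by simp only [Prod.fst_add, Prod.snd_add, map_add]; abel
      map_smul' := fun c p => by simp
      left_inv := fun p => by simp [F.I'_I, F.J'_J, F.I'_J, F.J'_I]
      right_inv := fun x => F.sum_eq x }
  simpa using e.finrank_eq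

/-- The splitting as a linear isometry. -/
def isometryEquiv : EuclideanSpace ℝ (Fin d) ≃ₗᵢ[ℝ]
    WithLp 2 (EuclideanSpace ℝ (Fin k) × EuclideanSpace ℝ (Fin n)) where
  toFun x := WithLp.toLp 2 (F.I' x, F.J' x)
  invFun p := F.I p.fst + F.J p.snd
  map_add' x y := by simp [← WithLp.toLp_add]
  map_smul' c x := by simp [← WithLp.toLp_smul]
  left_inv x := F.sum_eq x
  right_inv p := by simp [F.I'_I, F.J'_J, F.I'_J, F.J'_I]; rfl
  norm_map' x := by
    have h : ‖WithLp.toLp 2 (F.I' x, F.J' x)‖ ^ 2 = ‖x‖ ^ 2 := by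
      rw [WithLp.prod_norm_sq_eq_of_L2, F.norm_sq x]; rfl
    exact (pow_left_inj₀ (norm_nonneg _) (norm_nonneg _) two_ne_zero).1 h

theorem measurePreserving : MeasurePreserving
    (fun p : EuclideanSpace ℝ (Fin k) × EuclideanSpace ℝ (Fin n) => F.I p.1 + F.J p.2) :=
  (F.isometryEquiv.symm.measurePreserving).comp (WithLp.volume_preserving_toLp _ _)

theorem measurableEmbedding : MeasurableEmbedding
    (fun p : EuclideanSpace ℝ (Fin k) × EuclideanSpace ℝ (Fin n) => F.I p.1 + F.J p.2) := by
  have h1 : Continuous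
      (fun p : EuclideanSpace ℝ (Fin k) × EuclideanSpace ℝ (Fin n) => F.I p.1 + F.J p.2) := by
    fun_prop
  refine h1.measurableEmbedding fun p q h => ?_
  have h2 := congrArg F.I' h
  have h3 := congrArg F.J' h
  simp only [map_add, F.I'_I, F.J'_J, F.I'_J, F.J'_I, add_zero, zero_add] at h2 h3
  exact Prod.ext h2 h3

theorem lintegral_eq {φ : EuclideanSpace ℝ (Fin d) → ENNReal} (hφ : Measurable φ) :
    ∫⁻ x, φ x = ∫⁻ u, ∫⁻ v, φ (F.I u + F.J v) := by
  rw [← F.measurePreserving.lintegral_comp hφ, Measure.volume_eq_prod, lintegral_prod]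
  exact (hφ.comp F.measurePreserving.measurable).aemeasurable

theorem integrable_comp {φ : EuclideanSpace ℝ (Fin d) → ℝ} (hφ : Integrable φ) :
    Integrable (fun p : EuclideanSpace ℝ (Fin k) × EuclideanSpace ℝ (Fin n) =>
      φ (F.I p.1 + F.J p.2)) (volume.prod volume) :=
  F.measurePreserving.integrable_comp_of_integrable hφ

theorem integral_eq {φ : EuclideanSpace ℝ (Fin d) → ℝ} (hφ : Integrable φ) :
    ∫ x, φ x = ∫ u, ∫ v, φ (F.I u + F.J v) := by
  rw [← F.measurePreserving.integral_comp F.measurableEmbedding, Measure.volume_eq_prod,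
    integral_prod]
  exact F.integrable_comp hφ

end OrthFrame

/-- A subspace of dimension `k` of `ℝᵈ` and its orthogonal complement give a frame. -/
theorem exists_orthFrame {k n d : ℕ} (T : Submodule ℝ (EuclideanSpace ℝ (Fin d)))
    (hT : Module.finrank ℝ T = k) (hn : k + n = d) :
    ∃ F : OrthFrame k n d, (∀ x, x ∈ T ↔ F.J' x = 0) ∧ (∀ x, x ∈ Tᗮ ↔ F.I' x = 0) := by
  have hT' : Module.finrank ℝ Tᗮ = n := by
    have := T.finrank_add_finrank_orthogonal
    simp only [finrank_euclideanSpace, Fintype.card_fin] at this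
    omega
  subst hT hT'
  let a := (stdOrthonormalBasis ℝ T).repr
  let b := (stdOrthonormalBasis ℝ Tᗮ).repr
  refine ⟨{
    I := T.subtypeL ∘L (a.symm.toContinuousLinearEquiv : _ →L[ℝ] T)
    J := Tᗮ.subtypeL ∘L (b.symm.toContinuousLinearEquiv : _ →L[ℝ] Tᗮ)
    I' := (a.toContinuousLinearEquiv : T →L[ℝ] _) ∘L T.orthogonalProjectionOnto
    J' := (b.toContinuousLinearEquiv : Tᗮ →L[ℝ] _) ∘L Tᗮ.orthogonalProjectionOnto
    I'_I := fun u => by simp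
    J'_J := fun u => by simp
    I'_J := fun v => by
      simp [Submodule.orthogonalProjectionOnto_apply_of_mem_orthogonal]
    J'_I := fun u => by
      simp [Submodule.orthogonalProjectionOnto_orthogonal_apply_eq_zero]
    sum_eq := fun x => by simp
    inner_I := fun u x => ?_
    inner_J := fun v x => ?_ }, fun x => ?_, fun x => ?_⟩
  · simp only [ContinuousLinearMap.comp_apply, ContinuousLinearEquiv.coe_coe,
      LinearIsometryEquiv.coe_toContinuousLinearEquiv, Submodule.subtypeL_apply]
    rw [← Submodule.inner_orthogonalProjectionOnto_eq_of_mem_left, ← a.inner_map_map]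
    simp
  · simp only [ContinuousLinearMap.comp_apply, ContinuousLinearEquiv.coe_coe,
      LinearIsometryEquiv.coe_toContinuousLinearEquiv, Submodule.subtypeL_apply]
    rw [← Submodule.inner_orthogonalProjectionOnto_eq_of_mem_left, ← b.inner_map_map]
    simp
  · simp only [ContinuousLinearMap.comp_apply, ContinuousLinearEquiv.coe_coe,
      LinearIsometryEquiv.coe_toContinuousLinearEquiv, map_eq_zero_iff _ b.injective]
    rw [Submodule.orthogonalProjectionOnto_eq_zero_iff, Submodule.orthogonal_orthogonal]
  · simp only [ContinuousLinearMap.comp_apply, ContinuousLinearEquiv.coe_coe,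
      LinearIsometryEquiv.coe_toContinuousLinearEquiv, map_eq_zero_iff _ a.injective]
    rw [Submodule.orthogonalProjectionOnto_eq_zero_iff]

/-! ### The Riesz map in coordinates -/

/-- The vector representing a linear form on `ℝⁿ`. -/
def rieszVec (n : ℕ) : (EuclideanSpace ℝ (Fin n) →L[ℝ] ℝ) →L[ℝ] EuclideanSpace ℝ (Fin n) :=
  LinearMap.toContinuousLinearMap
    { toFun := fun L => WithLp.toLp 2 fun i => L (EuclideanSpace.single i 1)
      map_add' := fun L M => by ext i; simp
      map_smul' := fun c L => by ext i; simp }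

theorem inner_rieszVec {n : ℕ} (L : EuclideanSpace ℝ (Fin n) →L[ℝ] ℝ)
    (v : EuclideanSpace ℝ (Fin n)) : inner ℝ (rieszVec n L) v = L v := by
  have h : v = ∑ i, v i • EuclideanSpace.single i (1 : ℝ) := by
    ext j
    simp [Finset.sum_apply, Pi.single_apply]
  conv_rhs => rw [h]
  simp [rieszVec, PiLp.inner_apply]

theorem innerSL_rieszVec {n : ℕ} (L : EuclideanSpace ℝ (Fin n) →L[ℝ] ℝ) :
    innerSL ℝ (rieszVec n L) = L := by
  ext v; exact inner_rieszVec L v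

theorem norm_rieszVec {n : ℕ} (L : EuclideanSpace ℝ (Fin n) →L[ℝ] ℝ) : ‖rieszVec n L‖ = ‖L‖ := by
  rw [← innerSL_rieszVec L, innerSL_apply_norm, innerSL_rieszVec]

/-! ### The set of minimizers of a Polyak-Lojasiewicz function is locally a graph -/

/-- A nonnegative function whose gradient is small compared with the constant in the
Polyak-Lojasiewicz inequality vanishes. -/
theorem eq_zero_of_lipschitz_gradient {k : ℕ} {q : EuclideanSpace ℝ (Fin k) → ℝ}
    {γ : EuclideanSpace ℝ (Fin k) → EuclideanSpace ℝ (Fin k)} {u₀ : EuclideanSpace ℝ (Fin k)}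
    {ρ ε μ : ℝ} (hε : 0 < ε) (hμ : 0 ≤ μ) (hεμ : 4 * ε * μ < 1)
    (hq : ∀ u ∈ Metric.ball u₀ ρ, HasFDerivAt q (innerSL ℝ (γ u)) u)
    (hnonneg : ∀ u ∈ Metric.ball u₀ ρ, 0 ≤ q u) (hγ₀ : γ u₀ = 0)
    (hL : ∀ u ∈ Metric.ball u₀ ρ, ∀ v ∈ Metric.ball u₀ ρ, ‖γ u - γ v‖ ≤ ε * ‖u - v‖)
    (hPL : ∀ u ∈ Metric.ball u₀ ρ, q u ≤ μ * ‖γ u‖ ^ 2) :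
    ∀ u ∈ Metric.ball u₀ (ρ / 2), q u = 0 := by
  intro u hu
  have hu' : ‖u - u₀‖ < ρ / 2 := by simpa [dist_eq_norm] using hu
  have hρ : 0 < ρ := by linarith [norm_nonneg (u - u₀)]
  have huρ : u ∈ Metric.ball u₀ ρ := by simp [dist_eq_norm]; linarith
  have h0ρ : u₀ ∈ Metric.ball u₀ ρ := Metric.mem_ball_self hρ
  have h1 : ‖γ u‖ ≤ ε * ‖u - u₀‖ := by simpa [hγ₀] using hL u huρ u₀ h0ρ
  -- One gradient step of length `1 / (2ε)`. As `‖γ u‖ ≤ ε ‖u - u₀‖`, it moves by at most half of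
  -- `‖u - u₀‖` and stays in the larger ball. It lowers `q` by at least `‖γ u‖² / (4ε)`, so `q ≥ 0`
  -- gives `‖γ u‖² ≤ 4 ε q u`, which contradicts the PŁ inequality unless `q u = 0`.
  set y := u - (1 / (2 * ε)) • γ u with hy
  have hyu : y - u = -((1 / (2 * ε)) • γ u) := by rw [hy]; abel
  have hyn : ‖y - u‖ = ‖γ u‖ / (2 * ε) := by
    rw [hyu, norm_neg, norm_smul, Real.norm_eq_abs, abs_of_pos (by positivity)]; ring
  have hyn' : ‖y - u‖ ≤ ‖u - u₀‖ / 2 := by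
    rw [hyn, div_le_iff₀ (by positivity)]; nlinarith
  have hyρ : y ∈ Metric.ball u₀ ρ := by
    rw [Metric.mem_ball, dist_eq_norm]
    calc ‖y - u₀‖ = ‖(y - u) + (u - u₀)‖ := by congr 1; abel
      _ ≤ ‖y - u‖ + ‖u - u₀‖ := norm_add_le _ _
      _ < ρ := by linarith
  have hseg : segment ℝ u y ⊆ Metric.ball u₀ ρ := (convex_ball u₀ ρ).segment_subset huρ hyρ
  have h2 : ‖q y - q u - innerSL ℝ (γ u) (y - u)‖ ≤ (ε * ‖y - u‖) * ‖y - u‖ := by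
    refine (convex_segment u y).norm_image_sub_le_of_norm_hasFDerivWithin_le'
      (f' := fun z => innerSL ℝ (γ z)) (fun z hz => (hq z (hseg hz)).hasFDerivWithinAt)
      (fun z hz => ?_) (left_mem_segment _ _ _) (right_mem_segment _ _ _)
    rw [← map_sub, innerSL_apply_norm]
    refine (hL z (hseg hz) u huρ).trans ?_
    refine mul_le_mul_of_nonneg_left ?_ hε.le
    obtain ⟨a, b, ha, hb, hab, rfl⟩ := hz
    have : a • u + b • y - u = b • (y - u) := by
      have : a = 1 - b := by linarith
      rw [this]; module
    rw [this, norm_smul, Real.norm_eq_abs, abs_of_nonneg hb]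
    exact mul_le_of_le_one_left (norm_nonneg _) (by linarith)
  have h3 : innerSL ℝ (γ u) (y - u) = -(‖γ u‖ ^ 2 / (2 * ε)) := by
    rw [hyu, innerSL_apply_apply, inner_neg_right, inner_smul_right, real_inner_self_eq_norm_sq]
    ring
  rw [h3, hyn, Real.norm_eq_abs] at h2
  have h4 := (abs_le.1 h2).2
  have h5 : ε * (‖γ u‖ / (2 * ε)) * (‖γ u‖ / (2 * ε)) = ‖γ u‖ ^ 2 / (2 * ε) / 2 := by
    field_simp
  have h6 : ‖γ u‖ ^ 2 / (2 * ε) / 2 ≤ q u := by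
    have := hnonneg y hyρ
    linarith
  have h7 : ‖γ u‖ ^ 2 ≤ 4 * ε * q u := by
    rw [div_div, div_le_iff₀ (by positivity)] at h6; linarith
  have h8 := hPL u huρ
  have h9 : q u ≤ (4 * ε * μ) * q u := h8.trans (by nlinarith)
  have h10 := hnonneg u huρ
  nlinarith

/-- A Lyapunov-Schmidt reduction. Positivity along `F.J` lets the inverse function theorem solve for
the zeros of the `F.J`-part of the gradient as a graph `ψ` over `F.I`. Along `ψ` the whole gradient
has derivative zero at the base point, so the reduced function `f ∘ ψ - c` has a gradient with
arbitrarily small Lipschitz constant near it, and `eq_zero_of_lipschitz_gradient` applies. -/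
theorem exists_graph_of_PL {k n d : ℕ} (F : OrthFrame k n d) {f : EuclideanSpace ℝ (Fin d) → ℝ}
    {c μ : ℝ} {x : EuclideanSpace ℝ (Fin d)} {W : Set (EuclideanSpace ℝ (Fin d))}
    (hW : IsOpen W) (hx : x ∈ W) (hf : ContDiffOn ℝ 4 f W) (hmin : ∀ y, c ≤ f y) (hfx : f x = c)
    (hμ : 0 ≤ μ) (hPL : ∀ y ∈ W, f y - c ≤ μ * ‖fderiv ℝ f y‖ ^ 2)
    (hpos : ∀ v, v ≠ 0 → 0 < hess f x (F.J v) (F.J v))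
    (hker : ∀ z, (∀ v, hess f x z (F.J v) = 0) → hess f x z = 0) :
    ∃ ρ > 0, ∃ w : EuclideanSpace ℝ (Fin k) → EuclideanSpace ℝ (Fin n),
      ContDiffOn ℝ 2 w (Metric.ball (F.I' x) ρ) ∧ w (F.I' x) = F.J' x ∧
      ∀ u ∈ Metric.ball (F.I' x) ρ, f (F.I u + F.J (w u)) = c := by
  have hfx4 : ContDiffAt ℝ 4 f x := hf.contDiffAt (hW.mem_nhds hx)
  have hD3 : ContDiffAt ℝ 3 (fderiv ℝ f) x := hfx4.fderiv_right (by norm_num)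
  have hDx : fderiv ℝ f x = 0 :=
    IsLocalMin.fderiv_eq_zero (Eventually.of_forall fun y => hfx ▸ hmin y)
  -- the map whose local inverse gives the graph
  let P : (EuclideanSpace ℝ (Fin d) →L[ℝ] ℝ) →L[ℝ] EuclideanSpace ℝ (Fin n) :=
    rieszVec n ∘L (ContinuousLinearMap.compL ℝ _ _ ℝ).flip F.J
  have hP : ∀ L v, inner ℝ (P L) v = L (F.J v) := fun L v => inner_rieszVec _ v
  let G : EuclideanSpace ℝ (Fin d) → EuclideanSpace ℝ (Fin d) :=
    fun y => F.I (F.I' y) + F.J (P (fderiv ℝ f y))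
  have hG3 : ContDiffAt ℝ 3 G x :=
    ((F.I.comp F.I').contDiff.contDiffAt).add ((F.J.comp P).contDiff.contDiffAt.comp x hD3)
  have hH : HasFDerivAt (fderiv ℝ f) (hess f x) x :=
    (hD3.differentiableAt (by norm_num)).hasFDerivAt
  let G' : EuclideanSpace ℝ (Fin d) →L[ℝ] EuclideanSpace ℝ (Fin d) :=
    F.I ∘L F.I' + F.J ∘L (P ∘L hess f x)
  have hG' : HasFDerivAt G G' x :=
    ((F.I.comp F.I').hasFDerivAt).add ((F.J.comp P).hasFDerivAt.comp x hH)
  have hinj : Function.Injective G' := by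
    rw [injective_iff_map_eq_zero]
    intro z hz
    have hz' : F.I (F.I' z) + F.J (P (hess f x z)) = 0 := hz
    have h1 : F.I' z = 0 := by simpa [F.I'_I, F.I'_J] using congrArg F.I' hz'
    have h2 : P (hess f x z) = 0 := by simpa [F.J'_I, F.J'_J] using congrArg F.J' hz'
    have h3 : z = F.J (F.J' z) := by
      conv_lhs => rw [← F.sum_eq z, h1, map_zero, zero_add]
    by_contra hne
    have h4 : F.J' z ≠ 0 := fun h => hne (by rw [h3, h, map_zero])
    have h5 := hpos _ h4
    rw [← h3, h3, ← hP, ← h3, h2, inner_zero_left] at h5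
    exact lt_irrefl _ h5
  let e : EuclideanSpace ℝ (Fin d) ≃L[ℝ] EuclideanSpace ℝ (Fin d) :=
    (LinearEquiv.ofInjectiveEndo (G' : _ →ₗ[ℝ] _) hinj).toContinuousLinearEquiv
  have he : HasFDerivAt G (e : _ →L[ℝ] _) x := by
    have : (e : EuclideanSpace ℝ (Fin d) →L[ℝ] EuclideanSpace ℝ (Fin d)) = G' := by
      ext1 z; rfl
    rw [this]; exact hG'
  have hGx : G x = F.I (F.I' x) := by simp [G, hDx]
  let Φ := hG3.toOpenPartialHomeomorph G he (by norm_num)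
  have hΦ : ∀ y, Φ y = G y := fun y => rfl
  have hxs : x ∈ Φ.source := hG3.mem_toOpenPartialHomeomorph_source he (by norm_num)
  have hinvC : ContDiffAt ℝ 3 Φ.symm (G x) := hG3.to_localInverse he (by norm_num)
  have hGt : G x ∈ Φ.target := Φ.map_source hxs
  have hinvx : Φ.symm (G x) = x := Φ.left_inv hxs
  set u₀ := F.I' x with hu₀
  have hψC : ContDiffAt ℝ 3 (fun u => Φ.symm (F.I u)) u₀ := by
    rw [hGx] at hinvC
    exact hinvC.comp u₀ F.I.contDiff.contDiffAt
  set ψ := fun u => Φ.symm (F.I u) with hψ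
  have hψx : ψ u₀ = x := by rw [← hinvx, hGx]
  -- near `u₀`
  have hev : ∀ᶠ u in 𝓝 u₀, ContDiffAt ℝ 2 ψ u ∧ ψ u ∈ W ∧ F.I u ∈ Φ.target := by
    have h1 : ∀ᶠ u in 𝓝 u₀, ContDiffAt ℝ 2 ψ u :=
      (hψC.of_le (by norm_num)).eventually (by norm_num)
    have h2 : ∀ᶠ u in 𝓝 u₀, ψ u ∈ W :=
      hψC.continuousAt.eventually_mem (by rw [hψx]; exact hW.mem_nhds hx)
    have h3 : ∀ᶠ u in 𝓝 u₀, F.I u ∈ Φ.target :=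
      F.I.continuous.continuousAt.eventually_mem
        (Φ.open_target.mem_nhds (by rw [← hGx]; exact hGt))
    exact h1.and (h2.and h3)
  have hGψ : ∀ u, F.I u ∈ Φ.target → F.I' (ψ u) = u ∧ P (fderiv ℝ f (ψ u)) = 0 := by
    intro u hu
    have h1 : F.I (F.I' (ψ u)) + F.J (P (fderiv ℝ f (ψ u))) = F.I u := Φ.right_inv hu
    exact ⟨by simpa [F.I'_I, F.I'_J] using congrArg F.I' h1,
      by simpa [F.J'_I, F.J'_J] using congrArg F.J' h1⟩
  obtain ⟨ρ₁, hρ₁, hball₁⟩ := Metric.eventually_nhds_iff_ball.1 hev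
  -- the derivative of `∇f ∘ ψ` vanishes at `u₀`
  have hstrict : HasStrictFDerivAt (fun u => fderiv ℝ f (ψ u))
      (0 : EuclideanSpace ℝ (Fin k) →L[ℝ] (EuclideanSpace ℝ (Fin d) →L[ℝ] ℝ)) u₀ := by
    have h1 : ContDiffAt ℝ 3 (fun u => fderiv ℝ f (ψ u)) u₀ := by
      have : ContDiffAt ℝ 3 (fderiv ℝ f) (ψ u₀) := by rw [hψx]; exact hD3
      exact this.comp u₀ hψC
    have h2 := h1.hasStrictFDerivAt (by norm_num)
    have h3 : fderiv ℝ (fun u => fderiv ℝ f (ψ u)) u₀ = 0 := by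
      have h4 : HasFDerivAt ψ (fderiv ℝ ψ u₀) u₀ :=
        (hψC.differentiableAt (by norm_num)).hasFDerivAt
      have hH' : HasFDerivAt (fderiv ℝ f) (hess f x) (ψ u₀) := by rw [hψx]; exact hH
      have h5 := hH'.comp u₀ h4
      have h6 : fderiv ℝ (fun u => fderiv ℝ f (ψ u)) u₀ = hess f x ∘L fderiv ℝ ψ u₀ := h5.fderiv
      rw [h6]
      ext1 z
      simp only [ContinuousLinearMap.comp_apply, zero_apply]
      -- Differentiating `P (fderiv ℝ f (ψ u)) = 0` only kills the pairings of the Hessian with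
      -- `F.J`; `hker` upgrades this to the vanishing of the full linear form.
      apply hker
      intro v
      have h7 : HasFDerivAt (fun u => P (fderiv ℝ f (ψ u)))
          (P ∘L (hess f x ∘L fderiv ℝ ψ u₀)) u₀ := P.hasFDerivAt.comp u₀ h5
      have h8 : HasFDerivAt (fun u => P (fderiv ℝ f (ψ u)))
          (0 : EuclideanSpace ℝ (Fin k) →L[ℝ] EuclideanSpace ℝ (Fin n)) u₀ := by
        refine (hasFDerivAt_const (0 : EuclideanSpace ℝ (Fin n)) u₀).congr_of_eventuallyEq ?_
        filter_upwards [hev] with u hu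
        exact (hGψ u hu.2.2).2
      have h9 := congrArg (fun L => L z) (h7.unique h8)
      simp only [ContinuousLinearMap.comp_apply, zero_apply] at h9
      rw [← hP, h9, inner_zero_left]
    rwa [h3] at h2
  obtain ⟨ε, hε, hεμ⟩ : ∃ ε : ℝ, 0 < ε ∧ 4 * ε * μ < 1 := by
    refine ⟨1 / (8 * (μ + 1)), by positivity, ?_⟩
    rw [show 4 * (1 / (8 * (μ + 1))) * μ = (μ / (μ + 1)) / 2 by field_simp; ring]
    have : μ / (μ + 1) ≤ 1 := div_le_one_of_le₀ (by linarith) (by positivity)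
    linarith
  obtain ⟨s, hs, hlip⟩ := hstrict.exists_lipschitzOnWith_of_nnnorm_lt ⟨ε, hε.le⟩
    (by rw [nnnorm_zero]; exact hε)
  obtain ⟨ρ₂, hρ₂, hball₂⟩ := Metric.mem_nhds_iff.1 hs
  set ρ := min ρ₁ ρ₂ with hρdef
  have hρ : 0 < ρ := lt_min hρ₁ hρ₂
  have hb1 : ∀ u ∈ Metric.ball u₀ ρ, ContDiffAt ℝ 2 ψ u ∧ ψ u ∈ W ∧ F.I u ∈ Φ.target :=
    fun u hu => hball₁ u (Metric.ball_subset_ball (min_le_left _ _) hu)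
  let γ : EuclideanSpace ℝ (Fin k) → EuclideanSpace ℝ (Fin k) :=
    fun u => rieszVec k (fderiv ℝ f (ψ u) ∘L F.I)
  have hI1 : ∀ L : EuclideanSpace ℝ (Fin d) →L[ℝ] ℝ, ‖L ∘L F.I‖ ≤ ‖L‖ := by
    intro L
    refine ContinuousLinearMap.opNorm_le_bound _ (norm_nonneg _) fun u => ?_
    simpa [F.norm_I] using L.le_opNorm (F.I u)
  have hkill : ∀ u ∈ Metric.ball u₀ ρ, ∀ v, fderiv ℝ f (ψ u) (F.J v) = 0 := by
    intro u hu v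
    rw [← hP, (hGψ u (hb1 u hu).2.2).2, inner_zero_left]
  -- On the graph the gradient has no `F.J`-part, so the PŁ inequality for `f` passes to the reduced
  -- function with the same constant.
  have hγn : ∀ u ∈ Metric.ball u₀ ρ, ‖fderiv ℝ f (ψ u)‖ ≤ ‖γ u‖ := by
    intro u hu
    rw [norm_rieszVec]
    refine ContinuousLinearMap.opNorm_le_bound _ (norm_nonneg _) fun z => ?_
    have h1 : fderiv ℝ f (ψ u) z = (fderiv ℝ f (ψ u) ∘L F.I) (F.I' z) := by
      conv_lhs => rw [← F.sum_eq z, map_add, hkill u hu, add_zero]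
      rfl
    rw [h1]
    exact ((fderiv ℝ f (ψ u) ∘L F.I).le_opNorm _).trans
      (mul_le_mul_of_nonneg_left (F.norm_I'_le z) (norm_nonneg _))
  have hzero := eq_zero_of_lipschitz_gradient (q := fun u => f (ψ u) - c) (γ := γ) (u₀ := u₀)
    (ρ := ρ) hε hμ hεμ ?_ (fun u _ => sub_nonneg.2 (hmin _)) (by simp [γ, hψx, hDx]) ?_ ?_
  · refine ⟨ρ / 2, by positivity, fun u => F.J' (ψ u), ?_, congrArg F.J' hψx, fun u hu => ?_⟩
    · intro u hu
      have := (hb1 u (Metric.ball_subset_ball (by linarith) hu)).1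
      exact (F.J'.contDiff.contDiffAt.comp u this).contDiffWithinAt
    · have h1 := hzero u hu
      have h2 := (hGψ u (hb1 u (Metric.ball_subset_ball (by linarith) hu)).2.2).1
      have h3 : F.I u + F.J (F.J' (ψ u)) = ψ u := by
        conv_rhs => rw [← F.sum_eq (ψ u), h2]
      rw [h3]; linarith
  · intro u hu
    obtain ⟨hu1, hu2, hu3⟩ := hb1 u hu
    have hψd : HasFDerivAt ψ (fderiv ℝ ψ u) u :=
      (hu1.differentiableAt (by norm_num)).hasFDerivAt
    have hfd : HasFDerivAt f (fderiv ℝ f (ψ u)) (ψ u) :=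
      ((hf.contDiffAt (hW.mem_nhds hu2)).differentiableAt (by norm_num)).hasFDerivAt
    have h1 := (hfd.comp u hψd).sub_const c
    convert! h1 using 1
    rw [innerSL_rieszVec]
    ext1 z
    simp only [ContinuousLinearMap.comp_apply]
    have h2 : F.I' (fderiv ℝ ψ u z) = z := by
      have h3 : HasFDerivAt (fun u => F.I' (ψ u)) (F.I' ∘L fderiv ℝ ψ u) u :=
        F.I'.hasFDerivAt.comp u hψd
      have h4 : HasFDerivAt (fun u => F.I' (ψ u))
          (ContinuousLinearMap.id ℝ (EuclideanSpace ℝ (Fin k))) u := by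
        refine (hasFDerivAt_id u).congr_of_eventuallyEq ?_
        filter_upwards [Metric.isOpen_ball.mem_nhds hu] with u' hu'
        exact (hGψ u' (hb1 u' hu').2.2).1
      exact congrArg (fun L => L z) (h3.unique h4)
    conv_rhs => rw [← F.sum_eq (fderiv ℝ ψ u z), map_add, hkill u hu, add_zero, h2]
  · intro u hu v hv
    have h1 := hlip.norm_sub_le (hball₂ (Metric.ball_subset_ball (min_le_right _ _) hu))
      (hball₂ (Metric.ball_subset_ball (min_le_right _ _) hv))
    simp only [γ]
    rw [← map_sub, norm_rieszVec, ← ContinuousLinearMap.sub_comp]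
    exact (hI1 _).trans h1
  · intro u hu
    refine (hPL _ (hb1 u hu).2.1).trans ?_
    exact mul_le_mul_of_nonneg_left (pow_le_pow_left₀ (norm_nonneg _) (hγn u hu) 2) hμ

/-! ### The set of local minima is connected -/

theorem exists_pos_le_of_posDef {V : Type*} [NormedAddCommGroup V] [NormedSpace ℝ V]
    [FiniteDimensional ℝ V] (B : V →L[ℝ] V →L[ℝ] ℝ) (h : ∀ v, v ≠ 0 → 0 < B v v) :
    ∃ a > 0, ∀ v, a * ‖v‖ ^ 2 ≤ B v v := by
  rcases (Metric.sphere (0 : V) 1).eq_empty_or_nonempty with he | hne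
  · refine ⟨1, one_pos, fun v => ?_⟩
    have : v = 0 := by
      by_contra hv
      have : (‖v‖⁻¹ • v) ∈ Metric.sphere (0 : V) 1 := by
        simp [norm_smul, inv_mul_cancel₀ (norm_ne_zero_iff.2 hv)]
      rw [he] at this; exact this
    simp [this]
  · have hcont : Continuous fun v => B v v := by fun_prop
    obtain ⟨v₀, hv₀, hmin⟩ := (isCompact_sphere (0 : V) 1).exists_isMinOn hne hcont.continuousOn
    have hv₀' : v₀ ≠ 0 := fun h => by simp [h] at hv₀
    refine ⟨B v₀ v₀, h _ hv₀', fun v => ?_⟩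
    rcases eq_or_ne v 0 with rfl | hv
    · simp
    have h1 : (‖v‖⁻¹ • v) ∈ Metric.sphere (0 : V) 1 := by
      simp [norm_smul, inv_mul_cancel₀ (norm_ne_zero_iff.2 hv)]
    have h2 : B v₀ v₀ ≤ B (‖v‖⁻¹ • v) (‖v‖⁻¹ • v) := hmin h1
    simp only [map_smul, smul_apply, smul_eq_mul] at h2
    have h3 : 0 < ‖v‖ := norm_pos_iff.2 hv
    calc B v₀ v₀ * ‖v‖ ^ 2 ≤ (‖v‖⁻¹ * (‖v‖⁻¹ * B v v)) * ‖v‖ ^ 2 := by gcongr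
      _ = B v v := by field_simp

/-! ### Nondegenerate maxima, and traps around pieces of the set of local minima. -/

section NegDef

variable {V : Type*} [NormedAddCommGroup V] [NormedSpace ℝ V] [FiniteDimensional ℝ V]
  {f : V → ℝ} {x : V}

/-- A negative definite Hessian is bounded below as a linear map, so the gradient is injective to
first order at the point. -/
theorem eventually_fderiv_ne_zero_of_negDef (hf : ContDiff ℝ 2 f)
    (h : ∀ v, v ≠ 0 → hess f x v v < 0) : ∀ᶠ y in 𝓝[≠] x, fderiv ℝ f y ≠ 0 := by
  obtain ⟨a, ha, hle⟩ := exists_pos_le_of_posDef (-hess f x) fun v hv => by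
    simpa using h v hv
  refine (hasFDerivAt_fderiv_of_contDiff_two hf x).eventually_ne
    ⟨⟨a⁻¹, by positivity⟩, AddMonoidHomClass.antilipschitz_of_bound _ fun z => ?_⟩
  change ‖z‖ ≤ a⁻¹ * ‖hess f x z‖
  rcases eq_or_ne z 0 with rfl | hz
  · simp
  have h1 : a * ‖z‖ ^ 2 ≤ ‖hess f x z‖ * ‖z‖ := by
    refine (hle z).trans ?_
    have := (hess f x z).le_opNorm z
    rw [Real.norm_eq_abs] at this
    simpa using (neg_le_abs _).trans this
  have h2 : 0 < ‖z‖ := norm_pos_iff.2 hz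
  rw [inv_mul_eq_div, le_div_iff₀ ha]
  nlinarith

theorem eventually_lt_of_negDef (hf : ContDiff ℝ 2 f) (hx : fderiv ℝ f x = 0)
    (h : ∀ v, v ≠ 0 → hess f x v v < 0) : ∀ᶠ y in 𝓝 x, y ≠ x → f y < f x := by
  obtain ⟨a, ha, hle⟩ := exists_pos_le_of_posDef (-hess f x) fun v hv => by
    simpa using h v hv
  have h1 : ∀ᶠ y in 𝓝 x, ‖hess f y - hess f x‖ < a / 2 := by
    have h0 : Continuous fun y => ‖hess f y - hess f x‖ :=
      ((continuous_hess hf).sub continuous_const).norm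
    exact h0.continuousAt.eventually_lt continuousAt_const (by simpa using ha)
  obtain ⟨r, hr, hball⟩ := Metric.eventually_nhds_iff_ball.1 h1
  filter_upwards [Metric.ball_mem_nhds x hr] with y hy hne
  have h2 : 0 < ‖y - x‖ := norm_pos_iff.2 (sub_ne_zero.2 hne)
  have h3 := taylor_two_upper hf (x := x) (z := y - x) (m := -(a / 2) * ‖y - x‖ ^ 2) fun ξ hξ => by
    have h4 : x + ξ • (y - x) ∈ Metric.ball x r :=
      add_smul_mem_of_convex (convex_ball x r) (Metric.mem_ball_self hr) (by simpa using hy) hξ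
    have h5 := hess_apply_le (f := f) x (y - x) (y - x)
    have h6 : (hess f (x + ξ • (y - x)) - hess f x) (y - x) (y - x) ≤ (a / 2) * ‖y - x‖ ^ 2 := by
      refine (le_abs_self _).trans (((hess f (x + ξ • (y - x)) - hess f x).le_opNorm₂ _ _).trans ?_)
      have := (hball _ h4).le
      rw [mul_assoc, ← sq]; gcongr
    have h7 := hle (y - x)
    simp only [sub_apply, neg_apply] at h6 h7
    linarith
  rw [hx] at h3
  simp only [zero_apply, add_zero, add_sub_cancel] at h3
  nlinarith [pow_pos h2 2]

/-- A limit of local minima is critical and not isolated among critical points, so it cannot be a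
nondegenerate maximum. -/
theorem isClosed_setOf_isLocalMin (hf : ContDiff ℝ 2 f)
    (hcrit : ∀ x, fderiv ℝ f x = 0 → ¬ IsLocalMin f x → ∀ v, v ≠ 0 → hess f x v v < 0) :
    IsClosed {x | IsLocalMin f x} := by
  refine isClosed_of_closure_subset fun x hx => ?_
  have h1 : fderiv ℝ f x = 0 := by
    have hc : IsClosed {y | fderiv ℝ f y = 0} :=
      isClosed_eq (hf.continuous_fderiv (by norm_num)) continuous_const
    exact closure_minimal (fun y hy => IsLocalMin.fderiv_eq_zero hy) hc hx
  by_contra hne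
  have h2 := eventually_fderiv_ne_zero_of_negDef hf (hcrit x h1 hne)
  rw [eventually_nhdsWithin_iff] at h2
  obtain ⟨y, hy1, hy2⟩ := ((mem_closure_iff_frequently.1 hx).and_eventually h2).exists
  refine hy2 (fun h => hne (h ▸ hy1)) (IsLocalMin.fderiv_eq_zero hy1)

theorem countable_nonmin_crit (hf : ContDiff ℝ 2 f)
    (hcrit : ∀ x, fderiv ℝ f x = 0 → ¬ IsLocalMin f x → ∀ v, v ≠ 0 → hess f x v v < 0) :
    {x | fderiv ℝ f x = 0 ∧ ¬ IsLocalMin f x}.Countable := by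
  set X := {x | fderiv ℝ f x = 0 ∧ ¬ IsLocalMin f x}
  have hd : DiscreteTopology X := by
    rw [discreteTopology_subtype_iff]
    intro x hx
    have h2 := eventually_fderiv_ne_zero_of_negDef hf (hcrit x hx.1 hx.2)
    rw [← Filter.empty_mem_iff_bot, mem_inf_iff]
    exact ⟨_, h2, X, mem_principal_self _, by ext y; simp [X]; tauto⟩
  exact countable_of_Lindelof_of_discrete

/-- A neighbourhood of a level piece of a clopen set of local minima which no descending segment
can leave. -/
theorem exists_trap (hf : Continuous f) {A : Set V} (hA : IsCompact A)
    (hAmin : ∀ x ∈ A, IsLocalMin f x) {ρ : ℝ}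
    (hρ : 0 < ρ) (hsep : ∀ x, IsLocalMin f x → x ∈ Metric.thickening ρ A → x ∈ A) {a : V}
    (ha : a ∈ A) :
    ∃ O : Set V, IsOpen O ∧ a ∈ O ∧ O ⊆ Metric.thickening ρ A ∧
      ∀ x ∈ O, ∀ z, (∀ s ∈ Icc (0 : ℝ) 1, f (x + s • z) ≤ f x) → x + z ∈ O := by
  -- At this stage `f` may take several values on `A`, so the trap is built around the part of `A`
  -- at the level of `a` only.
  set A' := A ∩ {x | f x = f a} with hA'
  have hA'c : IsCompact A' := hA.inter_right (isClosed_eq hf continuous_const)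
  have hne : A'.Nonempty := ⟨a, ha, rfl⟩
  have hW : A' ⊆ interior {y | f a ≤ f y} ∩ Metric.thickening ρ A := by
    intro x hx
    refine ⟨mem_interior_iff_mem_nhds.2 ?_, Metric.self_subset_thickening hρ A hx.1⟩
    have h1 : ∀ᶠ y in 𝓝 x, f x ≤ f y := hAmin x hx.1
    rwa [hx.2] at h1
  obtain ⟨r, hr, hrW⟩ := hA'c.exists_cthickening_subset_open
    (isOpen_interior.inter Metric.isOpen_thickening) hW
  have hmem : ∀ x, Metric.infDist x A' ≤ r → x ∈ Metric.cthickening r A' := fun x hx => by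
    rw [Metric.mem_cthickening_iff, ← ENNReal.ofReal_toReal (Metric.infEDist_ne_top hne)]
    exact ENNReal.ofReal_le_ofReal hx
  have hcont : Continuous fun x => Metric.infDist x A' := Metric.continuous_infDist_pt A'
  set S := {x | Metric.infDist x A' = r} with hS
  have hSc : IsCompact S :=
    hA'c.cthickening.of_isClosed_subset (isClosed_eq hcont continuous_const)
      fun x hx => hmem x (le_of_eq hx)
  -- Near `A'` one has `f ≥ f a`. A point of the shell with equality would be a local minimum near
  -- `A`, hence a point of `A'`, at distance `0` and not `r`. The minimum of `f` on the compact
  -- shell is then a barrier that a descending segment cannot cross.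
  have hSlt : ∀ x ∈ S, f a < f x := by
    intro x hx
    have h1 := hrW (hmem x (le_of_eq hx))
    refine lt_of_le_of_ne (interior_subset (s := {y | f a ≤ f y}) h1.1) fun heq => ?_
    have h2 : IsLocalMin f x := by
      filter_upwards [isOpen_interior.mem_nhds h1.1] with y hy
      exact heq ▸ interior_subset (s := {y | f a ≤ f y}) hy
    have h3 : x ∈ A' := ⟨hsep x h2 h1.2, heq.symm⟩
    have h4 : Metric.infDist x A' = 0 := Metric.infDist_zero_of_mem h3
    rw [hS, mem_ofPred_eq, h4] at hx
    exact hr.ne hx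
  obtain ⟨b, hab, hb⟩ : ∃ b, f a < b ∧ ∀ x ∈ S, b ≤ f x := by
    rcases S.eq_empty_or_nonempty with he | hSne
    · exact ⟨f a + 1, by linarith, by simp [he]⟩
    · obtain ⟨x₀, hx₀, hmin⟩ := hSc.exists_isMinOn hSne hf.continuousOn
      exact ⟨f x₀, hSlt x₀ hx₀, fun x hx => hmin hx⟩
  refine ⟨{x | Metric.infDist x A' < r} ∩ {x | f x < b},
    (isOpen_lt hcont continuous_const).inter (isOpen_lt hf continuous_const),
    ⟨by simpa [Metric.infDist_zero_of_mem (show a ∈ A' from ⟨ha, rfl⟩)] using hr, hab⟩,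
    fun x hx => (hrW (hmem x (le_of_lt hx.1))).2, fun x hx z hz => ?_⟩
  have hz1 : f (x + z) ≤ f x := by simpa using hz 1 (by simp)
  refine ⟨?_, lt_of_le_of_lt hz1 hx.2⟩
  by_contra hge
  have hge' : r ≤ Metric.infDist (x + z) A' := not_lt.1 hge
  have h1 : Continuous fun s : ℝ => Metric.infDist (x + s • z) A' :=
    hcont.comp (by fun_prop)
  obtain ⟨s, hs, hsr⟩ := intermediate_value_Icc (zero_le_one (α := ℝ)) h1.continuousOn
    (show r ∈ Icc _ _ from ⟨by simpa using hx.1.le, by simpa using hge'⟩)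
  exact absurd (lt_of_le_of_lt (hz s hs) hx.2) (not_lt.2 (hb _ hsr))

end NegDef

/-- Gradient descent with a small step on a compact sublevel set. -/
theorem exists_descent_map {d : ℕ} {f : EuclideanSpace ℝ (Fin d) → ℝ} (hf : ContDiff ℝ 2 f)
    {c : ℝ} (hK : Bornology.IsBounded {x | f x ≤ c}) :
    ∃ Z : EuclideanSpace ℝ (Fin d) → EuclideanSpace ℝ (Fin d), Continuous Z ∧
      (∀ x, f x ≤ c → ∀ s ∈ Icc (0 : ℝ) 1, f (x + s • Z x) ≤ f x) ∧
      (∀ x, f x ≤ c → f (x + Z x) = f x → fderiv ℝ f x = 0) ∧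
      (∀ x, f x ≤ c → fderiv ℝ f (x + Z x) = 0 → Z x = 0) := by
  obtain ⟨R, hR⟩ := hK.subset_closedBall 0
  have hBc : IsCompact (Metric.closedBall (0 : EuclideanSpace ℝ (Fin d)) (R + 1)) :=
    isCompact_closedBall _ _
  have hBconv := convex_closedBall (0 : EuclideanSpace ℝ (Fin d)) (R + 1)
  have hD := hf.continuous_fderiv (by norm_num)
  obtain ⟨Λ, hΛ⟩ := hBc.exists_bound_of_continuousOn (f := fun x => ‖hess f x‖)
    (continuous_hess hf).norm.continuousOn
  obtain ⟨G, hG⟩ := hBc.exists_bound_of_continuousOn hD.continuousOn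
  simp only [norm_norm] at hΛ
  set Λ' := max Λ 0 with hΛ'
  set G' := max G 0 with hG'
  have hΛ0 : 0 ≤ Λ' := le_max_right _ _
  have hG0 : 0 ≤ G' := le_max_right _ _
  -- The step length serves three purposes: `η G' ≤ 1` keeps a step inside the ball of radius `R +
  -- 1`, while `Λ' η ≤ 1/2` gives sufficient decrease and also bounds the change of the gradient
  -- over a step by half its norm, so that only critical points are sent to critical points.
  set η : ℝ := 1 / (2 * Λ' + G' + 1) with hη
  have hηpos : 0 < η := by positivity
  have hηΛ : Λ' * η ≤ 1 / 2 := by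
    rw [hη, mul_one_div, div_le_iff₀ (by positivity)]; linarith
  have hηG : η * G' ≤ 1 := by
    rw [hη, one_div_mul_eq_div, div_le_iff₀ (by positivity)]; linarith
  let Z : EuclideanSpace ℝ (Fin d) → EuclideanSpace ℝ (Fin d) :=
    fun x => -(η • rieszVec d (fderiv ℝ f x))
  have hZn : ∀ x, ‖Z x‖ = η * ‖fderiv ℝ f x‖ := fun x => by
    rw [norm_neg, norm_smul, norm_rieszVec, Real.norm_eq_abs, abs_of_pos hηpos]
  have hZd : ∀ x, fderiv ℝ f x (Z x) = -(η * ‖fderiv ℝ f x‖ ^ 2) := fun x => by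
    rw [map_neg, map_smul, smul_eq_mul, ← inner_rieszVec, real_inner_self_eq_norm_sq,
      norm_rieszVec]
  have hxB : ∀ x, f x ≤ c → ‖x‖ ≤ R := fun x hx => by simpa using hR hx
  have hxB' : ∀ x, f x ≤ c → x ∈ Metric.closedBall (0 : EuclideanSpace ℝ (Fin d)) (R + 1) :=
    fun x hx => by simpa using (hxB x hx).trans (by linarith)
  have hZ1 : ∀ x, f x ≤ c → ‖Z x‖ ≤ 1 := fun x hx => by
    rw [hZn]
    exact (mul_le_mul_of_nonneg_left ((hG x (hxB' x hx)).trans (le_max_left _ _)) hηpos.le).trans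
      hηG
  have hZB : ∀ x, f x ≤ c → x + Z x ∈ Metric.closedBall (0 : EuclideanSpace ℝ (Fin d)) (R + 1) :=
    fun x hx => by
      simpa using (norm_add_le _ _).trans (add_le_add (hxB x hx) (hZ1 x hx))
  have hdesc : ∀ x, f x ≤ c → ∀ s ∈ Icc (0 : ℝ) 1,
      f (x + s • Z x) ≤ f x - s * (η / 2) * ‖fderiv ℝ f x‖ ^ 2 := by
    intro x hx s hs
    have h1 := taylor_two_upper hf (x := x) (z := s • Z x) (m := Λ' * (s ^ 2 * ‖Z x‖ ^ 2))
      fun ξ hξ => by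
        have h2 : x + s • Z x ∈ Metric.closedBall (0 : EuclideanSpace ℝ (Fin d)) (R + 1) :=
          hBconv.add_smul_mem (hxB' x hx) (hZB x hx) hs
        have h3 := add_smul_mem_of_convex hBconv (hxB' x hx) h2 hξ
        refine (hess_apply_le _ _ _).trans ?_
        rw [norm_smul, Real.norm_eq_abs, abs_of_nonneg hs.1]
        have h4 : ‖hess f (x + ξ • s • Z x)‖ ≤ Λ' := (hΛ _ h3).trans (le_max_left _ _)
        calc ‖hess f (x + ξ • s • Z x)‖ * (s * ‖Z x‖) * (s * ‖Z x‖)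
            = ‖hess f (x + ξ • s • Z x)‖ * (s ^ 2 * ‖Z x‖ ^ 2) := by ring
          _ ≤ _ := by gcongr
    rw [map_smul, smul_eq_mul, hZd, hZn] at h1
    refine h1.trans ?_
    have h5 : 0 ≤ ‖fderiv ℝ f x‖ ^ 2 := by positivity
    have h6 : s * (η * (Λ' * η)) ≤ η / 2 := by
      have : η * (Λ' * η) ≤ η / 2 := by nlinarith
      calc s * (η * (Λ' * η)) ≤ 1 * (η * (Λ' * η)) :=
            mul_le_mul_of_nonneg_right hs.2 (by positivity)
        _ ≤ η / 2 := by linarith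
    have h7 : s * (s * (η * (Λ' * η))) * ‖fderiv ℝ f x‖ ^ 2 ≤
        s * (η / 2) * ‖fderiv ℝ f x‖ ^ 2 :=
      mul_le_mul_of_nonneg_right (mul_le_mul_of_nonneg_left h6 hs.1) h5
    have h8 : 0 ≤ s * (η / 2) * ‖fderiv ℝ f x‖ ^ 2 :=
      mul_nonneg (mul_nonneg hs.1 (by positivity)) h5
    nlinarith
  refine ⟨Z, ?_, fun x hx s hs => ?_, fun x hx h => ?_, fun x hx h => ?_⟩
  · exact (((rieszVec d).continuous.comp hD).const_smul η).neg
  · have := hdesc x hx s hs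
    have h8 : 0 ≤ s * (η / 2) * ‖fderiv ℝ f x‖ ^ 2 :=
      mul_nonneg (mul_nonneg hs.1 (by positivity)) (by positivity)
    linarith
  · have h1 := hdesc x hx 1 (by simp)
    rw [one_smul, h] at h1
    have h2 : ‖fderiv ℝ f x‖ ^ 2 = 0 := le_antisymm (by nlinarith) (by positivity)
    simpa using h2
  · have h1 : ‖fderiv ℝ f (x + Z x) - fderiv ℝ f x‖ ≤ Λ' * ‖x + Z x - x‖ :=
      hBconv.norm_image_sub_le_of_norm_hasFDerivWithin_le
        (fun y _ => (hasFDerivAt_fderiv_of_contDiff_two hf y).hasFDerivWithinAt)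
        (fun y hy => (hΛ y hy).trans (le_max_left _ _)) (hxB' x hx) (hZB x hx)
    rw [h, zero_sub, norm_neg, add_sub_cancel_left, hZn, ← mul_assoc] at h1
    have h2 : ‖fderiv ℝ f x‖ = 0 := by nlinarith [norm_nonneg (fderiv ℝ f x)]
    rw [← norm_eq_zero, hZn, h2, mul_zero]

/-- A mountain-pass argument run through discrete gradient descent. If the local minima split into
`A` and `B`, each point of a path from `A` to `B` that avoids the maxima is carried by descent into
a trap around `A` or around `B`. The two sets of such points are open and cover the connected path,
so some point lies in both; but an orbit cannot stay in two disjoint traps. -/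
theorem isPreconnected_setOf_isLocalMin {d : ℕ} (hd : 2 ≤ d) {f : EuclideanSpace ℝ (Fin d) → ℝ}
    (hf : ContDiff ℝ 2 f) (hcoer : ∀ c, Bornology.IsBounded {x | f x ≤ c})
    (hcrit : ∀ x, fderiv ℝ f x = 0 → ¬ IsLocalMin f x → ∀ v, v ≠ 0 → hess f x v v < 0)
    (hM : Bornology.IsBounded {x | IsLocalMin f x}) :
    IsPreconnected {x | IsLocalMin f x} := by
  have hfc : Continuous f := hf.continuous
  have hMcl := isClosed_setOf_isLocalMin hf hcrit
  have hMc : IsCompact {x | IsLocalMin f x} := Metric.isCompact_of_isClosed_isBounded hMcl hM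
  rw [isPreconnected_closed_iff]
  intro t t' ht ht' hsub ⟨a₀, ha₀, ha₀t⟩ ⟨b₀, hb₀, hb₀t⟩
  by_contra hemp
  rw [not_nonempty_iff_eq_empty] at hemp
  set A := {x | IsLocalMin f x} ∩ t with hAdef
  set B := {x | IsLocalMin f x} ∩ t' with hBdef
  have hA : IsCompact A := hMc.inter_right ht
  have hB : IsCompact B := hMc.inter_right ht'
  have hAB : Disjoint A B := by
    rw [Set.disjoint_iff]
    rintro x ⟨⟨h1, h2⟩, ⟨_, h3⟩⟩
    rw [← hemp]; exact ⟨h1, h2, h3⟩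
  have hcov : ∀ x, IsLocalMin f x → x ∈ A ∨ x ∈ B := fun x hx =>
    (hsub hx).imp (fun h => ⟨hx, h⟩) (fun h => ⟨hx, h⟩)
  obtain ⟨ρ, hρ, hdis⟩ := hAB.exists_thickenings hA hB.isClosed
  rw [Set.disjoint_left] at hdis
  have hsepA : ∀ x, IsLocalMin f x → x ∈ Metric.thickening ρ A → x ∈ A := fun x hx hxA =>
    (hcov x hx).resolve_right fun hxB => hdis hxA (Metric.self_subset_thickening hρ B hxB)
  have hsepB : ∀ x, IsLocalMin f x → x ∈ Metric.thickening ρ B → x ∈ B := fun x hx hxB =>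
    (hcov x hx).resolve_left fun hxA => hdis (Metric.self_subset_thickening hρ A hxA) hxB
  -- a path avoiding the critical points that are not minima
  set X := {x | fderiv ℝ f x = 0 ∧ ¬ IsLocalMin f x} with hX
  have hpc : IsPathConnected Xᶜ := by
    -- Dimension at least two is essential here: on a line, a single maximum separates.
    refine (countable_nonmin_crit hf hcrit).isPathConnected_compl_of_one_lt_rank ?_
    rw [rank_eq_card_basis (EuclideanSpace.basisFun (Fin d) ℝ).toBasis, Fintype.card_fin]
    exact_mod_cast hd
  obtain ⟨γ, hγ⟩ := hpc.joinedIn a₀ (fun h => h.2 ha₀) b₀ (fun h => h.2 hb₀)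
  have hPc : IsCompact (range γ) := isCompact_range γ.continuous
  have hPconn : IsPreconnected (range γ) := isPreconnected_range γ.continuous
  obtain ⟨p, _, hp⟩ := hPc.exists_isMaxOn (range_nonempty γ) hfc.continuousOn
  set c := f p
  obtain ⟨Z, hZc, hZ1, hZ2, hZ3⟩ := exists_descent_map hf (hcoer c)
  have hKc : IsCompact {x | f x ≤ c} :=
    Metric.isCompact_of_isClosed_isBounded (isClosed_le hfc continuous_const) (hcoer c)
  set T : EuclideanSpace ℝ (Fin d) → EuclideanSpace ℝ (Fin d) := fun x => x + Z x with hT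
  have hTc : Continuous T := continuous_id.add hZc
  have hTle : ∀ x, f x ≤ c → f (T x) ≤ f x := fun x hx => by simpa using hZ1 x hx 1 (by simp)
  have hTK : ∀ x, f x ≤ c → ∀ n, f (T^[n] x) ≤ c := by
    intro x hx n
    induction n with
    | zero => exact hx
    | succ n ih => rw [Function.iterate_succ_apply']; exact (hTle _ ih).trans ih
  -- Descent never lands on a maximum from outside: a point whose image is critical is itself fixed
  -- by `T`.
  have hTX : ∀ x, f x ≤ c → x ∉ X → ∀ n, T^[n] x ∉ X := by
    intro x hx hxX n
    induction n with
    | zero => exact hxX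
    | succ n ih =>
      rw [Function.iterate_succ_apply']
      intro h
      have h1 := hZ3 _ (hTK x hx n) h.1
      apply ih
      have h2 : T (T^[n] x) = T^[n] x := by
        change T^[n] x + Z (T^[n] x) = T^[n] x
        rw [h1, add_zero]
      rwa [h2] at h
  have hlim : ∀ x, f x ≤ c → x ∉ X → ∃ y, IsLocalMin f y ∧
      ∀ O, IsOpen O → y ∈ O → ∃ n, T^[n] x ∈ O := by
    intro x hx hxX
    have hanti : Antitone fun n => f (T^[n] x) := antitone_nat_of_succ_le fun n => by
      rw [Function.iterate_succ_apply']; exact hTle _ (hTK x hx n)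
    obtain ⟨y, hyK, φ, hφ, hy⟩ := hKc.tendsto_subseq (fun n => hTK x hx n)
    have hy1 : Tendsto (fun n => f (T^[φ n] x)) atTop (𝓝 (f y)) := (hfc.tendsto y).comp hy
    have hall : Tendsto (fun n => f (T^[n] x)) atTop (𝓝 (f y)) :=
      (tendsto_iff_tendsto_subseq_of_antitone hanti hφ.tendsto_atTop).2 hy1
    have hge : ∀ n, f y ≤ f (T^[n] x) := hanti.le_of_tendsto hall
    have hTy : f (T y) = f y := by
      have h1 : Tendsto (fun n => f (T (T^[φ n] x))) atTop (𝓝 (f (T y))) :=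
        ((hfc.comp hTc).tendsto y).comp hy
      have h2 : Tendsto (fun n => f (T^[φ n + 1] x)) atTop (𝓝 (f y)) :=
        hall.comp ((tendsto_add_atTop_nat 1).comp hφ.tendsto_atTop)
      refine tendsto_nhds_unique h1 (h2.congr fun n => ?_)
      rw [Function.iterate_succ_apply']
    have hy0 : fderiv ℝ f y = 0 := hZ2 y hyK hTy
    refine ⟨y, ?_, fun O hO hyO => ?_⟩
    -- Near a nondegenerate maximum `y`, every other point lies strictly below `f y`; but the values
    -- along the orbit stay above their limit `f y`. So the orbit would have to hit `y`, which `hTX`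
    -- forbids.
    · by_contra hne
      have h1 := hy.eventually (eventually_lt_of_negDef hf hy0 (hcrit y hy0 hne))
      obtain ⟨n, hn⟩ := h1.exists
      have h2 : T^[φ n] x = y := by
        by_contra h3
        exact absurd (hn h3) (not_lt.2 (hge _))
      exact hTX x hx hxX (φ n) (h2 ▸ ⟨hy0, hne⟩)
    · obtain ⟨n, hn⟩ := (hy.eventually (hO.mem_nhds hyO)).exists
      exact ⟨φ n, hn⟩
  choose! OA hOA1 hOA2 hOA3 hOA4 using fun a (ha : a ∈ A) =>
    exists_trap hfc hA (fun x hx => hx.1) hρ hsepA ha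
  choose! OB hOB1 hOB2 hOB3 hOB4 using fun b (hb : b ∈ B) =>
    exists_trap hfc hB (fun x hx => hx.1) hρ hsepB hb
  set UA := ⋃ a ∈ A, OA a with hUA
  set UB := ⋃ b ∈ B, OB b with hUB
  have hUAo : IsOpen UA := isOpen_biUnion hOA1
  have hUBo : IsOpen UB := isOpen_biUnion hOB1
  have hTA : ∀ x, f x ≤ c → ∀ n, T^[n] x ∈ UA → ∀ m, T^[n + m] x ∈ UA := by
    intro x hx n hn m
    induction m with
    | zero => exact hn
    | succ m ih =>
      obtain ⟨a, ha, h⟩ := mem_iUnion₂.1 ih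
      rw [← add_assoc, Function.iterate_succ_apply']
      exact mem_iUnion₂.2 ⟨a, ha, hOA4 a ha _ h _ (hZ1 _ (hTK x hx _))⟩
  have hTB : ∀ x, f x ≤ c → ∀ n, T^[n] x ∈ UB → ∀ m, T^[n + m] x ∈ UB := by
    intro x hx n hn m
    induction m with
    | zero => exact hn
    | succ m ih =>
      obtain ⟨a, ha, h⟩ := mem_iUnion₂.1 ih
      rw [← add_assoc, Function.iterate_succ_apply']
      exact mem_iUnion₂.2 ⟨a, ha, hOB4 a ha _ h _ (hZ1 _ (hTK x hx _))⟩
  have hPK : ∀ x ∈ range γ, f x ≤ c := fun x hx => hp hx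
  have hPX : ∀ x ∈ range γ, x ∉ X := by rintro _ ⟨s, rfl⟩; exact hγ s
  obtain ⟨x, hxP, hxA, hxB⟩ := hPconn (⋃ n, T^[n] ⁻¹' UA) (⋃ n, T^[n] ⁻¹' UB)
    (isOpen_iUnion fun n => hUAo.preimage (hTc.iterate n))
    (isOpen_iUnion fun n => hUBo.preimage (hTc.iterate n))
    (fun x hx => by
      obtain ⟨y, hy, hyO⟩ := hlim x (hPK x hx) (hPX x hx)
      rcases hcov y hy with h | h
      · obtain ⟨n, hn⟩ := hyO UA hUAo (mem_iUnion₂.2 ⟨y, h, hOA2 y h⟩)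
        exact Or.inl (mem_iUnion.2 ⟨n, hn⟩)
      · obtain ⟨n, hn⟩ := hyO UB hUBo (mem_iUnion₂.2 ⟨y, h, hOB2 y h⟩)
        exact Or.inr (mem_iUnion.2 ⟨n, hn⟩))
    ⟨a₀, ⟨0, γ.source⟩, mem_iUnion.2 ⟨0, mem_iUnion₂.2 ⟨a₀, ⟨ha₀, ha₀t⟩, hOA2 _ ⟨ha₀, ha₀t⟩⟩⟩⟩
    ⟨b₀, ⟨1, γ.target⟩, mem_iUnion.2 ⟨0, mem_iUnion₂.2 ⟨b₀, ⟨hb₀, hb₀t⟩, hOB2 _ ⟨hb₀, hb₀t⟩⟩⟩⟩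
  obtain ⟨n, hn⟩ := mem_iUnion.1 hxA
  obtain ⟨m, hm⟩ := mem_iUnion.1 hxB
  have h1 := hTA x (hPK x hxP) n hn m
  have h2 := hTB x (hPK x hxP) m hm n
  rw [add_comm] at h2
  obtain ⟨a, ha, h3⟩ := mem_iUnion₂.1 h1
  obtain ⟨b, hb, h4⟩ := mem_iUnion₂.1 h2
  exact hdis (hOA3 a ha h3) (hOB3 b hb h4)

/-! ### The Riemannian volume of an embedded submanifold -/

section Volume

variable {k d : ℕ}

/-- The matrix of a linear map `ℝᵏ → ℝᵈ`. -/
def matrixOf (B : EuclideanSpace ℝ (Fin k) →L[ℝ] EuclideanSpace ℝ (Fin d)) :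
    Matrix (Fin d) (Fin k) ℝ :=
  Matrix.of fun i j => B (EuclideanSpace.single j 1) i

theorem apply_eq_sum {V : Type*} [NormedAddCommGroup V] [NormedSpace ℝ V]
    (B : EuclideanSpace ℝ (Fin k) →L[ℝ] V) (x : EuclideanSpace ℝ (Fin k)) :
    B x = ∑ i, x i • B (EuclideanSpace.single i 1) := by
  have h : x = ∑ i, x i • EuclideanSpace.single i (1 : ℝ) := by
    ext j
    simp [Finset.sum_apply, Pi.single_apply]
  conv_lhs => rw [h]
  simp

theorem matrixOf_comp {l : ℕ} (B : EuclideanSpace ℝ (Fin k) →L[ℝ] EuclideanSpace ℝ (Fin d))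
    (C : EuclideanSpace ℝ (Fin l) →L[ℝ] EuclideanSpace ℝ (Fin k)) :
    matrixOf (B ∘L C) = matrixOf B * matrixOf C := by
  ext i j
  rw [Matrix.mul_apply]
  change B (C _) i = _
  rw [apply_eq_sum B]
  simp [matrixOf, mul_comm]

theorem matrixOf_inner (B : EuclideanSpace ℝ (Fin k) →L[ℝ] EuclideanSpace ℝ (Fin d))
    (i j : Fin k) : ((matrixOf B).transpose * matrixOf B) i j =
      inner ℝ (B (EuclideanSpace.single i 1)) (B (EuclideanSpace.single j 1)) := by
  rw [Matrix.mul_apply, PiLp.inner_apply]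
  simp [matrixOf, mul_comm]

theorem inducedMetric_eq (ψ : EuclideanSpace ℝ (Fin k) → EuclideanSpace ℝ (Fin d))
    (u : EuclideanSpace ℝ (Fin k)) :
    inducedMetric ψ u = (matrixOf (fderiv ℝ ψ u)).transpose * matrixOf (fderiv ℝ ψ u) := by
  ext i j
  rw [matrixOf_inner]; rfl

theorem det_matrixOf (C : EuclideanSpace ℝ (Fin k) →L[ℝ] EuclideanSpace ℝ (Fin k)) :
    (matrixOf C).det = C.det := by
  rw [ContinuousLinearMap.det, ← LinearMap.det_toMatrix (EuclideanSpace.basisFun (Fin k) ℝ).toBasis]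
  congr 1

theorem inducedMetric_det_nonneg (ψ : EuclideanSpace ℝ (Fin k) → EuclideanSpace ℝ (Fin d))
    (u : EuclideanSpace ℝ (Fin k)) : 0 ≤ (inducedMetric ψ u).det := by
  rw [inducedMetric_eq]
  exact (Matrix.posSemidef_conjTranspose_mul_self (matrixOf (fderiv ℝ ψ u))).det_nonneg

theorem inducedMetric_det_comp {ψ₁ ψ₂ : EuclideanSpace ℝ (Fin k) → EuclideanSpace ℝ (Fin d)}
    {u v : EuclideanSpace ℝ (Fin k)} {C : EuclideanSpace ℝ (Fin k) →L[ℝ] EuclideanSpace ℝ (Fin k)}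
    (h : fderiv ℝ ψ₁ u = fderiv ℝ ψ₂ v ∘L C) :
    (inducedMetric ψ₁ u).det = (inducedMetric ψ₂ v).det * C.det ^ 2 := by
  rw [inducedMetric_eq, inducedMetric_eq, h, matrixOf_comp, Matrix.transpose_mul, ← det_matrixOf,
    Matrix.mul_assoc, ← Matrix.mul_assoc _ (matrixOf _) (matrixOf C), Matrix.det_mul,
    Matrix.det_mul, Matrix.det_transpose]
  ring

theorem continuousOn_inducedMetric_det {U : Set (EuclideanSpace ℝ (Fin k))}
    {ψ : EuclideanSpace ℝ (Fin k) → EuclideanSpace ℝ (Fin d)} (hU : IsOpen U)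
    (hψ : ContDiffOn ℝ 2 ψ U) : ContinuousOn (fun u => (inducedMetric ψ u).det) U := by
  have h1 : ContinuousOn (fderiv ℝ ψ) U := hψ.continuousOn_fderiv_of_isOpen hU (by norm_num)
  have h2 : Continuous fun B : EuclideanSpace ℝ (Fin k) →L[ℝ] EuclideanSpace ℝ (Fin d) =>
      (Matrix.of fun i j : Fin k => inner ℝ (B (EuclideanSpace.single i 1))
        (B (EuclideanSpace.single j 1)) : Matrix (Fin k) (Fin k) ℝ).det := by
    refine Continuous.matrix_det (continuous_matrix fun i j => ?_)
    simp only [Matrix.of_apply]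
    fun_prop
  exact h2.comp_continuousOn h1

/-- The volume density of a parametrization. -/
def volDensity (ψ : EuclideanSpace ℝ (Fin k) → EuclideanSpace ℝ (Fin d))
    (u : EuclideanSpace ℝ (Fin k)) : ENNReal :=
  ENNReal.ofReal √(inducedMetric ψ u).det

theorem measurableSet_inter_preimage {α β : Type*} [TopologicalSpace α] [MeasurableSpace α]
    [BorelSpace α] [TopologicalSpace β] [MeasurableSpace β] [BorelSpace β] {U : Set α} {ψ : α → β}
    {X : Set β} (hU : MeasurableSet U) (hψ : ContinuousOn ψ U) (hX : MeasurableSet X) :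
    MeasurableSet (U ∩ ψ ⁻¹' X) := by
  have h1 := (hψ.domRestrict.measurable hX)
  have h2 := hU.subtype_image h1
  convert h2 using 1
  ext x; simp [and_comm]

variable {S : Set (EuclideanSpace ℝ (Fin d))} {U₁ U₂ : Set (EuclideanSpace ℝ (Fin k))}
  {ψ₁ ψ₂ : EuclideanSpace ℝ (Fin k) → EuclideanSpace ℝ (Fin d)}

theorem IsLocalParam.injOn (h : IsLocalParam S U₁ ψ₁) : InjOn ψ₁ U₁ := by
  intro x hx y hy hxy
  have := h.isEmbedding.injective (a₁ := ⟨x, hx⟩) (a₂ := ⟨y, hy⟩) hxy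
  exact congrArg Subtype.val this

theorem IsLocalParam.subset (h : IsLocalParam S U₁ ψ₁) : ψ₁ '' U₁ ⊆ S := by
  obtain ⟨V, _, hV⟩ := h.image_eq
  rw [hV]; exact inter_subset_left

/-- The coordinate change between two parametrizations. -/
def transition (U₂ : Set (EuclideanSpace ℝ (Fin k)))
    (ψ₁ ψ₂ : EuclideanSpace ℝ (Fin k) → EuclideanSpace ℝ (Fin d)) :
    EuclideanSpace ℝ (Fin k) → EuclideanSpace ℝ (Fin k) :=
  fun u => Function.invFunOn ψ₂ U₂ (ψ₁ u)

theorem transition_mem {u : EuclideanSpace ℝ (Fin k)} (hu : ψ₁ u ∈ ψ₂ '' U₂) :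
    transition U₂ ψ₁ ψ₂ u ∈ U₂ := Function.invFunOn_mem hu

theorem apply_transition {u : EuclideanSpace ℝ (Fin k)} (hu : ψ₁ u ∈ ψ₂ '' U₂) :
    ψ₂ (transition U₂ ψ₁ ψ₂ u) = ψ₁ u := Function.invFunOn_eq hu

/-- The embedding property gives continuity of the transition map. A linear left inverse `L` of the
derivative of `ψ₂` makes `L ∘ ψ₂` a local diffeomorphism, so locally the transition is the inverse
of `L ∘ ψ₂` applied to `L ∘ ψ₁`. -/
theorem hasFDerivAt_transition (h₁ : IsLocalParam S U₁ ψ₁) (h₂ : IsLocalParam S U₂ ψ₂)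
    {u : EuclideanSpace ℝ (Fin k)} (hu : u ∈ U₁) (hu₂ : ψ₁ u ∈ ψ₂ '' U₂) :
    ∃ C : EuclideanSpace ℝ (Fin k) →L[ℝ] EuclideanSpace ℝ (Fin k),
      HasFDerivAt (transition U₂ ψ₁ ψ₂) C u ∧
      fderiv ℝ ψ₁ u = fderiv ℝ ψ₂ (transition U₂ ψ₁ ψ₂ u) ∘L C := by
  set χ := transition U₂ ψ₁ ψ₂ with hχ
  obtain ⟨V, hV, hVeq⟩ := h₂.image_eq
  have hO : ∀ᶠ z in 𝓝 u, ψ₁ z ∈ ψ₂ '' U₂ := by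
    have h3 : U₁ ∩ ψ₁ ⁻¹' V ∈ 𝓝 u :=
      (h₁.contDiffOn.continuousOn.isOpen_inter_preimage h₁.isOpen hV).mem_nhds
        ⟨hu, by rw [hVeq] at hu₂; exact hu₂.2⟩
    filter_upwards [h3] with z hz
    rw [hVeq]
    exact ⟨h₁.subset ⟨z, hz.1, rfl⟩, hz.2⟩
  have hψ₁c : ContinuousAt ψ₁ u := h₁.contDiffOn.continuousOn.continuousAt (h₁.isOpen.mem_nhds hu)
  have hχU : χ u ∈ U₂ := transition_mem hu₂
  have hχc : ContinuousAt χ u := by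
    classical
    let g : EuclideanSpace ℝ (Fin k) → U₂ := fun z => if h : χ z ∈ U₂ then ⟨χ z, h⟩ else ⟨χ u, hχU⟩
    have hg : ∀ z, ψ₁ z ∈ ψ₂ '' U₂ → (g z : EuclideanSpace ℝ (Fin k)) = χ z := fun z hz => by
      simp [g, hχ, transition_mem hz]
    have h3 : Tendsto g (𝓝 u) (𝓝 (g u)) := by
      rw [h₂.isEmbedding.tendsto_nhds_iff]
      have h4 : ψ₂ (g u) = ψ₁ u := by rw [hg u hu₂]; exact apply_transition hu₂
      rw [h4]
      refine hψ₁c.congr' ?_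
      filter_upwards [hO] with z hz
      simp only [Function.comp]
      rw [hg z hz]; exact (apply_transition hz).symm
    have h5 : Tendsto (fun z => (g z : EuclideanSpace ℝ (Fin k))) (𝓝 u) (𝓝 (g u)) :=
      (continuous_subtype_val.tendsto _).comp h3
    rw [hg u hu₂] at h5
    refine h5.congr' ?_
    filter_upwards [hO] with z hz using hg z hz
  have hψ₂C : ContDiffAt ℝ 2 ψ₂ (χ u) := h₂.contDiffOn.contDiffAt (h₂.isOpen.mem_nhds hχU)
  have hψ₂d : HasStrictFDerivAt ψ₂ (fderiv ℝ ψ₂ (χ u)) (χ u) :=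
    hψ₂C.hasStrictFDerivAt (by norm_num)
  have hψ₁d : HasFDerivAt ψ₁ (fderiv ℝ ψ₁ u) u :=
    ((h₁.contDiffOn.contDiffAt (h₁.isOpen.mem_nhds hu)).differentiableAt (by norm_num)).hasFDerivAt
  obtain ⟨L', hL'⟩ := LinearMap.exists_leftInverse_of_injective
    (fderiv ℝ ψ₂ (χ u) : EuclideanSpace ℝ (Fin k) →ₗ[ℝ] EuclideanSpace ℝ (Fin d))
    (LinearMap.ker_eq_bot.2 (h₂.immersion _ hχU))
  let L : EuclideanSpace ℝ (Fin d) →L[ℝ] EuclideanSpace ℝ (Fin k) :=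
    LinearMap.toContinuousLinearMap L'
  have hLB : L ∘L fderiv ℝ ψ₂ (χ u) =
      (ContinuousLinearEquiv.refl ℝ (EuclideanSpace ℝ (Fin k)) : _ →L[ℝ] _) := by
    ext1 z
    exact LinearMap.congr_fun hL' z
  have hs : HasStrictFDerivAt (fun z => L (ψ₂ z))
      (ContinuousLinearEquiv.refl ℝ (EuclideanSpace ℝ (Fin k)) : _ →L[ℝ] _) (χ u) := by
    rw [← hLB]; exact L.hasStrictFDerivAt.comp (χ u) hψ₂d
  have hχd : HasFDerivAt χ (L ∘L fderiv ℝ ψ₁ u) u := by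
    have h3 := hs.to_localInverse.hasFDerivAt
    have h4 : L (ψ₂ (χ u)) = L (ψ₁ u) := by rw [hχ, apply_transition hu₂]
    simp only [h4] at h3
    have h5 := h3.comp u (L.hasFDerivAt.comp u hψ₁d)
    refine HasFDerivAt.congr_of_eventuallyEq h5 ?_
    filter_upwards [hO, hχc.eventually hs.eventually_left_inverse] with z hz hz2
    simp only [Function.comp]
    rw [← apply_transition (ψ₂ := ψ₂) hz]
    exact hz2.symm
  refine ⟨_, hχd, ?_⟩
  have h6 := hψ₂d.hasFDerivAt.comp u hχd
  refine hψ₁d.unique (h6.congr_of_eventuallyEq ?_)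
  filter_upwards [hO] with z hz
  exact (apply_transition hz).symm

/-- Change of variables: the Gram determinants differ by the square of the Jacobian of the
transition, whose root is the Jacobian factor. -/
theorem lintegral_volDensity_eq (h₁ : IsLocalParam S U₁ ψ₁) (h₂ : IsLocalParam S U₂ ψ₂)
    {X : Set (EuclideanSpace ℝ (Fin d))} (hX : MeasurableSet X) (hX₁ : X ⊆ ψ₁ '' U₁)
    (hX₂ : X ⊆ ψ₂ '' U₂) :
    ∫⁻ u in U₁ ∩ ψ₁ ⁻¹' X, volDensity ψ₁ u = ∫⁻ u in U₂ ∩ ψ₂ ⁻¹' X, volDensity ψ₂ u := by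
  set χ := transition U₂ ψ₁ ψ₂ with hχ
  have hA₁ : MeasurableSet (U₁ ∩ ψ₁ ⁻¹' X) :=
    measurableSet_inter_preimage h₁.isOpen.measurableSet h₁.contDiffOn.continuousOn hX
  have himg : χ '' (U₁ ∩ ψ₁ ⁻¹' X) = U₂ ∩ ψ₂ ⁻¹' X := by
    ext z
    constructor
    · rintro ⟨u, ⟨hu, hux⟩, rfl⟩
      refine ⟨transition_mem (hX₂ hux), ?_⟩
      rw [mem_preimage, hχ, apply_transition (hX₂ hux)]; exact hux
    · rintro ⟨hz, hzx⟩
      obtain ⟨u, hu, hue⟩ := hX₁ hzx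
      have hux : ψ₁ u ∈ X := by rw [hue]; exact hzx
      refine ⟨u, ⟨hu, hux⟩, ?_⟩
      refine h₂.injOn (transition_mem (hX₂ hux)) hz ?_
      rw [apply_transition (hX₂ hux), hue]
  have hinj : InjOn χ (U₁ ∩ ψ₁ ⁻¹' X) := by
    intro x hx y hy hxy
    refine h₁.injOn hx.1 hy.1 ?_
    rw [← apply_transition (hX₂ hx.2), ← apply_transition (hX₂ hy.2)]
    exact congrArg ψ₂ hxy
  choose! C hC1 hC2 using fun (u : EuclideanSpace ℝ (Fin k)) (hu : u ∈ U₁ ∩ ψ₁ ⁻¹' X) =>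
    hasFDerivAt_transition h₁ h₂ hu.1 (hX₂ hu.2)
  rw [← himg, lintegral_image_eq_lintegral_abs_det_fderiv_mul volume hA₁
    (fun u hu => (hC1 u hu).hasFDerivWithinAt) hinj]
  refine setLIntegral_congr_fun hA₁ fun u hu => ?_
  simp only [volDensity]
  rw [inducedMetric_det_comp (hC2 u hu), Real.sqrt_mul (inducedMetric_det_nonneg _ _),
    Real.sqrt_sq_eq_abs, mul_comm, ENNReal.ofReal_mul (abs_nonneg _)]

/-- The volume carried by one coordinate patch. -/
def patchMeasure (U : Set (EuclideanSpace ℝ (Fin k)))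
    (ψ : EuclideanSpace ℝ (Fin k) → EuclideanSpace ℝ (Fin d)) :
    Measure (EuclideanSpace ℝ (Fin d)) :=
  Measure.map ψ ((volume.restrict U).withDensity (volDensity ψ))

theorem patchMeasure_apply (h₁ : IsLocalParam S U₁ ψ₁) {X : Set (EuclideanSpace ℝ (Fin d))}
    (hX : MeasurableSet X) : patchMeasure U₁ ψ₁ X = ∫⁻ u in U₁ ∩ ψ₁ ⁻¹' X, volDensity ψ₁ u := by
  have h2 : AEMeasurable ψ₁ (volume.restrict U₁) :=
    h₁.contDiffOn.continuousOn.aemeasurable h₁.isOpen.measurableSet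
  rw [patchMeasure, Measure.map_apply_of_aemeasurable
    (h2.mono_ac (withDensity_absolutelyContinuous _ _)) hX, withDensity_apply',
    Measure.restrict_restrict' h₁.isOpen.measurableSet, inter_comm]

/-- A countable family of patches covers `S`. Cutting the patches to be disjoint and summing their
measures gives `M`; on any other patch, `lintegral_volDensity_eq` identifies each summand. -/
theorem exists_isRiemannianVolume (hS : IsEmbeddedSubmanifold k S) (hSm : MeasurableSet S) :
    ∃ M : Measure (EuclideanSpace ℝ (Fin d)), IsRiemannianVolume k S M := by
  rcases S.eq_empty_or_nonempty with rfl | hne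
  · refine ⟨0, by simp, fun U ψ h A _ hAU => ?_⟩
    have hU : U = ∅ := by
      have := h.subset
      rwa [subset_empty_iff, image_eq_empty] at this
    have hA : A = ∅ := subset_empty_iff.1 (hU ▸ hAU)
    simp [hA]
  choose! U ψ hp hx using hS
  choose! V hVo hV using fun x hxS => (hp x hxS).image_eq
  have hxV : ∀ x ∈ S, x ∈ V x := fun x hxS => by
    have := hx x hxS
    rw [hV x hxS] at this; exact this.2
  obtain ⟨t, htS, htc, hcov⟩ := TopologicalSpace.countable_cover_nhdsWithin (s := S) (f := V)
    fun x hxS => mem_nhdsWithin_of_mem_nhds ((hVo x hxS).mem_nhds (hxV x hxS))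
  have htne : t.Nonempty := by
    obtain ⟨x, hxS⟩ := hne
    obtain ⟨y, hy, _⟩ := mem_iUnion₂.1 (hcov hxS)
    exact ⟨y, hy⟩
  obtain ⟨e, he⟩ := htc.exists_eq_range htne
  have heS : ∀ n, e n ∈ S := fun n => htS (by rw [he]; exact mem_range_self n)
  have hcov' : S ⊆ ⋃ n, V (e n) := by
    intro x hxS
    obtain ⟨y, hy, hxy⟩ := mem_iUnion₂.1 (hcov hxS)
    rw [he] at hy
    obtain ⟨n, rfl⟩ := hy
    exact mem_iUnion.2 ⟨n, hxy⟩
  set D := disjointed fun n => V (e n) with hD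
  have hDm : ∀ n, MeasurableSet (D n) :=
    fun n => MeasurableSet.disjointed (fun n => (hVo _ (heS n)).measurableSet) n
  have hDV : ∀ n, D n ⊆ V (e n) := fun n => disjointed_subset _ n
  have hDd : Pairwise (Function.onFun Disjoint D) := disjoint_disjointed _
  have hDU : ⋃ n, D n = ⋃ n, V (e n) := iUnion_disjointed
  have hMap : ∀ X, MeasurableSet X →
      (Measure.sum fun n => (patchMeasure (U (e n)) (ψ (e n))).restrict (D n)) X =
        ∑' n, ∫⁻ u in U (e n) ∩ ψ (e n) ⁻¹' (X ∩ D n), volDensity (ψ (e n)) u := by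
    intro X hX
    rw [Measure.sum_apply _ hX]
    congr 1
    ext n
    rw [Measure.restrict_apply hX, patchMeasure_apply (hp _ (heS n)) (hX.inter (hDm n))]
  refine ⟨Measure.sum fun n => (patchMeasure (U (e n)) (ψ (e n))).restrict (D n), ?_, ?_⟩
  · rw [hMap _ hSm.compl, ENNReal.tsum_eq_zero]
    intro n
    have : U (e n) ∩ ψ (e n) ⁻¹' (Sᶜ ∩ D n) = ∅ := by
      ext u
      simp only [mem_inter_iff, mem_preimage, mem_empty_iff_false, iff_false]
      rintro ⟨hu, hu2, _⟩
      exact hu2 ((hp _ (heS n)).subset ⟨u, hu, rfl⟩)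
    rw [this]; simp
  · intro U₀ ψ₀ h₀ A hA hAU
    have hY : MeasurableSet (ψ₀ '' A) :=
      hA.image_of_continuousOn_injOn (h₀.contDiffOn.continuousOn.mono hAU) (h₀.injOn.mono hAU)
    have hYS : ψ₀ '' A ⊆ S := (image_mono hAU).trans h₀.subset
    rw [hMap _ hY]
    have h1 : ∀ n, ∫⁻ u in U (e n) ∩ ψ (e n) ⁻¹' (ψ₀ '' A ∩ D n), volDensity (ψ (e n)) u =
        ∫⁻ u in U₀ ∩ ψ₀ ⁻¹' (ψ₀ '' A ∩ D n), volDensity ψ₀ u := by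
      intro n
      refine lintegral_volDensity_eq (hp _ (heS n)) h₀ (hY.inter (hDm n)) ?_
        (inter_subset_left.trans (image_mono hAU))
      rw [hV _ (heS n)]
      exact inter_subset_inter hYS (hDV n)
    simp_rw [h1]
    rw [← lintegral_iUnion (fun n => measurableSet_inter_preimage h₀.isOpen.measurableSet
      h₀.contDiffOn.continuousOn (hY.inter (hDm n)))]
    · have : ⋃ n, U₀ ∩ ψ₀ ⁻¹' (ψ₀ '' A ∩ D n) = A := by
        rw [← inter_iUnion, ← preimage_iUnion, ← inter_iUnion, hDU,
          inter_eq_left.2 (hYS.trans hcov')]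
        exact h₀.injOn.preimage_image_inter hAU |> fun h => by rw [inter_comm]; exact h
      rw [this]; rfl
    · intro m n hmn
      rw [Function.onFun, Set.disjoint_left]
      rintro u ⟨_, _, h3⟩ ⟨_, _, h4⟩
      exact Set.disjoint_left.1 (hDd hmn) h3 h4

theorem IsRiemannianVolume.restrict_image {M : Measure (EuclideanSpace ℝ (Fin d))}
    (hM : IsRiemannianVolume k S M) (h₁ : IsLocalParam S U₁ ψ₁) :
    M.restrict (ψ₁ '' U₁) = patchMeasure U₁ ψ₁ := by
  ext X hX
  rw [patchMeasure_apply h₁ hX, Measure.restrict_apply hX]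
  have h2 : X ∩ ψ₁ '' U₁ = ψ₁ '' (U₁ ∩ ψ₁ ⁻¹' X) := by
    rw [image_inter_preimage, inter_comm]
  rw [h2, hM.apply_image U₁ ψ₁ h₁ _ (measurableSet_inter_preimage h₁.isOpen.measurableSet
    h₁.contDiffOn.continuousOn hX) inter_subset_left]
  rfl

end Volume

/-! ### Determinants of bilinear forms -/

section Bilin

variable {k n d : ℕ}

/-- The matrix of a bilinear form in a family of vectors. -/
def bilinMatrix {V ι : Type*} [NormedAddCommGroup V] [NormedSpace ℝ V] (H : V →L[ℝ] V →L[ℝ] ℝ)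
    (b : ι → V) : Matrix ι ι ℝ :=
  Matrix.of fun i j => H (b i) (b j)

theorem dotProduct_bilinMatrix {V ι : Type*} [NormedAddCommGroup V] [NormedSpace ℝ V] [Fintype ι]
    (H : V →L[ℝ] V →L[ℝ] ℝ) (b : ι → V) (v : ι → ℝ) :
    v ⬝ᵥ (bilinMatrix H b).mulVec v = H (∑ i, v i • b i) (∑ i, v i • b i) := by
  simp only [dotProduct, Matrix.mulVec, bilinMatrix, Matrix.of_apply, map_sum, map_smul,
    sum_apply, smul_apply, smul_eq_mul, Finset.mul_sum]
  rw [Finset.sum_comm]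
  refine Finset.sum_congr rfl fun i _ => Finset.sum_congr rfl fun j _ => ?_
  ring

theorem det_bounds_of_form_bounds {n : ℕ} {A : Matrix (Fin n) (Fin n) ℝ} (hA : A.IsHermitian)
    {a Λ : ℝ} (ha : 0 ≤ a) (hlow : ∀ v : EuclideanSpace ℝ (Fin n), a * ‖v‖ ^ 2 ≤ v ⬝ᵥ A.mulVec v)
    (hup : ∀ v : EuclideanSpace ℝ (Fin n), v ⬝ᵥ A.mulVec v ≤ Λ * ‖v‖ ^ 2) :
    a ^ n ≤ A.det ∧ A.det ≤ Λ ^ n := by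
  have h1 : ∀ i, hA.eigenvalues i =
      (hA.eigenvectorBasis i : EuclideanSpace ℝ (Fin n)) ⬝ᵥ
        A.mulVec (hA.eigenvectorBasis i : EuclideanSpace ℝ (Fin n)) := by
    intro i
    rw [hA.eigenvalues_eq i]; simp
  have h2 : ∀ i, ‖(hA.eigenvectorBasis i : EuclideanSpace ℝ (Fin n))‖ = 1 :=
    fun i => hA.eigenvectorBasis.orthonormal.1 i
  have h3 : ∀ i, a ≤ hA.eigenvalues i := fun i => by
    have := hlow (hA.eigenvectorBasis i)
    rw [← h1, h2] at this; simpa using this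
  have h4 : ∀ i, hA.eigenvalues i ≤ Λ := fun i => by
    have := hup (hA.eigenvectorBasis i)
    rw [← h1, h2] at this; simpa using this
  have hdet : A.det = ∏ i, hA.eigenvalues i := by
    rw [hA.det_eq_prod_eigenvalues]; simp
  rw [hdet]
  constructor
  · calc a ^ n = ∏ _i : Fin n, a := by simp
      _ ≤ _ := Finset.prod_le_prod (fun _ _ => ha) fun i _ => h3 i
  · calc ∏ i, hA.eigenvalues i ≤ ∏ _i : Fin n, Λ :=
        Finset.prod_le_prod (fun i _ => ha.trans (h3 i)) fun i _ => h4 i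
      _ = Λ ^ n := by simp

theorem det_bilinMatrix_bounds {V : Type*} [NormedAddCommGroup V] [InnerProductSpace ℝ V]
    {H : V →L[ℝ] V →L[ℝ] ℝ} (hH : ∀ v w, H v w = H w v) {b : Fin n → V} (hb : Orthonormal ℝ b)
    {a Λ : ℝ} (ha : 0 ≤ a) (hlow : ∀ v ∈ Submodule.span ℝ (range b), a * ‖v‖ ^ 2 ≤ H v v)
    (hup : ∀ v, H v v ≤ Λ * ‖v‖ ^ 2) :
    a ^ n ≤ (bilinMatrix H b).det ∧ (bilinMatrix H b).det ≤ Λ ^ n := by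
  have hn : ∀ v : EuclideanSpace ℝ (Fin n), ‖∑ i, v i • b i‖ ^ 2 = ‖v‖ ^ 2 := fun v => by
    rw [← real_inner_self_eq_norm_sq, hb.inner_sum, EuclideanSpace.norm_sq_eq]
    simp [sq]
  refine det_bounds_of_form_bounds (Matrix.IsHermitian.ext fun i j => by simp [bilinMatrix, hH])
    ha (fun v => ?_) fun v => ?_
  · rw [dotProduct_bilinMatrix, ← hn]
    exact hlow _ (Submodule.sum_mem _ fun i _ =>
      Submodule.smul_mem _ _ (Submodule.subset_span (mem_range_self i)))
  · rw [dotProduct_bilinMatrix, ← hn]; exact hup _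

/-- The images of the coordinate vectors under the second embedding of a frame. -/
def OrthFrame.jVec (F : OrthFrame k n d) (i : Fin n) : EuclideanSpace ℝ (Fin d) :=
  F.J (EuclideanSpace.single i 1)

/-- Linear algebra behind the change from fibre to normal determinants. The form `H` kills the graph
directions, so an orthonormal normal family `b` may be replaced by its components along `F.J` modulo
those directions. The square of the determinant of this change of vectors is the Gram determinant of
the graph. -/
theorem det_bilinMatrix_eq_mul (F : OrthFrame k n d)
    {H : EuclideanSpace ℝ (Fin d) →L[ℝ] EuclideanSpace ℝ (Fin d) →L[ℝ] ℝ}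
    (hH : ∀ v w, H v w = H w v)
    (W : EuclideanSpace ℝ (Fin k) →L[ℝ] EuclideanSpace ℝ (Fin n))
    (hB : ∀ u, H ((F.I + F.J ∘L W) u) = 0) {b : Fin n → EuclideanSpace ℝ (Fin d)}
    (hb : Orthonormal ℝ b) (hbB : ∀ i u, inner ℝ (b i) ((F.I + F.J ∘L W) u) = 0) :
    (bilinMatrix H b).det = (bilinMatrix H F.jVec).det *
      ((matrixOf (F.I + F.J ∘L W)).transpose * matrixOf (F.I + F.J ∘L W)).det := by
  set w := matrixOf W with hw
  let X : Matrix (Fin k) (Fin n) ℝ := Matrix.of fun l i => F.I' (b i) l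
  let Y : Matrix (Fin n) (Fin n) ℝ := Matrix.of fun l i => F.J' (b i) l
  have hW : ∀ l m, W (EuclideanSpace.single l 1) m = w m l := fun l m => rfl
  have hgram : (matrixOf (F.I + F.J ∘L W)).transpose * matrixOf (F.I + F.J ∘L W) =
      1 + w.transpose * w := by
    ext i j
    rw [matrixOf_inner, Matrix.add_apply, hw, matrixOf_inner]
    simp only [add_apply, ContinuousLinearMap.comp_apply, inner_add_left, F.inner_I, F.inner_J,
      map_add, F.I'_I, F.I'_J, F.J'_I, F.J'_J, add_zero, zero_add]
    congr 1
    rw [Matrix.one_apply, EuclideanSpace.inner_single_left]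
    simp
  have hX : X = -(w.transpose * Y) := by
    ext l i
    have h1 := hbB i (EuclideanSpace.single l 1)
    rw [real_inner_comm] at h1
    simp only [add_apply, ContinuousLinearMap.comp_apply, inner_add_left, F.inner_I, F.inner_J] at h1
    rw [Matrix.neg_apply, Matrix.mul_apply]
    have h2 : inner ℝ (W (EuclideanSpace.single l 1)) (F.J' (b i)) =
        ∑ m, w.transpose l m * Y m i := by
      rw [PiLp.inner_apply]
      exact Finset.sum_congr rfl fun m _ => by
        simp only [hW, Matrix.transpose_apply, Y, Matrix.of_apply]
        simp [mul_comm]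
    rw [h2] at h1
    have h3 : inner ℝ (EuclideanSpace.single l (1 : ℝ)) (F.I' (b i)) = X l i := by
      simp [X, EuclideanSpace.inner_single_left]
    rw [h3] at h1
    linarith
  have hON : X.transpose * X + Y.transpose * Y = 1 := by
    ext i j
    have h1 : inner ℝ (b i) (b j) = inner ℝ (F.I' (b i)) (F.I' (b j)) +
        inner ℝ (F.J' (b i)) (F.J' (b j)) := by
      conv_lhs => rw [← F.sum_eq (b i)]
      rw [inner_add_left, F.inner_I, F.inner_J]
    rw [orthonormal_iff_ite.1 hb i j, PiLp.inner_apply, PiLp.inner_apply] at h1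
    rw [Matrix.add_apply, Matrix.mul_apply, Matrix.mul_apply, Matrix.one_apply, h1]
    simp [X, Y, mul_comm]
  have hYY : Y.transpose * ((1 + w * w.transpose) * Y) = 1 := by
    conv_rhs => rw [← hON, hX]
    simp only [Matrix.transpose_neg, Matrix.transpose_mul, Matrix.transpose_transpose,
      Matrix.neg_mul, Matrix.mul_neg, neg_neg, Matrix.add_mul, Matrix.mul_add, Matrix.one_mul,
      Matrix.mul_assoc]
    abel
  have hdetY : Y.det * ((1 + w * w.transpose).det * Y.det) = 1 := by
    have := congrArg Matrix.det hYY
    rwa [Matrix.det_mul, Matrix.det_mul, Matrix.det_transpose, Matrix.det_one] at this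
  -- `Q` gives the coordinates of `b` along `F.J` after subtracting graph vectors. Normality gives
  -- `X = -wᵀ Y`, and orthonormality becomes `Yᵀ (1 + w wᵀ) Y = 1`, so `(det Q)² = det (1 + w wᵀ)`,
  -- which is `det (1 + wᵀ w)`.
  let Q : Matrix (Fin n) (Fin n) ℝ := (1 + w * w.transpose) * Y
  have hQ : Q = Y - w * X := by
    simp only [Q, hX, Matrix.add_mul, Matrix.one_mul, Matrix.mul_neg, sub_neg_eq_add,
      Matrix.mul_assoc]
  have hbdec : ∀ i, b i = (F.I + F.J ∘L W) (F.I' (b i)) + ∑ l, Q l i • F.jVec l := by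
    intro i
    have h1 : ∑ l, Q l i • F.jVec l = F.J (F.J' (b i) - W (F.I' (b i))) := by
      rw [apply_eq_sum F.J]
      refine Finset.sum_congr rfl fun l _ => ?_
      have h2 : Q l i = (F.J' (b i) - W (F.I' (b i))) l := by
        rw [hQ, Matrix.sub_apply, Matrix.mul_apply, apply_eq_sum W]
        simp [X, Y, hw, matrixOf, mul_comm]
      rw [h2]; rfl
    rw [h1]
    simp only [add_apply, ContinuousLinearMap.comp_apply, map_sub]
    conv_lhs => rw [← F.sum_eq (b i)]
    abel
  have hHb : bilinMatrix H b = Q.transpose * (bilinMatrix H F.jVec * Q) := by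
    ext i j
    have h0 : ∀ u v, H v ((F.I + F.J ∘L W) u) = 0 := fun u v => by rw [hH, hB]; rfl
    have h1 : bilinMatrix H b i j = H (∑ l, Q l i • F.jVec l) (∑ l, Q l j • F.jVec l) := by
      simp only [bilinMatrix, Matrix.of_apply]
      conv_lhs => rw [hbdec i, hbdec j]
      rw [map_add, h0, zero_add, map_add, hB, zero_add]
    rw [h1]
    simp only [Matrix.mul_apply, Matrix.transpose_apply, bilinMatrix, Matrix.of_apply, map_sum,
      map_smul, sum_apply, smul_apply, smul_eq_mul, Finset.mul_sum]
    rw [Finset.sum_comm]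
    refine Finset.sum_congr rfl fun l _ => Finset.sum_congr rfl fun m _ => ?_
    ring
  rw [hHb, hgram, Matrix.det_mul, Matrix.det_mul, Matrix.det_transpose,
    Matrix.det_one_add_mul_comm w.transpose w, Matrix.det_mul]
  linear_combination ((1 + w * w.transpose).det * (bilinMatrix H F.jVec).det) * hdetY

/-! ### Kernels of bilinear forms -/

variable {H : EuclideanSpace ℝ (Fin d) →L[ℝ] EuclideanSpace ℝ (Fin d) →L[ℝ] ℝ}

/-- The kernel of a bilinear form. -/
def formKer (H : EuclideanSpace ℝ (Fin d) →L[ℝ] EuclideanSpace ℝ (Fin d) →L[ℝ] ℝ) :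
    Submodule ℝ (EuclideanSpace ℝ (Fin d)) :=
  LinearMap.ker H.toLinearMap

theorem mem_formKer {x : EuclideanSpace ℝ (Fin d)} : x ∈ formKer H ↔ H x = 0 := Iff.rfl

theorem OrthFrame.finrank_range_J (F : OrthFrame k n d) :
    Module.finrank ℝ (LinearMap.range F.J.toLinearMap) = n := by
  rw [LinearMap.finrank_range_of_inj]
  · simp
  · exact Function.LeftInverse.injective F.J'_J

theorem disjoint_ker_range (F : OrthFrame k n d) (hpos : ∀ v, v ≠ 0 → 0 < H (F.J v) (F.J v)) :
    Disjoint (formKer H)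
      (LinearMap.range F.J.toLinearMap) := by
  rw [Submodule.disjoint_def]
  rintro x hx ⟨v, rfl⟩
  by_contra hne
  have hv : v ≠ 0 := fun h => hne (by simp [h])
  have h1 := hpos v hv
  have h2 : H (F.J v) = 0 := hx
  rw [h2] at h1
  exact lt_irrefl _ h1

theorem finrank_ker_le (F : OrthFrame k n d) (hpos : ∀ v, v ≠ 0 → 0 < H (F.J v) (F.J v)) :
    Module.finrank ℝ (formKer H) ≤ k := by
  have h1 := Submodule.finrank_add_finrank_le_of_disjoint (disjoint_ker_range F hpos)
  rw [F.finrank_range_J] at h1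
  have h2 := F.dim_eq
  simp at h1
  omega

theorem exists_ker_add_range (F : OrthFrame k n d)
    (hpos : ∀ v, v ≠ 0 → 0 < H (F.J v) (F.J v))
    (hk : Module.finrank ℝ (formKer H) = k)
    (y : EuclideanSpace ℝ (Fin d)) : ∃ z v, H z = 0 ∧ y = z + F.J v := by
  have h1 := Submodule.eq_top_of_disjoint
    (formKer H)
    (LinearMap.range F.J.toLinearMap)
    (by rw [hk, F.finrank_range_J]; simp [F.dim_eq]) (disjoint_ker_range F hpos)
  have h2 : y ∈ formKer H ⊔
      LinearMap.range F.J.toLinearMap := by rw [h1]; trivial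
  obtain ⟨z, hz, _, ⟨v, rfl⟩, rfl⟩ := Submodule.mem_sup.1 h2
  exact ⟨z, v, hz, rfl⟩

/-- By dimension, the kernel and the range of `F.J` span the whole space, and symmetry handles the
pairing with the kernel. -/
theorem eq_zero_of_forall_J (F : OrthFrame k n d) (hH : ∀ v w, H v w = H w v)
    (hpos : ∀ v, v ≠ 0 → 0 < H (F.J v) (F.J v))
    (hk : Module.finrank ℝ (formKer H) = k)
    {z : EuclideanSpace ℝ (Fin d)} (hz : ∀ v, H z (F.J v) = 0) : H z = 0 := by
  ext1 y
  obtain ⟨z', v, hz', rfl⟩ := exists_ker_add_range F hpos hk y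
  rw [map_add, hz, add_zero, hH, hz']; rfl

/-- If a form is bounded below on the complement `range J` of its kernel, then it has the same
lower bound on the orthogonal complement of the kernel. -/
theorem le_of_forall_ker_orthogonal (F : OrthFrame k n d) (hH : ∀ v w, H v w = H w v) {a : ℝ}
    (ha : 0 < a) (hlow : ∀ v, a * ‖v‖ ^ 2 ≤ H (F.J v) (F.J v))
    (hk : Module.finrank ℝ (formKer H) = k)
    {y : EuclideanSpace ℝ (Fin d)} (hy : ∀ z, H z = 0 → inner ℝ z y = 0) :
    a * ‖y‖ ^ 2 ≤ H y y := by
  have hpos : ∀ v, v ≠ 0 → 0 < H (F.J v) (F.J v) := fun v hv =>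
    lt_of_lt_of_le (by have := norm_pos_iff.2 hv; positivity) (hlow v)
  obtain ⟨z, v, hz, hyz⟩ := exists_ker_add_range F hpos hk y
  have h1 : H y y = H (F.J v) (F.J v) := by
    have h0 : ∀ w, H w z = 0 := fun w => by rw [hH, hz]; rfl
    rw [hyz, map_add, h0, zero_add, map_add, hz, zero_add]
  -- Since `F.J v = y - z` with `z` in the kernel and `y` orthogonal to it, passing from `y` to `F.J
  -- v` leaves the form unchanged and can only increase the norm.
  have h2 : ‖v‖ ^ 2 = ‖y‖ ^ 2 + ‖z‖ ^ 2 := by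
    have h3 : F.J v = y - z := by rw [hyz]; abel
    rw [← F.norm_J, h3, norm_sub_sq_real, real_inner_comm, hy z hz]; ring
  rw [h1]
  refine le_trans ?_ (hlow v)
  rw [h2]
  have : 0 ≤ a * ‖z‖ ^ 2 := by positivity
  linarith

end Bilin

/-! ### Functions satisfying a Polyak-Lojasiewicz inequality near a connected set of minimizers -/

/-- `f` is `C²`, satisfies the Polyak-Lojasiewicz inequality near its compact connected set of
minimizers, where it is `C⁴`, all its other critical points are nondegenerate maxima, and it grows
quadratically. -/
structure IsPLMin {d : ℕ} (f : EuclideanSpace ℝ (Fin d) → ℝ) (c μ : ℝ) : Prop where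
  contDiff : ContDiff ℝ 2 f
  le : ∀ x, c ≤ f x
  pos : 0 < μ
  localPL : ∀ x, f x = c → ∃ W, IsOpen W ∧ x ∈ W ∧ ContDiffOn ℝ 4 f W ∧
    ∀ y ∈ W, f y - c ≤ μ * ‖fderiv ℝ f y‖ ^ 2
  nonempty : ∃ x, f x = c
  preconnected : IsPreconnected {x | f x = c}
  isCompact : IsCompact {x | f x = c}
  eq_of_isLocalMin : ∀ x, IsLocalMin f x → f x = c
  crit : ∀ x, fderiv ℝ f x = 0 → f x = c ∨ ∀ v, v ≠ 0 → hess f x v v < 0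
  growth : ∃ a > 0, ∃ R : ℝ, ∀ x, a * ‖x‖ ^ 2 - R ≤ f x

theorem norm_gradient_eq {d : ℕ} (f : EuclideanSpace ℝ (Fin d) → ℝ)
    (x : EuclideanSpace ℝ (Fin d)) : ‖gradient f x‖ = ‖fderiv ℝ f x‖ :=
  LinearIsometryEquiv.norm_map _ _

theorem gradient_eq_zero_iff {d : ℕ} (f : EuclideanSpace ℝ (Fin d) → ℝ)
    (x : EuclideanSpace ℝ (Fin d)) : gradient f x = 0 ↔ fderiv ℝ f x = 0 := by
  rw [← norm_eq_zero, norm_gradient_eq, norm_eq_zero]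

theorem exists_growth {d : ℕ} {h : EuclideanSpace ℝ (Fin d) → ℝ} (hc : Continuous h) {c μ D : ℝ}
    (hμ : 0 < μ) {S : Set (EuclideanSpace ℝ (Fin d))} (hS : Bornology.IsBounded S)
    (hne : S.Nonempty)
    (hg : ∀ x, D ≤ ‖x‖ → μ * Metric.infDist x S ^ 2 / 2 ≤ h x - c) :
    ∃ a > 0, ∃ R : ℝ, ∀ x, a * ‖x‖ ^ 2 - R ≤ h x := by
  obtain ⟨r, hr⟩ := hS.subset_closedBall 0
  obtain ⟨C, hC⟩ := (isCompact_closedBall (0 : EuclideanSpace ℝ (Fin d))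
    (max D (max r 0))).exists_bound_of_continuousOn hc.continuousOn
  have hinf : ∀ x, ‖x‖ - r ≤ Metric.infDist x S := fun x => by
    refine (Metric.le_infDist hne).2 fun {y} hy => ?_
    have h1 : ‖y‖ ≤ r := by simpa using hr hy
    have h2 := norm_sub_norm_le x y
    rw [dist_eq_norm]; linarith
  set a := μ / 4 with ha
  refine ⟨a, by positivity, |C| + |c| + μ * r ^ 2 / 2 + a * (max D (max r 0)) ^ 2,
    fun x => ?_⟩
  have h5 : 0 ≤ a * (max D (max r 0)) ^ 2 := by positivity
  have h6 : 0 ≤ μ * r ^ 2 / 2 := by positivity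
  rcases le_total ‖x‖ (max D (max r 0)) with hx | hx
  · have h1 := hC x (by simpa using hx)
    rw [Real.norm_eq_abs] at h1
    have h2 := (abs_le.1 (h1.trans (le_abs_self C))).1
    have h3 : a * ‖x‖ ^ 2 ≤ a * (max D (max r 0)) ^ 2 := by gcongr
    have := abs_nonneg c
    linarith
  · have h1 := hg x ((le_max_left _ _).trans hx)
    have h2 : r ≤ ‖x‖ := (le_max_left _ _).trans ((le_max_right _ _).trans hx)
    have h3 : (‖x‖ - r) ^ 2 ≤ Metric.infDist x S ^ 2 :=
      pow_le_pow_left₀ (by linarith) (hinf x) 2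
    have h4 : μ * (‖x‖ - r) ^ 2 / 2 ≤ h x - c := le_trans (by gcongr) h1
    have h7 : ‖x‖ ^ 2 / 2 - r ^ 2 ≤ (‖x‖ - r) ^ 2 := by nlinarith [sq_nonneg (‖x‖ - 2 * r)]
    have h8 : μ * (‖x‖ ^ 2 / 2 - r ^ 2) / 2 ≤ μ * (‖x‖ - r) ^ 2 / 2 := by gcongr
    have h9 : a * ‖x‖ ^ 2 - μ * r ^ 2 / 2 = μ * (‖x‖ ^ 2 / 2 - r ^ 2) / 2 := by rw [ha]; ring
    have h10 := abs_nonneg C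
    have h11 := neg_abs_le c
    linarith

theorem isBounded_sublevel {d : ℕ} {h : EuclideanSpace ℝ (Fin d) → ℝ}
    (hg : ∃ a > 0, ∃ R : ℝ, ∀ x, a * ‖x‖ ^ 2 - R ≤ h x) (b : ℝ) :
    Bornology.IsBounded {x | h x ≤ b} := by
  obtain ⟨a, ha, R, hR⟩ := hg
  refine (Metric.isBounded_closedBall (x := (0 : EuclideanSpace ℝ (Fin d)))
    (r := √((R + b) / a))).subset fun x (hx : h x ≤ b) => ?_
  have h1 : a * ‖x‖ ^ 2 ≤ R + b := by linarith [hR x]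
  rw [mem_closedBall_zero_iff]
  refine Real.le_sqrt_of_sq_le ?_
  rw [le_div_iff₀ ha]; linarith

/-- The local `PL°` condition and quadratic growth: all local minima are global, and they form
a connected compact set. -/
theorem PLCirc.exists_isPLMin {d : ℕ} (hd : 2 ≤ d) {h : EuclideanSpace ℝ (Fin d) → ℝ}
    (hPL : PLCirc h) {c ν D : ℝ} (hc : IsLeast (range h) c) (hν : 0 < ν)
    (hg : ∀ x, D ≤ ‖x‖ → ν * Metric.infDist x (argminSet h) ^ 2 / 2 ≤ h x - c) :
    ∃ μ, IsPLMin h c μ ∧ argminSet h = {x | h x = c} := by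
  obtain ⟨hC2, ⟨μ, hμ, N, hN, hcrit⟩, K, hK, hMK⟩ := hPL
  obtain ⟨⟨x₀, hx₀⟩, hcmin⟩ := hc
  have hle : ∀ x, c ≤ h x := fun x => hcmin (mem_range_self x)
  have harg : argminSet h = {x | h x = c} := by
    ext x
    exact ⟨fun hx => le_antisymm (hx₀ ▸ hx x₀) (hle x), fun hx z => by
      rw [mem_ofPred_eq] at hx; rw [hx]; exact hle z⟩
  have hlmin : ∀ x, h x = c → IsLocalMin h x := fun x hx =>
    Eventually.of_forall fun y => hx ▸ hle y
  have hSb : Bornology.IsBounded {x | h x = c} := hK.isBounded.subset fun x hx => hMK (hlmin x hx)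
  rw [harg] at hg
  have hgrow := exists_growth hC2.continuous hν hSb ⟨x₀, hx₀⟩ hg
  -- A critical point inside some `N C` attains the minimum over that open set by the PŁ inequality,
  -- so it is a local minimum; the others fall under the second clause.
  have hcrit' : ∀ x, fderiv ℝ h x = 0 → ¬ IsLocalMin h x → ∀ v, v ≠ 0 → hess h x v v < 0 := by
    intro x hx hnot
    refine hcrit x (fun hmem => hnot ?_) ((gradient_eq_zero_iff h x).2 hx)
    obtain ⟨C, hC, hxC⟩ := mem_iUnion₂.1 hmem
    obtain ⟨hopen, _, ⟨c', hc', hpl⟩, _⟩ := hN C hC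
    have h1 := hpl x hxC
    rw [(gradient_eq_zero_iff h x).2 hx, norm_zero] at h1
    filter_upwards [hopen.mem_nhds hxC] with y hy
    have := hc'.2 (mem_image_of_mem h hy)
    nlinarith
  have hconn := isPreconnected_setOf_isLocalMin hd hC2 (isBounded_sublevel hgrow) hcrit'
    (hK.isBounded.subset hMK)
  have hloc : ∀ x, IsLocalMin h x → ∃ W, IsOpen W ∧ x ∈ W ∧ ContDiffOn ℝ 4 h W ∧
      ∀ y ∈ W, h y - h x ≤ (2 * μ)⁻¹ * ‖fderiv ℝ h y‖ ^ 2 := by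
    intro x hx
    have hC : connectedComponentIn (localMinima h) x ∈ componentsOf (localMinima h) := ⟨x, hx, rfl⟩
    obtain ⟨hopen, hsub, ⟨c', hc', hpl⟩, hsm⟩ := hN _ hC
    have hxN := hsub (mem_connectedComponentIn hx)
    refine ⟨_, hopen, hxN, hsm, fun y hy => ?_⟩
    have h1 := hpl y hy
    have h2 := hc'.2 (mem_image_of_mem h hxN)
    rw [norm_gradient_eq] at h1
    linarith
  have hall : ∀ x, IsLocalMin h x → h x = c := by
    intro x hx
    by_contra hne
    have hcl := isClosed_setOf_isLocalMin hC2 hcrit'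
    -- Local minima are critical, so the PŁ inequality makes `h` locally constant on them;
    -- connectedness then leaves only the value `c`.
    have hloceq : ∀ x, IsLocalMin h x → ∀ᶠ y in 𝓝 x, IsLocalMin h y → h y = h x := by
      intro x hx
      obtain ⟨W, hW, hxW, _, hpl⟩ := hloc x hx
      have hx' : ∀ᶠ y in 𝓝 x, h x ≤ h y := hx
      filter_upwards [hW.mem_nhds hxW, hx'] with y hy hxy hmin
      have h1 := hpl y hy
      rw [hmin.fderiv_eq_zero, norm_zero] at h1
      linarith
    obtain ⟨y, hy, hy1, hy2⟩ := isPreconnected_closed_iff.1 hconn {y | h y = c}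
      ({y | IsLocalMin h y} ∩ {y | h y ≠ c}) (isClosed_eq hC2.continuous continuous_const)
      (by
        refine isClosed_of_closure_subset fun y hy => ?_
        have hym : IsLocalMin h y :=
          closure_minimal (fun z hz => hz.1) hcl hy
        refine ⟨hym, fun hyc => ?_⟩
        obtain ⟨z, hz1, hz2⟩ := ((mem_closure_iff_frequently.1 hy).and_eventually
          (hloceq y hym)).exists
        exact hz1.2 ((hz2 hz1.1).trans hyc))
      (fun y hy => (em (h y = c)).imp id fun hyc => ⟨hy, hyc⟩)
      ⟨x₀, hlmin x₀ hx₀, hx₀⟩ ⟨x, hx, hx, hne⟩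
    exact hy2.2 hy1
  have hM : {x | IsLocalMin h x} = {x | h x = c} := by
    ext x; exact ⟨hall x, hlmin x⟩
  -- The constant of `IsPLMin` is the factor in front of the squared gradient, hence the inverse of
  -- the usual PŁ constant up to a factor of two.
  refine ⟨(2 * μ)⁻¹, ⟨hC2, hle, by positivity, fun x hx => ?_, ⟨x₀, hx₀⟩, hM ▸ hconn, ?_, hall,
    fun x hx => ?_, hgrow⟩, harg⟩
  · have := hloc x (hlmin x hx)
    rwa [hx] at this
  · exact Metric.isCompact_of_isClosed_isBounded
      (isClosed_eq hC2.continuous continuous_const) hSb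
  · by_cases hx' : IsLocalMin h x
    · exact Or.inl (hall x hx')
    · exact Or.inr (hcrit' x hx hx')

/-! ### Second-order consequences of the Polyak-Lojasiewicz inequality. -/

namespace IsPLMin

variable {d : ℕ} {f : EuclideanSpace ℝ (Fin d) → ℝ} {c μ : ℝ} {x : EuclideanSpace ℝ (Fin d)}

theorem fderiv_eq_zero (h : IsPLMin f c μ) (hx : f x = c) : fderiv ℝ f x = 0 :=
  IsLocalMin.fderiv_eq_zero (Eventually.of_forall fun y => hx ▸ h.le y)

theorem hess_nonneg (h : IsPLMin f c μ) (hx : f x = c) (z : EuclideanSpace ℝ (Fin d)) :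
    0 ≤ hess f x z z := by
  have h1 := tendsto_taylor_quotient h.contDiff (h.fderiv_eq_zero hx) z
  have h2 : 0 ≤ 1 / 2 * hess f x z z := ge_of_tendsto' h1 fun σ => by
    have := h.le (x + σ • z)
    rw [hx]; exact div_nonneg (by linarith) (sq_nonneg _)
  linarith

/-- The PŁ inequality at `x + σ z`, divided by `σ²`, in the limit `σ ↓ 0`. -/
theorem half_hess_le (h : IsPLMin f c μ) (hx : f x = c) (z : EuclideanSpace ℝ (Fin d)) :
    (1 / 2) * hess f x z z ≤ μ * ‖hess f x z‖ ^ 2 := by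
  obtain ⟨W, hW, hxW, -, hPL⟩ := h.localPL x hx
  have h1 := tendsto_taylor_quotient h.contDiff (h.fderiv_eq_zero hx) z
  have h3 : HasDerivAt (fun s : ℝ => x + s • z) z 0 := by
    simpa using ((hasDerivAt_id (0 : ℝ)).smul_const z).const_add x
  have h2 : HasDerivAt (fun s : ℝ => fderiv ℝ f (x + s • z)) (hess f x z) 0 := by
    have h4 : HasFDerivAt (fderiv ℝ f) (hess f x) (x + (0 : ℝ) • z) := by
      simpa using hasFDerivAt_fderiv_of_contDiff_two h.contDiff x
    exact h4.comp_hasDerivAt (0 : ℝ) h3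
  have h5 := hasDerivAt_iff_tendsto_slope.1 h2
  have h6 : Tendsto (fun σ : ℝ => μ * ‖slope (fun s : ℝ => fderiv ℝ f (x + s • z)) 0 σ‖ ^ 2)
      (𝓝[>] 0) (𝓝 (μ * ‖hess f x z‖ ^ 2)) :=
    ((h5.mono_left (nhdsWithin_mono _ fun s (hs : 0 < s) => hs.ne')).norm.pow 2).const_mul μ
  refine le_of_tendsto_of_tendsto h1 h6 ?_
  have h7 : ∀ᶠ σ : ℝ in 𝓝[>] 0, x + σ • z ∈ W := by
    have : Tendsto (fun s : ℝ => x + s • z) (𝓝 0) (𝓝 x) := by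
      simpa using h3.continuousAt.tendsto
    exact (this.mono_left nhdsWithin_le_nhds).eventually (hW.mem_nhds hxW)
  filter_upwards [h7, self_mem_nhdsWithin] with σ hσ hσ0
  have hσ0 : 0 < σ := hσ0
  rw [slope_def_module, sub_zero, zero_smul, add_zero, h.fderiv_eq_zero hx, sub_zero, norm_smul,
    hx, div_le_iff₀ (by positivity), Real.norm_eq_abs, abs_of_pos (inv_pos.2 hσ0)]
  refine (hPL _ hσ).trans (le_of_eq ?_)
  field_simp

/-- The Hessian is bounded below by a fixed constant in the directions normal to its kernel. -/
theorem gap (h : IsPLMin f c μ) (hx : f x = c) {v : EuclideanSpace ℝ (Fin d)}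
    (hv : ∀ z, hess f x z = 0 → inner ℝ z v = 0) : (1 / (2 * μ)) * ‖v‖ ^ 2 ≤ hess f x v v := by
  set H := hess f x with hH
  have hsymm : ∀ v w, H v w = H w v := hess_comm h.contDiff x
  let A : EuclideanSpace ℝ (Fin d) →ₗ[ℝ] EuclideanSpace ℝ (Fin d) :=
    ((rieszVec d) ∘L H).toLinearMap
  have hA : ∀ z w, inner ℝ (A z) w = H z w := fun z w => inner_rieszVec _ w
  have hAs : A.IsSymmetric := fun z w => by rw [hA, hsymm, ← hA, real_inner_comm]
  have hfr : Module.finrank ℝ (EuclideanSpace ℝ (Fin d)) = d := by simp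
  let b := hAs.eigenvectorBasis hfr
  let lam := hAs.eigenvalues hfr
  have hAb : ∀ i, A (b i) = lam i • b i := fun i => hAs.apply_eigenvectorBasis hfr i
  have hHb : ∀ i w, H (b i) w = lam i * inner ℝ (b i) w := fun i w => by
    rw [← hA, hAb, real_inner_smul_left]
  -- On a unit eigenvector `half_hess_le` reads `λ / 2 ≤ μ λ²`, so a positive eigenvalue cannot be
  -- small.
  have hlam : ∀ i, lam i = 0 ∨ 1 / (2 * μ) ≤ lam i := by
    intro i
    have h1 := h.half_hess_le hx (b i)
    have h2 := h.hess_nonneg hx (b i)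
    have hb1 : ‖b i‖ = 1 := b.orthonormal.1 i
    rw [← hH, hHb, real_inner_self_eq_norm_sq, hb1] at h1 h2
    have h3 : ‖H (b i)‖ = |lam i| := by
      have : ‖A (b i)‖ = ‖H (b i)‖ := norm_rieszVec _
      rw [← this, hAb, norm_smul, hb1, mul_one, Real.norm_eq_abs]
    rw [h3, sq_abs] at h1
    rcases eq_or_ne (lam i) 0 with h0 | h0
    · exact Or.inl h0
    · right
      have hpos : 0 < lam i := lt_of_le_of_ne (by simpa using h2) (Ne.symm h0)
      have hμ := h.pos
      rw [div_le_iff₀ (by positivity)]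
      nlinarith
  have hsum : v = ∑ i, inner ℝ (b i) v • b i := (b.sum_repr' v).symm
  have hHv : H v v = ∑ i, lam i * inner ℝ (b i) v ^ 2 := by
    conv_lhs => rw [hsum]
    rw [map_sum]
    refine Finset.sum_congr rfl fun i _ => ?_
    rw [map_smul, ← hsum, hsymm, hHb, smul_eq_mul]; ring
  rw [hHv, ← b.sum_sq_inner_right v, Finset.mul_sum]
  refine Finset.sum_le_sum fun i _ => ?_
  rcases hlam i with h0 | h0
  · have h1 : H (b i) = 0 := by
      ext1 w; rw [hHb, h0, zero_mul]; rfl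
    rw [hv _ h1]; simp
  · exact mul_le_mul_of_nonneg_right h0 (sq_nonneg _)

end IsPLMin

/-! ### Graph charts of the set of minimizers -/

section Charts

variable {k n d : ℕ}

/-- The graph of `w` in the coordinates of a frame. -/
def graphMap (F : OrthFrame k n d) (w : EuclideanSpace ℝ (Fin k) → EuclideanSpace ℝ (Fin n))
    (u : EuclideanSpace ℝ (Fin k)) : EuclideanSpace ℝ (Fin d) :=
  F.I u + F.J (w u)

/-- The graph of `w` over a ball consists of minimizers of `f`, and `f` is uniformly convex in the
direction of the second factor of the frame near that graph. -/
structure MinChart (f : EuclideanSpace ℝ (Fin d) → ℝ) (c : ℝ) (F : OrthFrame k n d)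
    (u₀ : EuclideanSpace ℝ (Fin k)) (ρ r a : ℝ)
    (w : EuclideanSpace ℝ (Fin k) → EuclideanSpace ℝ (Fin n)) : Prop where
  ρ_pos : 0 < ρ
  r_pos : 0 < r
  a_pos : 0 < a
  contDiffOn : ContDiffOn ℝ 2 w (Metric.ball u₀ ρ)
  mem : ∀ u ∈ Metric.ball u₀ ρ, f (graphMap F w u) = c
  lower : ∀ u ∈ Metric.ball u₀ ρ, ∀ v, ‖v‖ ≤ r → ∀ z,
    a * ‖z‖ ^ 2 ≤ hess f (graphMap F w u + F.J v) (F.J z) (F.J z)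
  bound : ∃ C, ∀ u ∈ Metric.ball u₀ ρ, (inducedMetric (graphMap F w) u).det ≤ C

theorem contDiffOn_graphMap {F : OrthFrame k n d} {U : Set (EuclideanSpace ℝ (Fin k))}
    {w : EuclideanSpace ℝ (Fin k) → EuclideanSpace ℝ (Fin n)} (hw : ContDiffOn ℝ 2 w U) :
    ContDiffOn ℝ 2 (graphMap F w) U :=
  F.I.contDiff.contDiffOn.add (F.J.contDiff.comp_contDiffOn hw)

theorem I'_graphMap (F : OrthFrame k n d)
    (w : EuclideanSpace ℝ (Fin k) → EuclideanSpace ℝ (Fin n)) (u : EuclideanSpace ℝ (Fin k)) :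
    F.I' (graphMap F w u) = u := by
  simp [graphMap, F.I'_I, F.I'_J]

theorem J'_graphMap (F : OrthFrame k n d)
    (w : EuclideanSpace ℝ (Fin k) → EuclideanSpace ℝ (Fin n)) (u : EuclideanSpace ℝ (Fin k)) :
    F.J' (graphMap F w u) = w u := by
  simp [graphMap, F.J'_I, F.J'_J]

theorem fderiv_graphMap {F : OrthFrame k n d}
    {w : EuclideanSpace ℝ (Fin k) → EuclideanSpace ℝ (Fin n)} {u : EuclideanSpace ℝ (Fin k)}
    (hw : DifferentiableAt ℝ w u) :
    HasFDerivAt (graphMap F w) (F.I + F.J ∘L fderiv ℝ w u) u :=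
  F.I.hasFDerivAt.add (F.J.hasFDerivAt.comp u hw.hasFDerivAt)

theorem hess_lower_of_near {f : EuclideanSpace ℝ (Fin d) → ℝ} {x y : EuclideanSpace ℝ (Fin d)}
    {F : OrthFrame k n d} {a₀ : ℝ} (hlow : ∀ z, a₀ * ‖z‖ ^ 2 ≤ hess f x (F.J z) (F.J z))
    (hy : ‖hess f y - hess f x‖ ≤ a₀ / 2) (z : EuclideanSpace ℝ (Fin n)) :
    a₀ / 2 * ‖z‖ ^ 2 ≤ hess f y (F.J z) (F.J z) := by
  have h1 : (hess f x - hess f y) (F.J z) (F.J z) ≤ a₀ / 2 * ‖z‖ ^ 2 := by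
    refine (le_abs_self _).trans (((hess f x - hess f y).le_opNorm₂ _ _).trans ?_)
    rw [norm_sub_rev, F.norm_J, mul_assoc, ← sq]; gcongr
  simp only [sub_apply] at h1
  linarith [hlow z]

theorem IsPLMin.exists_minChart {f : EuclideanSpace ℝ (Fin d) → ℝ} {c μ : ℝ}
    (h : IsPLMin f c μ) {x : EuclideanSpace ℝ (Fin d)} (hx : f x = c) (F : OrthFrame k n d)
    (hpos : ∀ v, v ≠ 0 → 0 < hess f x (F.J v) (F.J v))
    (hk : Module.finrank ℝ (formKer (hess f x)) = k) :
    ∃ ρ r a w, MinChart f c F (F.I' x) ρ r a w ∧ graphMap F w (F.I' x) = x := by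
  obtain ⟨W, hW, hxW, hf4, hPL⟩ := h.localPL x hx
  obtain ⟨ρ₀, hρ₀, w, hwC, hw0, hwm⟩ := exists_graph_of_PL F hW hxW hf4 h.le hx h.pos.le hPL hpos
    fun z hz => eq_zero_of_forall_J F (hess_comm h.contDiff x) hpos hk hz
  obtain ⟨a₀, ha₀, hlow⟩ := exists_pos_le_of_posDef ((hess f x).bilinearComp F.J F.J)
    fun v hv => by simpa using hpos v hv
  have hlow' : ∀ z, a₀ * ‖z‖ ^ 2 ≤ hess f x (F.J z) (F.J z) := fun z => by simpa using hlow z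
  have hcont : Continuous fun y => ‖hess f y - hess f x‖ :=
    ((continuous_hess h.contDiff).sub continuous_const).norm
  have hev : ∀ᶠ y in 𝓝 x, ‖hess f y - hess f x‖ < a₀ / 2 :=
    hcont.continuousAt.eventually_lt continuousAt_const (by simpa using ha₀)
  obtain ⟨δ, hδ, hball⟩ := Metric.eventually_nhds_iff_ball.1 hev
  have hg0 : graphMap F w (F.I' x) = x := by rw [graphMap, hw0, F.sum_eq]
  have hu₀ : Metric.ball (F.I' x) ρ₀ ∈ 𝓝 (F.I' x) := Metric.ball_mem_nhds _ hρ₀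
  have hgC := contDiffOn_graphMap (F := F) hwC
  have hgc : ContinuousAt (graphMap F w) (F.I' x) := hgC.continuousOn.continuousAt hu₀
  have hdc : ContinuousAt (fun u => (inducedMetric (graphMap F w) u).det) (F.I' x) :=
    (continuousOn_inducedMetric_det Metric.isOpen_ball hgC).continuousAt hu₀
  have h1 : ∀ᶠ u in 𝓝 (F.I' x), graphMap F w u ∈ Metric.ball x (δ / 2) :=
    hgc.eventually_mem (by rw [hg0]; exact Metric.ball_mem_nhds _ (by positivity))
  have h2 : ∀ᶠ u in 𝓝 (F.I' x), (inducedMetric (graphMap F w) u).det <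
      (inducedMetric (graphMap F w) (F.I' x)).det + 1 :=
    hdc.eventually_lt continuousAt_const (by linarith)
  obtain ⟨ρ, hρ, hb⟩ := Metric.eventually_nhds_iff_ball.1 ((h1.and h2).and hu₀)
  refine ⟨ρ, δ / 2, a₀ / 2, w, ⟨hρ, by positivity, by positivity,
    hwC.mono fun u hu => (hb u hu).2, fun u hu => hwm u (hb u hu).2, fun u hu v hv z => ?_,
    ⟨_, fun u hu => (hb u hu).1.2.le⟩⟩, hg0⟩
  refine hess_lower_of_near hlow' (hball _ ?_).le z
  have h3 := (hb u hu).1.1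
  rw [Metric.mem_ball, dist_eq_norm] at h3 ⊢
  calc ‖graphMap F w u + F.J v - x‖ = ‖(graphMap F w u - x) + F.J v‖ := by congr 1; abel
    _ ≤ ‖graphMap F w u - x‖ + ‖F.J v‖ := norm_add_le _ _
    _ < δ := by rw [F.norm_J]; linarith

namespace MinChart

variable {f : EuclideanSpace ℝ (Fin d) → ℝ} {c : ℝ} {F : OrthFrame k n d}
  {u₀ : EuclideanSpace ℝ (Fin k)} {ρ r a : ℝ}
  {w : EuclideanSpace ℝ (Fin k) → EuclideanSpace ℝ (Fin n)} {μ : ℝ}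
  {u : EuclideanSpace ℝ (Fin k)}

/-- The open set covered by a chart. -/
def dom (F : OrthFrame k n d) (u₀ : EuclideanSpace ℝ (Fin k)) (ρ r : ℝ)
    (w : EuclideanSpace ℝ (Fin k) → EuclideanSpace ℝ (Fin n)) : Set (EuclideanSpace ℝ (Fin d)) :=
  {y | F.I' y ∈ Metric.ball u₀ ρ ∧ ‖F.J' y - w (F.I' y)‖ < r}

theorem isOpen_dom (C : MinChart f c F u₀ ρ r a w) : IsOpen (dom F u₀ ρ r w) := by
  have h1 : IsOpen (F.I' ⁻¹' Metric.ball u₀ ρ) := Metric.isOpen_ball.preimage F.I'.continuous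
  have h2 : ContinuousOn (fun y => ‖F.J' y - w (F.I' y)‖) (F.I' ⁻¹' Metric.ball u₀ ρ) :=
    (F.J'.continuous.continuousOn.sub (C.contDiffOn.continuousOn.comp
      F.I'.continuous.continuousOn fun y hy => hy)).norm
  exact h2.isOpen_inter_preimage h1 isOpen_Iio

theorem graphMap_mem_dom (C : MinChart f c F u₀ ρ r a w) (hu : u ∈ Metric.ball u₀ ρ) :
    graphMap F w u ∈ dom F u₀ ρ r w := by
  refine ⟨by rwa [I'_graphMap], ?_⟩
  rw [I'_graphMap, J'_graphMap, sub_self, norm_zero]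
  exact C.r_pos

theorem value_lower (C : MinChart f c F u₀ ρ r a w) (h : IsPLMin f c μ)
    (hu : u ∈ Metric.ball u₀ ρ) {v : EuclideanSpace ℝ (Fin n)} (hv : ‖v‖ ≤ r) :
    c + a / 2 * ‖v‖ ^ 2 ≤ f (graphMap F w u + F.J v) := by
  have h1 := taylor_two_lower h.contDiff (x := graphMap F w u) (z := F.J v) (m := a * ‖v‖ ^ 2)
    fun ξ hξ => by
      have h2 : ‖ξ • v‖ ≤ r := by
        rw [norm_smul, Real.norm_eq_abs, abs_of_pos hξ.1]
        exact (mul_le_of_le_one_left (norm_nonneg _) hξ.2.le).trans hv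
      have := C.lower u hu _ h2 v
      rwa [map_smul] at this
  rw [C.mem u hu, h.fderiv_eq_zero (C.mem u hu)] at h1
  simp only [zero_apply] at h1
  linarith

theorem eq_graphMap_add (F : OrthFrame k n d)
    (w : EuclideanSpace ℝ (Fin k) → EuclideanSpace ℝ (Fin n)) (y : EuclideanSpace ℝ (Fin d)) :
    y = graphMap F w (F.I' y) + F.J (F.J' y - w (F.I' y)) := by
  conv_lhs => rw [← F.sum_eq y]
  rw [graphMap, map_sub]; abel

/-- In each fibre `f` grows at least quadratically away from the graph, so the chart domain contains
no minimizers off the graph. -/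
theorem image_eq (C : MinChart f c F u₀ ρ r a w) (h : IsPLMin f c μ) :
    graphMap F w '' Metric.ball u₀ ρ = {x | f x = c} ∩ dom F u₀ ρ r w := by
  ext y
  constructor
  · rintro ⟨u, hu, rfl⟩
    exact ⟨C.mem u hu, C.graphMap_mem_dom hu⟩
  · rintro ⟨hy, hy1, hy2⟩
    have h1 := C.value_lower h hy1 hy2.le
    rw [← eq_graphMap_add, show f y = c from hy] at h1
    have h2 : F.J' y - w (F.I' y) = 0 := by
      have ha := C.a_pos
      have : ‖F.J' y - w (F.I' y)‖ ^ 2 = 0 := le_antisymm (by nlinarith) (sq_nonneg _)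
      simpa using this
    refine ⟨F.I' y, hy1, ?_⟩
    conv_rhs => rw [eq_graphMap_add F w y, h2, map_zero, add_zero]

theorem differentiableAt (C : MinChart f c F u₀ ρ r a w) (hu : u ∈ Metric.ball u₀ ρ) :
    DifferentiableAt ℝ w u :=
  (C.contDiffOn.contDiffAt (Metric.isOpen_ball.mem_nhds hu)).differentiableAt (by norm_num)

theorem isLocalParam (C : MinChart f c F u₀ ρ r a w) (h : IsPLMin f c μ) :
    IsLocalParam {x | f x = c} (Metric.ball u₀ ρ) (graphMap F w) where
  isOpen := Metric.isOpen_ball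
  contDiffOn := contDiffOn_graphMap C.contDiffOn
  immersion u hu := by
    rw [(fderiv_graphMap (C.differentiableAt hu)).fderiv]
    intro z z' hz
    simpa [F.I'_I, F.I'_J] using congrArg F.I' hz
  isEmbedding := by
    have hc : Continuous (fun u : Metric.ball u₀ ρ => graphMap F w u) :=
      (contDiffOn_graphMap C.contDiffOn).continuousOn.domRestrict
    refine IsEmbedding.of_comp hc F.I'.continuous ?_
    have : (F.I' ∘ fun u : Metric.ball u₀ ρ => graphMap F w u) = Subtype.val := by
      ext1 u; exact I'_graphMap F w u
    rw [this]; exact IsEmbedding.subtypeVal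
  image_eq := ⟨_, C.isOpen_dom, C.image_eq h⟩

theorem hess_fderiv_eq_zero (C : MinChart f c F u₀ ρ r a w) (h : IsPLMin f c μ)
    (hu : u ∈ Metric.ball u₀ ρ) (z : EuclideanSpace ℝ (Fin k)) :
    hess f (graphMap F w u) ((F.I + F.J ∘L fderiv ℝ w u) z) = 0 := by
  have h1 := (hasFDerivAt_fderiv_of_contDiff_two h.contDiff (graphMap F w u)).comp u
    (fderiv_graphMap (C.differentiableAt hu))
  have h2 : HasFDerivAt (fderiv ℝ f ∘ graphMap F w)
      (0 : EuclideanSpace ℝ (Fin k) →L[ℝ] (EuclideanSpace ℝ (Fin d) →L[ℝ] ℝ)) u := by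
    refine (hasFDerivAt_const (0 : EuclideanSpace ℝ (Fin d) →L[ℝ] ℝ) u).congr_of_eventuallyEq ?_
    filter_upwards [Metric.isOpen_ball.mem_nhds hu] with u' hu'
    exact h.fderiv_eq_zero (C.mem u' hu')
  exact congrArg (fun L => L z) (h1.unique h2)

theorem injective_deriv (F : OrthFrame k n d)
    (W : EuclideanSpace ℝ (Fin k) →L[ℝ] EuclideanSpace ℝ (Fin n)) :
    Function.Injective (F.I + F.J ∘L W) := by
  intro z z' hz
  simpa [F.I'_I, F.I'_J] using congrArg F.I' hz

theorem pos (C : MinChart f c F u₀ ρ r a w) (hu : u ∈ Metric.ball u₀ ρ)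
    (v : EuclideanSpace ℝ (Fin n)) (hv : v ≠ 0) :
    0 < hess f (graphMap F w u) (F.J v) (F.J v) := by
  have h1 := C.lower u hu 0 (by simpa using C.r_pos.le) v
  rw [map_zero, add_zero] at h1
  have := norm_pos_iff.2 hv
  have ha := C.a_pos
  exact lt_of_lt_of_le (by positivity) h1

theorem finrank_range (F : OrthFrame k n d)
    (W : EuclideanSpace ℝ (Fin k) →L[ℝ] EuclideanSpace ℝ (Fin n)) :
    Module.finrank ℝ (LinearMap.range (F.I + F.J ∘L W).toLinearMap) = k := by
  rw [LinearMap.finrank_range_of_inj (injective_deriv F W)]; simp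

theorem range_le_formKer (C : MinChart f c F u₀ ρ r a w) (h : IsPLMin f c μ)
    (hu : u ∈ Metric.ball u₀ ρ) :
    LinearMap.range (F.I + F.J ∘L fderiv ℝ w u).toLinearMap ≤
      formKer (hess f (graphMap F w u)) := by
  rintro _ ⟨z, rfl⟩
  exact C.hess_fderiv_eq_zero h hu z

/-- Positivity along `F.J` bounds the nullity above by `k`. Differentiating `fderiv ℝ f = 0` along
the graph puts its `k` tangent directions in the kernel. -/
theorem finrank_formKer (C : MinChart f c F u₀ ρ r a w) (h : IsPLMin f c μ)
    (hu : u ∈ Metric.ball u₀ ρ) :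
    Module.finrank ℝ (formKer (hess f (graphMap F w u))) = k := by
  refine le_antisymm (finrank_ker_le F (C.pos hu)) ?_
  have := Submodule.finrank_mono (C.range_le_formKer h hu)
  rwa [finrank_range] at this

theorem range_eq_formKer (C : MinChart f c F u₀ ρ r a w) (h : IsPLMin f c μ)
    (hu : u ∈ Metric.ball u₀ ρ) :
    LinearMap.range (F.I + F.J ∘L fderiv ℝ w u).toLinearMap =
      formKer (hess f (graphMap F w u)) :=
  Submodule.eq_of_le_of_finrank_eq (C.range_le_formKer h hu)
    (by rw [finrank_range, C.finrank_formKer h hu])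

end MinChart

end Charts

/-! ### Constant nullity, the submanifold of minimizers and its tangent space. -/

namespace IsPLMin

variable {d : ℕ} {f : EuclideanSpace ℝ (Fin d) → ℝ} {c μ : ℝ} {x : EuclideanSpace ℝ (Fin d)}

/-- The frame given by the kernel of the Hessian and its orthogonal complement. -/
theorem exists_frame (h : IsPLMin f c μ) (hx : f x = c) {k n : ℕ}
    (hk : Module.finrank ℝ (formKer (hess f x)) = k) (hkn : k + n = d) :
    ∃ F : OrthFrame k n d, (∀ y, hess f x y = 0 ↔ F.J' y = 0) ∧
      (∀ v, (1 / (2 * μ)) * ‖v‖ ^ 2 ≤ hess f x (F.J v) (F.J v)) := by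
  obtain ⟨F, hF1, _⟩ := exists_orthFrame (formKer (hess f x)) hk hkn
  refine ⟨F, hF1, fun v => ?_⟩
  rw [← F.norm_J v]
  refine h.gap hx fun z hz => ?_
  have h1 : F.J' z = 0 := (hF1 z).1 hz
  rw [real_inner_comm, F.inner_J, h1, inner_zero_right]

theorem pos_of_lower {k n : ℕ} {F : OrthFrame k n d} (h : IsPLMin f c μ)
    (hlow : ∀ v, (1 / (2 * μ)) * ‖v‖ ^ 2 ≤ hess f x (F.J v) (F.J v))
    (v : EuclideanSpace ℝ (Fin n)) (hv : v ≠ 0) : 0 < hess f x (F.J v) (F.J v) := by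
  have := norm_pos_iff.2 hv
  have hμ := h.pos
  exact lt_of_lt_of_le (by positivity) (hlow v)

/-- Every minimizer has a chart whose frame is given by the kernel of the Hessian. -/
theorem exists_minChart_ker (h : IsPLMin f c μ) (hx : f x = c) {k n : ℕ}
    (hk : Module.finrank ℝ (formKer (hess f x)) = k) (hkn : k + n = d) :
    ∃ (F : OrthFrame k n d) (ρ r a : ℝ)
      (w : EuclideanSpace ℝ (Fin k) → EuclideanSpace ℝ (Fin n)),
      MinChart f c F (F.I' x) ρ r a w ∧ graphMap F w (F.I' x) = x := by
  obtain ⟨F, _, hF2⟩ := h.exists_frame hx hk hkn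
  obtain ⟨ρ, r, a, w, hC⟩ := h.exists_minChart hx F (h.pos_of_lower hF2) hk
  exact ⟨F, ρ, r, a, w, hC⟩

theorem finrank_formKer_le (f : EuclideanSpace ℝ (Fin d) → ℝ) (x : EuclideanSpace ℝ (Fin d)) :
    Module.finrank ℝ (formKer (hess f x)) ≤ d := by
  simpa using Submodule.finrank_le (formKer (hess f x))

/-- The nullity of the Hessian is the same at all minimizers. -/
theorem exists_finrank_eq (h : IsPLMin f c μ) :
    ∃ k ≤ d, ∀ x, f x = c → Module.finrank ℝ (formKer (hess f x)) = k := by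
  obtain ⟨x₀, hx₀⟩ := h.nonempty
  refine ⟨_, finrank_formKer_le f x₀, fun x hx => ?_⟩
  -- The nullity is constant on each chart, hence locally constant on the connected set of
  -- minimizers.
  have hloc : ∀ x, f x = c → ∀ᶠ y in 𝓝[{x | f x = c}] x,
      Module.finrank ℝ (formKer (hess f y)) = Module.finrank ℝ (formKer (hess f x)) := by
    intro x hx
    obtain ⟨F, ρ, r, a, w, C, hC⟩ := h.exists_minChart_ker hx rfl
      (Nat.add_sub_of_le (finrank_formKer_le f x))
    have h1 : MinChart.dom F (F.I' x) ρ r w ∈ 𝓝 x := C.isOpen_dom.mem_nhds (by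
      have := C.graphMap_mem_dom (Metric.mem_ball_self C.ρ_pos)
      rwa [hC] at this)
    filter_upwards [mem_nhdsWithin_of_mem_nhds h1, self_mem_nhdsWithin] with y hy1 hy2
    obtain ⟨u, hu, rfl⟩ : y ∈ graphMap F w '' Metric.ball (F.I' x) ρ := by
      rw [C.image_eq h]; exact ⟨hy2, hy1⟩
    exact C.finrank_formKer h hu
  have hcont : ContinuousOn (fun y => Module.finrank ℝ (formKer (hess f y))) {x | f x = c} :=
    fun x hx => tendsto_nhds_of_eventually_eq (hloc x hx)
  exact h.preconnected.constant hcont hx hx₀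

/-- With nullity `d` the charts are open sets of minimizers, so the set of minimizers would be
clopen, hence the whole space, which is not compact. This provides a nonzero normal vector in the
perturbation argument. -/
theorem finrank_lt (h : IsPLMin f c μ) (hd : 0 < d) (hx : f x = c) :
    Module.finrank ℝ (formKer (hess f x)) < d := by
  refine lt_of_le_of_ne (finrank_formKer_le f x) fun hdim => ?_
  obtain ⟨k, hkd, hk⟩ := h.exists_finrank_eq
  have hkd' : k = d := by rw [← hk x hx, hdim]
  have hopen : IsOpen {x | f x = c} := by
    rw [isOpen_iff_mem_nhds]
    intro y hy
    obtain ⟨F, ρ, r, a, w, C, hC⟩ := h.exists_minChart_ker hy (hk y hy) (n := 0) (by omega)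
    refine mem_of_superset (C.isOpen_dom.mem_nhds (by
      have := C.graphMap_mem_dom (Metric.mem_ball_self C.ρ_pos)
      rwa [hC] at this)) fun z hz => ?_
    have h1 : F.J' z - w (F.I' z) = 0 := Subsingleton.elim _ _
    rw [mem_ofPred_eq, MinChart.eq_graphMap_add F w z, h1, map_zero, add_zero]
    exact C.mem _ hz.1
  have huniv := IsClopen.eq_univ ⟨h.isCompact.isClosed, hopen⟩ ⟨x, hx⟩
  have hnc : NoncompactSpace (EuclideanSpace ℝ (Fin d)) := by
    have : Nonempty (Fin d) := ⟨⟨0, hd⟩⟩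
    have : Nontrivial (EuclideanSpace ℝ (Fin d)) := inferInstance
    exact NormedSpace.noncompactSpace ℝ _
  exact noncompact_univ _ (huniv ▸ h.isCompact)

theorem isEmbeddedSubmanifold (h : IsPLMin f c μ) {k : ℕ}
    (hk : ∀ x, f x = c → Module.finrank ℝ (formKer (hess f x)) = k) :
    IsEmbeddedSubmanifold k {x | f x = c} := by
  intro x hx
  have hkd : k ≤ d := by rw [← hk x hx]; exact finrank_formKer_le f x
  obtain ⟨F, ρ, r, a, w, C, hC⟩ := h.exists_minChart_ker hx (hk x hx) (Nat.add_sub_of_le hkd)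
  exact ⟨_, _, C.isLocalParam h, F.I' x, Metric.mem_ball_self C.ρ_pos, hC⟩

/-- The gradient vanishes on the set, so its derivative kills tangent directions; conversely, the
derivative of a chart produces every vector of the kernel. -/
theorem tangentSpaceOf_eq (h : IsPLMin f c μ) (hx : f x = c) :
    tangentSpaceOf {x | f x = c} x = formKer (hess f x) := by
  apply le_antisymm
  · refine Submodule.span_le.2 fun y hy => ?_
    have h1 : HasFDerivWithinAt (fderiv ℝ f) (hess f x) {x | f x = c} x :=
      (hasFDerivAt_fderiv_of_contDiff_two h.contDiff x).hasFDerivWithinAt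
    have h2 : HasFDerivWithinAt (fderiv ℝ f)
        (0 : EuclideanSpace ℝ (Fin d) →L[ℝ] (EuclideanSpace ℝ (Fin d) →L[ℝ] ℝ))
        {x | f x = c} x :=
      (hasFDerivWithinAt_const (0 : EuclideanSpace ℝ (Fin d) →L[ℝ] ℝ) x _).congr
        (fun y hy => h.fderiv_eq_zero hy) (h.fderiv_eq_zero hx)
    exact h1.unique_on h2 hy
  · obtain ⟨F, ρ, r, a, w, C, hC⟩ := h.exists_minChart_ker hx rfl
      (Nat.add_sub_of_le (finrank_formKer_le f x))
    have hu := Metric.mem_ball_self (x := F.I' x) C.ρ_pos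
    have h1 := C.range_eq_formKer h hu
    rw [hC] at h1
    rw [← h1]
    rintro _ ⟨z, rfl⟩
    refine Submodule.subset_span ?_
    have h2 := ((fderiv_graphMap (F := F) (C.differentiableAt hu)).hasFDerivWithinAt
      (s := Metric.ball (F.I' x) ρ)).mapsTo_tangent_cone
    rw [hC] at h2
    have h3 : z ∈ tangentConeAt ℝ (Metric.ball (F.I' x) ρ) (F.I' x) := by
      rw [tangentConeAt_of_mem_nhds (Metric.ball_mem_nhds _ C.ρ_pos)]; trivial
    refine tangentConeAt_mono ?_ (h2 h3)
    rintro _ ⟨u, hu, rfl⟩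
    exact C.mem u hu

end IsPLMin

/-! ### The determinant of the normal Hessian -/

theorem hess_comp_add_linear {V E : Type*} [NormedAddCommGroup V] [NormedSpace ℝ V]
    [NormedAddCommGroup E] [NormedSpace ℝ E] {f : E → ℝ} (hf : ContDiff ℝ 2 f) (x : E)
    (L : V →L[ℝ] E) (a b : V) :
    hess (fun t => f (x + L t)) 0 a b = hess f x (L a) (L b) := by
  have h0 : ∀ t, HasFDerivAt (fun t => x + L t) L t := fun t => L.hasFDerivAt.const_add x
  have h1 : fderiv ℝ (fun t => f (x + L t)) = fun t => (fderiv ℝ f (x + L t)) ∘L L := by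
    ext1 t
    exact (((hf.differentiable (by norm_num)) (x + L t)).hasFDerivAt.comp t (h0 t)).fderiv
  have h2 : HasFDerivAt (fun t => fderiv ℝ f (x + L t)) (hess f (x + L 0) ∘L L) 0 :=
    (hasFDerivAt_fderiv_of_contDiff_two hf (x + L 0)).comp 0 (h0 0)
  have h3 := ((ContinuousLinearMap.compL ℝ V E ℝ).flip L).hasFDerivAt.comp (0 : V) h2
  rw [hess, h1]
  change fderiv ℝ (((ContinuousLinearMap.compL ℝ V E ℝ).flip L) ∘
    fun t => fderiv ℝ f (x + L t)) 0 a b = _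
  rw [h3.fderiv]
  simp

section NormalHessian

variable {k n d : ℕ}

/-- Removes the index type `Fin (finrank …)`, which varies with `x`, and rewrites the Hessian in
normal coordinates as that of `f` on normal vectors. -/
theorem exists_normalHessianDet_eq {f : EuclideanSpace ℝ (Fin d) → ℝ} (hf : ContDiff ℝ 2 f)
    (S : Set (EuclideanSpace ℝ (Fin d))) (x : EuclideanSpace ℝ (Fin d))
    (hn : Module.finrank ℝ (normalSpaceOf S x) = n) :
    ∃ b : Fin n → EuclideanSpace ℝ (Fin d), Orthonormal ℝ b ∧
      Submodule.span ℝ (range b) = normalSpaceOf S x ∧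
      normalHessianDet f S x = (bilinMatrix (hess f x) b).det := by
  subst hn
  set b := stdOrthonormalBasis ℝ (normalSpaceOf S x) with hb
  refine ⟨fun j => (b j : EuclideanSpace ℝ (Fin d)),
    b.orthonormal.comp_linearIsometry (normalSpaceOf S x).subtypeₗᵢ, ?_, ?_⟩
  · have h1 : (range fun j => (b j : EuclideanSpace ℝ (Fin d))) =
        (normalSpaceOf S x).subtype '' range b := by
      rw [← range_comp]; rfl
    rw [h1, Submodule.span_image, ← b.coe_toBasis, b.toBasis.span_eq, Submodule.map_subtype_top]
  · let L : EuclideanSpace ℝ (Fin (Module.finrank ℝ (normalSpaceOf S x))) →L[ℝ]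
        EuclideanSpace ℝ (Fin d) :=
      ∑ j, (EuclideanSpace.proj j).smulRight (b j : EuclideanSpace ℝ (Fin d))
    have hL : ∀ t, normalCoord S x t = x + L t := fun t => by
      simp [normalCoord, L, sum_apply, hb]
    have hLs : ∀ i, L (EuclideanSpace.single i 1) = b i := fun i => by
      simp [L, sum_apply]
    rw [normalHessianDet]
    congr 1
    ext i j
    simp only [hL, Matrix.of_apply, bilinMatrix]
    rw [hess_comp_add_linear hf x L, hLs, hLs]

namespace IsPLMin

variable {f : EuclideanSpace ℝ (Fin d) → ℝ} {c μ : ℝ} {x : EuclideanSpace ℝ (Fin d)}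

theorem normalSpaceOf_eq (h : IsPLMin f c μ) (hx : f x = c) :
    normalSpaceOf {x | f x = c} x = (formKer (hess f x))ᗮ := by
  rw [normalSpaceOf, h.tangentSpaceOf_eq hx]

theorem finrank_normalSpaceOf (h : IsPLMin f c μ) (hx : f x = c)
    (hk : Module.finrank ℝ (formKer (hess f x)) = k) (hkn : k + n = d) :
    Module.finrank ℝ (normalSpaceOf {x | f x = c} x) = n := by
  have h1 := (formKer (hess f x)).finrank_add_finrank_orthogonal
  rw [h.normalSpaceOf_eq hx]
  simp only [finrank_euclideanSpace, Fintype.card_fin] at h1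
  omega

theorem normalHessianDet_bounds (h : IsPLMin f c μ) (hx : f x = c)
    (hk : Module.finrank ℝ (formKer (hess f x)) = k) (hkn : k + n = d) {a Λ : ℝ} (ha : 0 ≤ a)
    (hlow : ∀ y, (∀ z, hess f x z = 0 → inner ℝ z y = 0) → a * ‖y‖ ^ 2 ≤ hess f x y y)
    (hup : ∀ y, hess f x y y ≤ Λ * ‖y‖ ^ 2) :
    a ^ n ≤ normalHessianDet f {x | f x = c} x ∧
      normalHessianDet f {x | f x = c} x ≤ Λ ^ n := by
  obtain ⟨b, hb, hspan, hdet⟩ := exists_normalHessianDet_eq h.contDiff {x | f x = c} x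
    (h.finrank_normalSpaceOf hx hk hkn)
  rw [hdet]
  refine det_bilinMatrix_bounds (hess_comm h.contDiff x) hb ha (fun v hv => hlow v fun z hz => ?_)
    hup
  rw [hspan, h.normalSpaceOf_eq hx] at hv
  exact (Submodule.mem_orthogonal _ _).1 hv z hz

theorem normalHessianDet_pos (h : IsPLMin f c μ) (hx : f x = c) :
    0 < normalHessianDet f {x | f x = c} x := by
  have h1 := (h.normalHessianDet_bounds hx rfl (Nat.add_sub_of_le (finrank_formKer_le f x))
    (a := 1 / (2 * μ)) (Λ := ‖hess f x‖) (by have := h.pos; positivity) (fun y hy => h.gap hx hy)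
    fun y => by have := hess_apply_le (f := f) x y y; rwa [mul_assoc, ← sq] at this).1
  have := h.pos
  exact lt_of_lt_of_le (by positivity) h1

end IsPLMin

namespace MinChart

variable {f : EuclideanSpace ℝ (Fin d) → ℝ} {c : ℝ} {F : OrthFrame k n d}
  {u₀ : EuclideanSpace ℝ (Fin k)} {ρ r a : ℝ}
  {w : EuclideanSpace ℝ (Fin k) → EuclideanSpace ℝ (Fin n)} {μ : ℝ}
  {u : EuclideanSpace ℝ (Fin k)}

theorem normalHessianDet_eq (C : MinChart f c F u₀ ρ r a w) (h : IsPLMin f c μ)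
    (hu : u ∈ Metric.ball u₀ ρ) :
    normalHessianDet f {x | f x = c} (graphMap F w u) =
      (bilinMatrix (hess f (graphMap F w u)) F.jVec).det * (inducedMetric (graphMap F w) u).det := by
  obtain ⟨b, hb, hspan, hdet⟩ := exists_normalHessianDet_eq h.contDiff {x | f x = c} _
    (h.finrank_normalSpaceOf (C.mem u hu) (C.finrank_formKer h hu) F.dim_eq)
  rw [hdet, inducedMetric_eq, (fderiv_graphMap (C.differentiableAt hu)).fderiv]
  refine det_bilinMatrix_eq_mul F (hess_comm h.contDiff _) _ (C.hess_fderiv_eq_zero h hu) hb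
    fun i z => ?_
  have h1 : b i ∈ normalSpaceOf {x | f x = c} (graphMap F w u) := by
    rw [← hspan]; exact Submodule.subset_span ⟨i, rfl⟩
  rw [h.normalSpaceOf_eq (C.mem u hu)] at h1
  exact (Submodule.mem_orthogonal' _ _).1 h1 _ (C.hess_fderiv_eq_zero h hu z)

theorem continuousOn_det_bilinMatrix (C : MinChart f c F u₀ ρ r a w) (hf : ContDiff ℝ 2 f) :
    ContinuousOn (fun u => (bilinMatrix (hess f (graphMap F w u)) F.jVec).det)
      (Metric.ball u₀ ρ) := by
  have h1 : Continuous fun x => (bilinMatrix (hess f x) F.jVec).det := by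
    refine Continuous.matrix_det (continuous_matrix fun i j => ?_)
    have := continuous_hess hf
    simp only [bilinMatrix, Matrix.of_apply]
    fun_prop
  exact h1.comp_continuousOn (contDiffOn_graphMap C.contDiffOn).continuousOn

end MinChart

namespace IsPLMin

variable {f : EuclideanSpace ℝ (Fin d) → ℝ} {c μ : ℝ} {x : EuclideanSpace ℝ (Fin d)}

/-- The chosen orthonormal bases need not vary continuously with the point. Continuity comes from
the factorization in a chart, where both factors are continuous. -/
theorem continuousOn_normalHessianDet (h : IsPLMin f c μ) :
    ContinuousOn (normalHessianDet f {x | f x = c}) {x | f x = c} := by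
  intro x hx
  obtain ⟨F, ρ, r, a, w, C, hC⟩ := h.exists_minChart_ker hx rfl
    (Nat.add_sub_of_le (finrank_formKer_le f x))
  have hdom : MinChart.dom F (F.I' x) ρ r w ∈ 𝓝 x := C.isOpen_dom.mem_nhds (by
    have := C.graphMap_mem_dom (Metric.mem_ball_self C.ρ_pos)
    rwa [hC] at this)
  have h1 : ContinuousAt (fun y => (bilinMatrix (hess f (graphMap F w (F.I' y))) F.jVec).det *
      (inducedMetric (graphMap F w) (F.I' y)).det) x := by
    have h2 := ((C.continuousOn_det_bilinMatrix h.contDiff).mul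
      (continuousOn_inducedMetric_det Metric.isOpen_ball (contDiffOn_graphMap (F := F)
        C.contDiffOn))).continuousAt (Metric.ball_mem_nhds _ C.ρ_pos)
    exact h2.comp (f := F.I') F.I'.continuous.continuousAt
  refine h1.continuousWithinAt.congr_of_eventuallyEq ?_ ?_
  · filter_upwards [mem_nhdsWithin_of_mem_nhds hdom, self_mem_nhdsWithin] with y hy1 hy2
    obtain ⟨u, hu, rfl⟩ : y ∈ graphMap F w '' Metric.ball (F.I' x) ρ := by
      rw [C.image_eq h]; exact ⟨hy2, hy1⟩
    rw [C.normalHessianDet_eq h hu, I'_graphMap]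
  · have := C.normalHessianDet_eq h (Metric.mem_ball_self C.ρ_pos)
    rwa [hC] at this ⊢

end IsPLMin

end NormalHessian

/-! ### Gaussian integrals and Laplace's method in a chart -/

section Gaussian

variable {n : ℕ}

theorem integrable_exp_neg_mul_norm_sq {b : ℝ} (hb : 0 < b) :
    Integrable fun v : EuclideanSpace ℝ (Fin n) => Real.exp (-b * ‖v‖ ^ 2) := by
  refine Integrable.of_integral_ne_zero ?_
  rw [GaussianFourier.integral_rexp_neg_mul_sq_norm hb]
  positivity

/-- The integral of the standard Gaussian. -/
def gaussConst (n : ℕ) : ℝ := ∫ v : EuclideanSpace ℝ (Fin n), Real.exp (-(1 / 2) * ‖v‖ ^ 2)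

theorem gaussConst_pos (n : ℕ) : 0 < gaussConst n := by
  rw [gaussConst, GaussianFourier.integral_rexp_neg_mul_sq_norm (by norm_num)]
  positivity

theorem integral_comp_linear (L : EuclideanSpace ℝ (Fin n) →ₗ[ℝ] EuclideanSpace ℝ (Fin n))
    (hL : LinearMap.det L ≠ 0) {φ : EuclideanSpace ℝ (Fin n) → ℝ} (hφ : Continuous φ) :
    ∫ v, φ (L v) = |(LinearMap.det L)⁻¹| * ∫ v, φ v := by
  have hLc : Continuous L := L.continuous_of_finiteDimensional
  have h1 := integral_map (μ := (volume : Measure (EuclideanSpace ℝ (Fin n)))) (φ := L)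
    hLc.aemeasurable (f := φ) hφ.aestronglyMeasurable
  rw [← h1, Measure.map_linearMap_addHaar_eq_smul_addHaar volume hL, integral_smul_measure,
    ENNReal.toReal_ofReal (abs_nonneg _), smul_eq_mul]

open scoped MatrixOrder in
-- Writing `A = Bᵀ B`, the linear substitution by `B` reduces to the standard Gaussian, with `|det
-- B| = √(det A)`.
theorem integral_exp_neg_quadratic {A : Matrix (Fin n) (Fin n) ℝ} (hA : A.PosDef) :
    ∫ v : EuclideanSpace ℝ (Fin n), Real.exp (-(1 / 2) * (v ⬝ᵥ A.mulVec v)) =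
      gaussConst n * A.det ^ (-(1 / 2) : ℝ) := by
  obtain ⟨B, hB⟩ := CStarAlgebra.nonneg_iff_eq_star_mul_self.mp hA.posSemidef.nonneg
  have hdet : A.det = B.det ^ 2 := by
    rw [hB, Matrix.det_mul, Matrix.star_eq_conjTranspose, Matrix.det_conjTranspose]
    simp [sq]
  have hBdet : B.det ≠ 0 := fun h => by
    have := hA.det_pos
    rw [hdet, h] at this; simp at this
  let L : EuclideanSpace ℝ (Fin n) →L[ℝ] EuclideanSpace ℝ (Fin n) :=
    Matrix.toEuclideanCLM (n := Fin n) (𝕜 := ℝ) B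
  have hLdet : LinearMap.det L.toLinearMap = B.det := by
    have h1 := det_matrixOf L
    have h2 : matrixOf L = B := by
      ext i j
      simp [matrixOf, L]
    rw [h2] at h1
    exact h1.symm
  have hq : ∀ v : EuclideanSpace ℝ (Fin n), v ⬝ᵥ A.mulVec v = ‖L v‖ ^ 2 := fun v => by
    rw [← real_inner_self_eq_norm_sq, PiLp.inner_apply, hB, ← Matrix.mulVec_mulVec,
      Matrix.dotProduct_mulVec, Matrix.star_eq_conjTranspose, Matrix.vecMul_conjTranspose]
    simp [L, dotProduct, sq]
  simp_rw [hq]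
  have h3 := integral_comp_linear L.toLinearMap (by rwa [hLdet])
    (φ := fun v => Real.exp (-(1 / 2) * ‖v‖ ^ 2)) (by fun_prop)
  rw [hLdet] at h3
  change ∫ v, Real.exp (-(1 / 2) * ‖L v‖ ^ 2) = _ at h3
  rw [h3, ← gaussConst, mul_comm, hdet, Real.rpow_neg (sq_nonneg _), ← Real.sqrt_eq_rpow,
    Real.sqrt_sq_eq_abs, abs_inv]

theorem posDef_bilinMatrix {V : Type*} [NormedAddCommGroup V] [NormedSpace ℝ V]
    {H : V →L[ℝ] V →L[ℝ] ℝ} (hH : ∀ v w, H v w = H w v) {b : Fin n → V}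
    (hpos : ∀ v : EuclideanSpace ℝ (Fin n), v ≠ 0 → 0 < H (∑ i, v i • b i) (∑ i, v i • b i)) :
    (bilinMatrix H b).PosDef := by
  refine Matrix.PosDef.of_dotProduct_mulVec_pos ?_ fun v hv => ?_
  · ext i j
    simp [bilinMatrix, hH (b i) (b j)]
  · have := hpos (WithLp.toLp 2 v) (by simpa using hv)
    rw [star_trivial, dotProduct_bilinMatrix]
    exact this

theorem OrthFrame.J_eq_sum {k d : ℕ} (F : OrthFrame k n d) (v : EuclideanSpace ℝ (Fin n)) :
    F.J v = ∑ i, v i • F.jVec i := apply_eq_sum F.J v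

theorem integral_exp_neg_hess {k d : ℕ} (F : OrthFrame k n d)
    {H : EuclideanSpace ℝ (Fin d) →L[ℝ] EuclideanSpace ℝ (Fin d) →L[ℝ] ℝ}
    (hH : ∀ v w, H v w = H w v) (hpos : ∀ v, v ≠ 0 → 0 < H (F.J v) (F.J v)) :
    ∫ v, Real.exp (-(1 / 2 * H (F.J v) (F.J v))) =
      gaussConst n * (bilinMatrix H F.jVec).det ^ (-(1 / 2) : ℝ) := by
  rw [← integral_exp_neg_quadratic (posDef_bilinMatrix hH fun v hv => by
    rw [← F.J_eq_sum]; exact hpos v hv)]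
  congr 1
  ext v
  rw [dotProduct_bilinMatrix, ← F.J_eq_sum, neg_mul]

end Gaussian

theorem integral_comp_add_smul {n : ℕ} (φ : EuclideanSpace ℝ (Fin n) → ℝ)
    (v₀ : EuclideanSpace ℝ (Fin n)) {σ : ℝ} (hσ : 0 < σ) :
    (σ ^ n)⁻¹ * ∫ v, φ v = ∫ s, φ (v₀ + σ • s) := by
  rw [Measure.integral_comp_smul volume (fun s => φ (v₀ + s)) σ, integral_add_left_eq_self φ v₀,
    finrank_euclideanSpace, Fintype.card_fin, abs_of_pos (by positivity), smul_eq_mul]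

namespace MinChart

variable {k n d : ℕ} {f : EuclideanSpace ℝ (Fin d) → ℝ} {c : ℝ} {F : OrthFrame k n d}
  {u₀ : EuclideanSpace ℝ (Fin k)} {ρ r a : ℝ}
  {w : EuclideanSpace ℝ (Fin k) → EuclideanSpace ℝ (Fin n)} {μ : ℝ}
  {u : EuclideanSpace ℝ (Fin k)}

/-- The domination for Laplace's method: where `φ` does not vanish the point lies in the chart
domain, and the quadratic growth of `f - c` in the fibre turns into a Gaussian bound in `s`,
independent of `σ`. -/
theorem norm_integrand_le (C : MinChart f c F u₀ ρ r a w) (h : IsPLMin f c μ)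
    {φ : EuclideanSpace ℝ (Fin d) → ℝ} {B : ℝ} (hB : ∀ x, |φ x| ≤ B)
    (hsupp : ∀ x, φ x ≠ 0 → x ∈ dom F u₀ ρ r w) (hu : u ∈ Metric.ball u₀ ρ) {σ : ℝ} (hσ : 0 < σ)
    (s : EuclideanSpace ℝ (Fin n)) :
    ‖φ (F.I u + F.J (w u + σ • s)) *
      Real.exp (-(f (F.I u + F.J (w u + σ • s)) - c) / σ ^ 2)‖ ≤
      B * Real.exp (-(a / 2) * ‖s‖ ^ 2) := by
  have hB0 : 0 ≤ B := (abs_nonneg _).trans (hB 0)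
  have hx : F.I u + F.J (w u + σ • s) = graphMap F w u + F.J (σ • s) := by
    rw [graphMap, map_add]; abel
  rcases eq_or_ne (φ (F.I u + F.J (w u + σ • s))) 0 with h0 | h0
  · rw [h0, zero_mul, norm_zero]; positivity
  · have h1 := (hsupp _ h0).2
    have h2 : F.I' (F.I u + F.J (w u + σ • s)) = u := by simp [F.I'_I, F.I'_J]
    have h3 : F.J' (F.I u + F.J (w u + σ • s)) = w u + σ • s := by simp [F.J'_I, F.J'_J]
    rw [h2, h3, add_sub_cancel_left] at h1
    have h4 := C.value_lower h hu h1.le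
    rw [norm_mul, Real.norm_eq_abs, Real.norm_eq_abs, Real.abs_exp]
    refine mul_le_mul (hB _) (Real.exp_le_exp.2 ?_) (Real.exp_pos _).le hB0
    rw [norm_smul, Real.norm_eq_abs, abs_of_pos hσ, ← hx, mul_pow] at h4
    rw [neg_div, neg_mul, neg_le_neg_iff, le_div_iff₀ (by positivity)]
    linarith

/-- Laplace's method in a single fibre of a chart. -/
theorem tendsto_fiber (C : MinChart f c F u₀ ρ r a w) (h : IsPLMin f c μ)
    {φ : EuclideanSpace ℝ (Fin d) → ℝ} (hφ : Continuous φ) {B : ℝ} (hB : ∀ x, |φ x| ≤ B)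
    (hsupp : ∀ x, φ x ≠ 0 → x ∈ dom F u₀ ρ r w) (hu : u ∈ Metric.ball u₀ ρ) :
    Tendsto (fun σ : ℝ => ∫ s, φ (F.I u + F.J (w u + σ • s)) *
      Real.exp (-(f (F.I u + F.J (w u + σ • s)) - c) / σ ^ 2)) (𝓝[>] 0)
      (𝓝 (gaussConst n * (φ (graphMap F w u) *
        (bilinMatrix (hess f (graphMap F w u)) F.jVec).det ^ (-(1 / 2) : ℝ)))) := by
  have hfc := h.contDiff.continuous
  rw [show gaussConst n * (φ (graphMap F w u) *
      (bilinMatrix (hess f (graphMap F w u)) F.jVec).det ^ (-(1 / 2) : ℝ)) =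
      ∫ s, φ (graphMap F w u) * Real.exp (-(1 / 2 * hess f (graphMap F w u) (F.J s) (F.J s))) by
    rw [integral_const_mul, integral_exp_neg_hess F (hess_comm h.contDiff _) (C.pos hu)]; ring]
  have ha := C.a_pos
  refine tendsto_integral_filter_of_dominated_convergence
    (fun s => B * Real.exp (-(a / 2) * ‖s‖ ^ 2)) ?_ ?_
    ((integrable_exp_neg_mul_norm_sq (by positivity)).const_mul B) ?_
  · refine Eventually.of_forall fun σ => Continuous.aestronglyMeasurable ?_
    fun_prop
  · filter_upwards [self_mem_nhdsWithin] with σ hσ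
    exact Eventually.of_forall fun s => C.norm_integrand_le h hB hsupp hu hσ s
  · refine Eventually.of_forall fun s => ?_
    have hx : ∀ σ : ℝ, F.I u + F.J (w u + σ • s) = graphMap F w u + σ • F.J s := fun σ => by
      rw [graphMap, map_add, map_smul]; abel
    simp_rw [hx]
    refine Tendsto.mul ?_ ?_
    · have h1 : Continuous fun σ : ℝ => φ (graphMap F w u + σ • F.J s) := by fun_prop
      have h2 := h1.tendsto 0
      rw [zero_smul, add_zero] at h2
      exact h2.mono_left nhdsWithin_le_nhds
    · have h3 := tendsto_taylor_quotient h.contDiff (h.fderiv_eq_zero (C.mem u hu)) (F.J s)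
      rw [C.mem u hu] at h3
      refine (Real.continuous_exp.tendsto _).comp ?_
      refine h3.neg.congr fun σ => ?_
      rw [neg_div]

/-- Laplace's method in a chart. -/
theorem tendsto_laplace (C : MinChart f c F u₀ ρ r a w) (h : IsPLMin f c μ)
    (hint : ∀ σ : ℝ, 0 < σ → Integrable fun x => Real.exp (-(f x - c) / σ ^ 2))
    {φ : EuclideanSpace ℝ (Fin d) → ℝ} (hφ : Continuous φ) {B : ℝ} (hB : ∀ x, |φ x| ≤ B)
    (hsupp : ∀ x, φ x ≠ 0 → x ∈ dom F u₀ ρ r w) :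
    Tendsto (fun σ : ℝ => (σ ^ n)⁻¹ * ∫ x, φ x * Real.exp (-(f x - c) / σ ^ 2)) (𝓝[>] 0)
      (𝓝 (gaussConst n * ∫ u in Metric.ball u₀ ρ, φ (graphMap F w u) *
        (bilinMatrix (hess f (graphMap F w u)) F.jVec).det ^ (-(1 / 2) : ℝ))) := by
  have hfc := h.contDiff.continuous
  have ha := C.a_pos
  rw [← integral_const_mul, ← integral_indicator measurableSet_ball]
  have hzero : ∀ u, u ∉ Metric.ball u₀ ρ → ∀ v, φ (F.I u + F.J v) = 0 := fun u hu v => by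
    by_contra h0
    have h1 := (hsupp _ h0).1
    simp only [map_add, F.I'_I, F.I'_J, add_zero] at h1
    exact hu h1
  have heq : ∀ σ : ℝ, 0 < σ → (σ ^ n)⁻¹ * ∫ x, φ x * Real.exp (-(f x - c) / σ ^ 2) =
      ∫ u, (σ ^ n)⁻¹ * ∫ v, φ (F.I u + F.J v) *
        Real.exp (-(f (F.I u + F.J v) - c) / σ ^ 2) := fun σ hσ => by
    rw [F.integral_eq, integral_const_mul]
    refine (hint σ hσ).bdd_mul (c := B) hφ.aestronglyMeasurable (Eventually.of_forall hB)
  -- The substitution `v = w u + σ s` absorbs the factor `σ⁻ⁿ`. It is valid for all `u`; off the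
  -- ball both sides vanish.
  have hfib : ∀ σ : ℝ, 0 < σ → ∀ u, (σ ^ n)⁻¹ * ∫ v, φ (F.I u + F.J v) *
        Real.exp (-(f (F.I u + F.J v) - c) / σ ^ 2) = ∫ s, φ (F.I u + F.J (w u + σ • s)) *
      Real.exp (-(f (F.I u + F.J (w u + σ • s)) - c) / σ ^ 2) := fun σ hσ u =>
    integral_comp_add_smul (fun v => φ (F.I u + F.J v) *
        Real.exp (-(f (F.I u + F.J v) - c) / σ ^ 2)) (w u) hσ
  have key : Tendsto (fun σ : ℝ => ∫ u, (σ ^ n)⁻¹ * ∫ v, φ (F.I u + F.J v) *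
        Real.exp (-(f (F.I u + F.J v) - c) / σ ^ 2)) (𝓝[>] 0)
      (𝓝 (∫ u, (Metric.ball u₀ ρ).indicator (fun u => gaussConst n * (φ (graphMap F w u) *
        (bilinMatrix (hess f (graphMap F w u)) F.jVec).det ^ (-(1 / 2) : ℝ))) u)) := by
    refine tendsto_integral_filter_of_dominated_convergence
      ((Metric.ball u₀ ρ).indicator fun _ => B * ∫ s : EuclideanSpace ℝ (Fin n),
        Real.exp (-(a / 2) * ‖s‖ ^ 2)) ?_ ?_ ?_ ?_
    · refine Eventually.of_forall fun σ => ?_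
      have h1 : Continuous fun p : EuclideanSpace ℝ (Fin k) × EuclideanSpace ℝ (Fin n) =>
          φ (F.I p.1 + F.J p.2) * Real.exp (-(f (F.I p.1 + F.J p.2) - c) / σ ^ 2) := by fun_prop
      exact (h1.stronglyMeasurable.integral_prod_right (ν := volume)).aestronglyMeasurable.const_mul _
    · filter_upwards [self_mem_nhdsWithin] with σ hσ
      refine Eventually.of_forall fun u => ?_
      by_cases hu : u ∈ Metric.ball u₀ ρ
      · rw [indicator_of_mem hu, hfib σ hσ, ← integral_const_mul]
        exact norm_integral_le_of_norm_le
          ((integrable_exp_neg_mul_norm_sq (by positivity)).const_mul B)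
          (Eventually.of_forall fun s => C.norm_integrand_le h hB hsupp hu hσ s)
      · rw [indicator_of_notMem hu]
        simp [hzero u hu]
    · rw [integrable_indicator_iff measurableSet_ball]
      exact integrableOn_const (measure_ball_lt_top.ne)
    · refine Eventually.of_forall fun u => ?_
      by_cases hu : u ∈ Metric.ball u₀ ρ
      · rw [indicator_of_mem hu]
        refine (C.tendsto_fiber h hφ hB hsupp hu).congr' ?_
        filter_upwards [self_mem_nhdsWithin] with σ hσ
        exact (hfib σ hσ u).symm
      · rw [indicator_of_notMem hu]
        simp [hzero u hu]
  refine key.congr' ?_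
  filter_upwards [self_mem_nhdsWithin] with σ hσ
  exact (heq σ hσ).symm

end MinChart

/-! ### Laplace's method around the set of minimizers -/

namespace MinChart

variable {k n d : ℕ} {f : EuclideanSpace ℝ (Fin d) → ℝ} {c : ℝ} {F : OrthFrame k n d}
  {u₀ : EuclideanSpace ℝ (Fin k)} {ρ r a : ℝ}
  {w : EuclideanSpace ℝ (Fin k) → EuclideanSpace ℝ (Fin n)} {μ : ℝ}
  {u : EuclideanSpace ℝ (Fin k)} {M : Measure (EuclideanSpace ℝ (Fin d))}

theorem det_pos (C : MinChart f c F u₀ ρ r a w) (h : IsPLMin f c μ)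
    (hu : u ∈ Metric.ball u₀ ρ) :
    0 < (bilinMatrix (hess f (graphMap F w u)) F.jVec).det :=
  (posDef_bilinMatrix (hess_comm h.contDiff _) fun v hv => by
    rw [← F.J_eq_sum]; exact C.pos hu v hv).det_pos

theorem inducedMetric_det_pos (C : MinChart f c F u₀ ρ r a w) (h : IsPLMin f c μ)
    (hu : u ∈ Metric.ball u₀ ρ) : 0 < (inducedMetric (graphMap F w) u).det := by
  have h1 := h.normalHessianDet_pos (C.mem u hu)
  rw [C.normalHessianDet_eq h hu] at h1
  exact pos_of_mul_pos_right h1 (C.det_pos h hu).le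

theorem aemeasurable_volDensity (C : MinChart f c F u₀ ρ r a w) :
    AEMeasurable (volDensity (graphMap F w)) (volume.restrict (Metric.ball u₀ ρ)) := by
  have h1 := continuousOn_inducedMetric_det Metric.isOpen_ball
    (contDiffOn_graphMap (F := F) C.contDiffOn)
  exact ((h1.sqrt).aemeasurable measurableSet_ball).ennreal_ofReal

theorem measure_image (C : MinChart f c F u₀ ρ r a w) (h : IsPLMin f c μ)
    (hM : IsRiemannianVolume k {x | f x = c} M) :
    M (graphMap F w '' Metric.ball u₀ ρ) =
      ∫⁻ u in Metric.ball u₀ ρ, volDensity (graphMap F w) u :=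
  hM.apply_image _ _ (C.isLocalParam h) _ measurableSet_ball subset_rfl

theorem measure_image_lt_top (C : MinChart f c F u₀ ρ r a w) (h : IsPLMin f c μ)
    (hM : IsRiemannianVolume k {x | f x = c} M) :
    M (graphMap F w '' Metric.ball u₀ ρ) < ⊤ := by
  obtain ⟨B, hB⟩ := C.bound
  rw [C.measure_image h hM]
  refine (setLIntegral_mono (g := fun _ => ENNReal.ofReal √B) measurable_const
    fun u hu => ENNReal.ofReal_le_ofReal (Real.sqrt_le_sqrt (hB u hu))).trans_lt ?_
  rw [setLIntegral_const]
  exact ENNReal.mul_lt_top ENNReal.ofReal_lt_top measure_ball_lt_top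

theorem measure_image_pos (C : MinChart f c F u₀ ρ r a w) (h : IsPLMin f c μ)
    (hM : IsRiemannianVolume k {x | f x = c} M) :
    0 < M (graphMap F w '' Metric.ball u₀ ρ) := by
  rw [C.measure_image h hM, pos_iff_ne_zero]
  intro h0
  rw [lintegral_eq_zero_iff' C.aemeasurable_volDensity] at h0
  have h1 : ∀ᵐ u ∂(volume.restrict (Metric.ball u₀ ρ)), False := by
    filter_upwards [h0, ae_restrict_mem measurableSet_ball] with u hu hu'
    have h2 : 0 < volDensity (graphMap F w) u :=
      ENNReal.ofReal_pos.2 (Real.sqrt_pos.2 (C.inducedMetric_det_pos h hu'))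
    rw [hu] at h2
    exact lt_irrefl _ h2
  have h3 : volume.restrict (Metric.ball u₀ ρ) = 0 := by
    rw [← ae_eq_bot]; exact Filter.eventually_false_iff_eq_bot.1 h1
  rw [Measure.restrict_eq_zero] at h3
  exact (Metric.measure_ball_pos volume u₀ C.ρ_pos).ne' h3

end MinChart

namespace IsPLMin

variable {k n d : ℕ} {f : EuclideanSpace ℝ (Fin d) → ℝ} {c μ : ℝ} {x : EuclideanSpace ℝ (Fin d)}
  {M : Measure (EuclideanSpace ℝ (Fin d))}

theorem continuousOn_rpow_normalHessianDet (h : IsPLMin f c μ) :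
    ContinuousOn (fun x => normalHessianDet f {x | f x = c} x ^ (-(1 / 2) : ℝ)) {x | f x = c} :=
  h.continuousOn_normalHessianDet.rpow_const fun _ hx => Or.inl (h.normalHessianDet_pos hx).ne'

theorem isFiniteMeasure (h : IsPLMin f c μ)
    (hk : ∀ x, f x = c → Module.finrank ℝ (formKer (hess f x)) = k)
    (hM : IsRiemannianVolume k {x | f x = c} M) : IsFiniteMeasure M := by
  have h1 : M {x | f x = c} < ⊤ := by
    refine h.isCompact.measure_lt_top_of_nhdsWithin fun x hx => ?_
    have hkd : k ≤ d := by rw [← hk x hx]; exact finrank_formKer_le f x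
    obtain ⟨F, ρ, r, a, w, C, hC⟩ := h.exists_minChart_ker hx (hk x hx) (Nat.add_sub_of_le hkd)
    refine ⟨_, ?_, C.measure_image_lt_top h hM⟩
    rw [C.image_eq h]
    refine inter_mem self_mem_nhdsWithin (mem_nhdsWithin_of_mem_nhds (C.isOpen_dom.mem_nhds ?_))
    have := C.graphMap_mem_dom (Metric.mem_ball_self C.ρ_pos)
    rwa [hC] at this
  refine ⟨?_⟩
  rw [← union_compl_self {x | f x = c}]
  refine (measure_union_le _ _).trans_lt ?_
  rw [hM.compl_eq_zero, add_zero]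
  exact h1

theorem measure_pos (h : IsPLMin f c μ)
    (hk : ∀ x, f x = c → Module.finrank ℝ (formKer (hess f x)) = k)
    (hM : IsRiemannianVolume k {x | f x = c} M) : 0 < M {x | f x = c} := by
  obtain ⟨x, hx⟩ := h.nonempty
  have hkd : k ≤ d := by rw [← hk x hx]; exact finrank_formKer_le f x
  obtain ⟨F, ρ, r, a, w, C, hC⟩ := h.exists_minChart_ker hx (hk x hx) (Nat.add_sub_of_le hkd)
  refine (C.measure_image_pos h hM).trans_le (measure_mono ?_)
  rw [C.image_eq h]
  exact inter_subset_left

theorem restrict_eq (hM : IsRiemannianVolume k {x | f x = c} M) :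
    M.restrict {x | f x = c} = M :=
  Measure.restrict_eq_self_of_ae_mem (mem_ae_iff.2 hM.compl_eq_zero)

theorem integrable_mul_rpow (h : IsPLMin f c μ)
    (hk : ∀ x, f x = c → Module.finrank ℝ (formKer (hess f x)) = k)
    (hM : IsRiemannianVolume k {x | f x = c} M) {φ : EuclideanSpace ℝ (Fin d) → ℝ}
    (hφ : Continuous φ) :
    Integrable (fun x => φ x * normalHessianDet f {x | f x = c} x ^ (-(1 / 2) : ℝ)) M := by
  have := h.isFiniteMeasure hk hM
  have h1 := (hφ.continuousOn.mul h.continuousOn_rpow_normalHessianDet).integrableOn_compact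
    (μ := M) h.isCompact
  rwa [IntegrableOn, restrict_eq hM] at h1

theorem integral_rpow_pos (h : IsPLMin f c μ)
    (hk : ∀ x, f x = c → Module.finrank ℝ (formKer (hess f x)) = k)
    (hM : IsRiemannianVolume k {x | f x = c} M) :
    0 < ∫ x in {x | f x = c}, normalHessianDet f {x | f x = c} x ^ (-(1 / 2) : ℝ) ∂M := by
  have hpos : ∀ x ∈ {x | f x = c}, 0 < normalHessianDet f {x | f x = c} x ^ (-(1 / 2) : ℝ) :=
    fun x hx => Real.rpow_pos_of_pos (h.normalHessianDet_pos hx) _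
  have h1 := h.integrable_mul_rpow hk hM (φ := fun _ => 1) continuous_const
  simp only [one_mul] at h1
  rw [setIntegral_pos_iff_support_of_nonneg_ae _ h1.integrableOn]
  · have : Function.support (fun x => normalHessianDet f {x | f x = c} x ^ (-(1 / 2) : ℝ)) ∩
        {x | f x = c} = {x | f x = c} :=
      inter_eq_right.2 fun x hx => (hpos x hx).ne'
    rw [this]
    exact h.measure_pos hk hM
  · filter_upwards [ae_restrict_mem h.isCompact.isClosed.measurableSet] with x hx
    exact (hpos x hx).le

/-- The Laplace integral of a chart, expressed with the Riemannian volume. -/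
theorem integral_chart_eq (h : IsPLMin f c μ) (hM : IsRiemannianVolume k {x | f x = c} M)
    {F : OrthFrame k n d} {u₀ : EuclideanSpace ℝ (Fin k)} {ρ r a : ℝ}
    {w : EuclideanSpace ℝ (Fin k) → EuclideanSpace ℝ (Fin n)} (C : MinChart f c F u₀ ρ r a w)
    {φ : EuclideanSpace ℝ (Fin d) → ℝ} (hφ : Continuous φ)
    (hsupp : ∀ x, φ x ≠ 0 → x ∈ MinChart.dom F u₀ ρ r w) :
    ∫ u in Metric.ball u₀ ρ, φ (graphMap F w u) *
        (bilinMatrix (hess f (graphMap F w u)) F.jVec).det ^ (-(1 / 2) : ℝ) =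
      ∫ x, φ x * normalHessianDet f {x | f x = c} x ^ (-(1 / 2) : ℝ) ∂M := by
  set S := {x | f x = c} with hS
  have himg := C.image_eq h
  have hsub : graphMap F w '' Metric.ball u₀ ρ ⊆ S := by rw [himg]; exact inter_subset_left
  have hmeas : MeasurableSet (graphMap F w '' Metric.ball u₀ ρ) := by
    rw [himg]; exact h.isCompact.isClosed.measurableSet.inter C.isOpen_dom.measurableSet
  have h1 : ∫ x, φ x * normalHessianDet f S x ^ (-(1 / 2) : ℝ) ∂M =
      ∫ x in graphMap F w '' Metric.ball u₀ ρ,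
        φ x * normalHessianDet f S x ^ (-(1 / 2) : ℝ) ∂M := by
    conv_lhs => rw [← restrict_eq hM]
    refine setIntegral_eq_of_subset_of_forall_sdiff_eq_zero h.isCompact.isClosed.measurableSet hsub
      fun x hx => ?_
    have : φ x = 0 := by
      by_contra h0
      exact hx.2 (by rw [himg]; exact ⟨hx.1, hsupp x h0⟩)
    rw [this, zero_mul]
  have hcont := contDiffOn_graphMap (F := F) C.contDiffOn
  have hae : AEStronglyMeasurable (fun x => φ x * normalHessianDet f S x ^ (-(1 / 2) : ℝ))
      (M.restrict (graphMap F w '' Metric.ball u₀ ρ)) :=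
    ((hφ.continuousOn.mul h.continuousOn_rpow_normalHessianDet).mono hsub).aestronglyMeasurable
      hmeas
  rw [hM.restrict_image (C.isLocalParam h)] at hae h1
  rw [h1, patchMeasure, integral_map _ hae, integral_withDensity_eq_integral_toReal_smul₀
    C.aemeasurable_volDensity]
  · refine setIntegral_congr_fun measurableSet_ball fun u hu => ?_
    have hA := C.det_pos h hu
    have hg := C.inducedMetric_det_pos h hu
    -- The Gram factor in the normal Hessian determinant, raised to the power `-1/2`, cancels the
    -- volume density of the chart.
    have h2 : (inducedMetric (graphMap F w) u).det ^ (-(1 / 2) : ℝ) *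
        √(inducedMetric (graphMap F w) u).det = 1 := by
      rw [Real.sqrt_eq_rpow, ← Real.rpow_add hg]; norm_num
    simp only [smul_eq_mul, volDensity]
    rw [ENNReal.toReal_ofReal (Real.sqrt_nonneg _), hS, C.normalHessianDet_eq h hu,
      Real.mul_rpow hA.le hg.le]
    linear_combination (-(φ (graphMap F w u) *
      (bilinMatrix (hess f (graphMap F w u)) F.jVec).det ^ (-(1 / 2) : ℝ))) * h2
  · exact Eventually.of_forall fun u => ENNReal.ofReal_lt_top
  · exact (hcont.continuousOn.aemeasurable measurableSet_ball).mono_ac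
      (withDensity_absolutelyContinuous _ _)

/-- Sublevel sets are compact, so `f` attains a minimum on the part of `{f ≤ c + 1}` outside `V`. -/
theorem exists_gap_off_nhds (h : IsPLMin f c μ) {V : Set (EuclideanSpace ℝ (Fin d))}
    (hV : IsOpen V) (hSV : {x | f x = c} ⊆ V) : ∃ ε > 0, ∀ x, x ∉ V → c + ε ≤ f x := by
  have hfc := h.contDiff.continuous
  have hK : IsCompact ({x | f x ≤ c + 1} \ V) :=
    (Metric.isCompact_of_isClosed_isBounded (isClosed_le hfc continuous_const)
      (isBounded_sublevel h.growth _)).diff hV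
  rcases ({x | f x ≤ c + 1} \ V).eq_empty_or_nonempty with he | hne
  · refine ⟨1, one_pos, fun x hx => ?_⟩
    by_contra! hlt
    exact (he ▸ (⟨hlt.le, hx⟩ : x ∈ {x | f x ≤ c + 1} \ V) : x ∈ (∅ : Set _))
  · obtain ⟨y, hy, hmin⟩ := hK.exists_isMinOn hne hfc.continuousOn
    have h1 : c < f y := lt_of_le_of_ne (h.le y) fun he => hy.2 (hSV he.symm)
    refine ⟨min 1 (f y - c), lt_min one_pos (by linarith), fun x hx => ?_⟩
    by_cases hx1 : f x ≤ c + 1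
    · have : f y ≤ f x := hmin ⟨hx1, hx⟩
      linarith [min_le_right 1 (f y - c)]
    · push Not at hx1
      linarith [min_le_left 1 (f y - c)]

theorem integrable_exp (h : IsPLMin f c μ) {lam : ℝ} (hl : 0 < lam) :
    Integrable fun x => Real.exp (-(f x - c) / lam) := by
  obtain ⟨a, ha, R, hR⟩ := h.growth
  have hfc := h.contDiff.continuous
  refine ((integrable_exp_neg_mul_norm_sq (n := d) (b := a / lam) (by positivity)).const_mul
    (Real.exp ((R + c) / lam))).mono' (by fun_prop) (Eventually.of_forall fun x => ?_)
  rw [Real.norm_eq_abs, Real.abs_exp, ← Real.exp_add]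
  refine Real.exp_le_exp.2 ?_
  rw [neg_mul, div_mul_eq_mul_div, ← sub_eq_add_neg, ← sub_div]
  gcongr
  linarith [hR x]

theorem tendsto_tail (h : IsPLMin f c μ) (n : ℕ) {V : Set (EuclideanSpace ℝ (Fin d))}
    (hV : IsOpen V) (hSV : {x | f x = c} ⊆ V) {φ : EuclideanSpace ℝ (Fin d) → ℝ} {B : ℝ}
    (hB : ∀ x, |φ x| ≤ B) (hφV : ∀ x ∈ V, φ x = 0) :
    Tendsto (fun σ : ℝ => (σ ^ n)⁻¹ * ∫ x, φ x * Real.exp (-(f x - c) / σ ^ 2)) (𝓝[>] 0)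
      (𝓝 0) := by
  obtain ⟨ε, hε, hgap⟩ := h.exists_gap_off_nhds hV hSV
  have hB0 : 0 ≤ B := (abs_nonneg _).trans (hB 0)
  set K := B * Real.exp ε * ∫ x, Real.exp (-(f x - c) / 1) with hK
  have hlim : Tendsto (fun σ : ℝ => (σ⁻¹ ^ (n : ℝ) * Real.exp (-ε * σ⁻¹)) * K) (𝓝[>] 0) (𝓝 0) := by
    have := ((tendsto_rpow_mul_exp_neg_mul_atTop_nhds_zero n ε hε).comp
      tendsto_inv_nhdsGT_zero).mul_const K
    simpa using this
  refine squeeze_zero_norm' ?_ hlim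
  filter_upwards [Ioo_mem_nhdsGT (zero_lt_one' ℝ)] with σ hσ
  have hσ0 := hσ.1
  have h1 : 1 ≤ σ⁻¹ := (one_le_inv₀ hσ0).2 hσ.2.le
  rw [norm_mul, Real.norm_eq_abs, abs_of_pos (by positivity), Real.rpow_natCast, inv_pow, mul_assoc]
  refine mul_le_mul_of_nonneg_left ?_ (by positivity)
  have h2 : ∀ x, ‖φ x * Real.exp (-(f x - c) / σ ^ 2)‖ ≤
      (Real.exp (-ε * σ⁻¹) * (B * Real.exp ε)) * Real.exp (-(f x - c) / 1) := fun x => by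
    by_cases hx : x ∈ V
    · rw [hφV x hx, zero_mul, norm_zero]; positivity
    · rw [norm_mul, Real.norm_eq_abs, Real.norm_eq_abs, Real.abs_exp]
      -- With `t = σ⁻¹ ≥ 1` and `f x - c ≥ ε`, one has `(f x - c) (t² - 1) ≥ ε (t - 1)`. This splits
      -- off an integrable factor independent of `σ` and one that decays faster than any power of
      -- `σ`.
      have h3 : Real.exp (-(f x - c) / σ ^ 2) ≤
          Real.exp (-ε * σ⁻¹) * Real.exp ε * Real.exp (-(f x - c) / 1) := by
        rw [← Real.exp_add, ← Real.exp_add]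
        refine Real.exp_le_exp.2 ?_
        have h4 := hgap x hx
        rw [div_eq_mul_inv, ← inv_pow, div_one]
        nlinarith [mul_nonneg (sub_nonneg.2 h1) (show 0 ≤ f x - c - ε by linarith),
          mul_nonneg (mul_nonneg (sub_nonneg.2 h1) (by linarith : (0:ℝ) ≤ σ⁻¹))
            (show 0 ≤ f x - c by linarith)]
      calc _ ≤ B * (Real.exp (-ε * σ⁻¹) * Real.exp ε * Real.exp (-(f x - c) / 1)) :=
            mul_le_mul (hB x) h3 (Real.exp_pos _).le hB0
        _ = _ := by ring
  refine (norm_integral_le_of_norm_le ((h.integrable_exp one_pos).const_mul _)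
    (Eventually.of_forall h2)).trans_eq ?_
  rw [integral_const_mul, hK]; ring

/-- Laplace's method: the contribution of the set of minimizers. -/
theorem tendsto_laplace (h : IsPLMin f c μ)
    (hk : ∀ x, f x = c → Module.finrank ℝ (formKer (hess f x)) = k) (hkn : k + n = d)
    (hM : IsRiemannianVolume k {x | f x = c} M) {φ : EuclideanSpace ℝ (Fin d) → ℝ}
    (hφ : Continuous φ) {B : ℝ} (hB : ∀ x, |φ x| ≤ B) :
    Tendsto (fun σ : ℝ => (σ ^ n)⁻¹ * ∫ x, φ x * Real.exp (-(f x - c) / σ ^ 2)) (𝓝[>] 0)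
      (𝓝 (gaussConst n *
        ∫ x, φ x * normalHessianDet f {x | f x = c} x ^ (-(1 / 2) : ℝ) ∂M)) := by
  set S := {x | f x = c} with hS
  have hfc := h.contDiff.continuous
  have hB0 : 0 ≤ B := (abs_nonneg _).trans (hB 0)
  choose F ρ r a w C hC using fun x : S => h.exists_minChart_ker x.2 (hk x x.2) hkn
  let U : S → Set (EuclideanSpace ℝ (Fin d)) := fun x =>
    MinChart.dom (F x) ((F x).I' x) (ρ x) (r x) (w x)
  have hU : ∀ x, IsOpen (U x) := fun x => (C x).isOpen_dom
  have hxU : ∀ x : S, (x : EuclideanSpace ℝ (Fin d)) ∈ U x := fun x => by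
    have := (C x).graphMap_mem_dom (Metric.mem_ball_self (C x).ρ_pos)
    rwa [hC] at this
  obtain ⟨t, ht⟩ := h.isCompact.elim_finite_subcover U hU fun x hx =>
    mem_iUnion.2 ⟨⟨x, hx⟩, hxU ⟨x, hx⟩⟩
  -- The partition must sum to one on a whole neighbourhood of `S`, not just on `S`, so that the
  -- remainder `η` vanishes near `S` and `tendsto_tail` applies to it.
  obtain ⟨δ, hδ, hδt⟩ := h.isCompact.exists_cthickening_subset_open
    (isOpen_biUnion fun x _ => hU x) ht
  obtain ⟨p, hp⟩ := PartitionOfUnity.exists_isSubordinate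
    (Metric.isClosed_cthickening (δ := δ) (E := S)) (fun i : t => U i) (fun i => hU i)
    (hδt.trans fun y hy => by
      obtain ⟨i, hi, hy⟩ := mem_iUnion₂.1 hy
      exact mem_iUnion.2 ⟨⟨i, hi⟩, hy⟩)
  have hp1 : ∀ i x, |p i x| ≤ 1 := fun i x => by
    rw [abs_of_nonneg (p.nonneg i x)]; exact p.le_one i x
  have hsum1 : ∀ x ∈ Metric.cthickening δ S, ∑ i, p i x = 1 := fun x hx => by
    rw [← finsum_eq_sum_of_fintype]; exact p.sum_eq_one hx
  have hint : ∀ (ψ : EuclideanSpace ℝ (Fin d) → ℝ) (B' : ℝ), Continuous ψ → (∀ x, |ψ x| ≤ B') →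
      ∀ σ : ℝ, 0 < σ → Integrable fun x => ψ x * Real.exp (-(f x - c) / σ ^ 2) :=
    fun ψ B' hψ hB' σ hσ => (h.integrable_exp (by positivity)).bdd_mul hψ.aestronglyMeasurable
      (c := B') (Eventually.of_forall hB')
  have hψc : ∀ i, Continuous fun x => φ x * p i x := fun i => hφ.mul (p i).continuous
  have hψB : ∀ i x, |φ x * p i x| ≤ B * 1 := fun i x => by
    rw [abs_mul]; exact mul_le_mul (hB x) (hp1 i x) (abs_nonneg _) hB0
  have hloc : ∀ i : t, Tendsto (fun σ : ℝ => (σ ^ n)⁻¹ * ∫ x, (φ x * p i x) *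
      Real.exp (-(f x - c) / σ ^ 2)) (𝓝[>] 0) (𝓝 (gaussConst n *
        ∫ x, (φ x * p i x) * normalHessianDet f S x ^ (-(1 / 2) : ℝ) ∂M)) := fun i => by
    have hsupp : ∀ x, φ x * p i x ≠ 0 → x ∈ U i := fun x hx =>
      hp i (subset_tsupport _ (right_ne_zero_of_mul hx))
    rw [← h.integral_chart_eq hM (C i) (hψc i) hsupp]
    exact (C i).tendsto_laplace h (fun σ hσ => h.integrable_exp (by positivity)) (hψc i) (hψB i)
      hsupp
  set η : EuclideanSpace ℝ (Fin d) → ℝ := fun x => φ x * (1 - ∑ i, p i x) with hη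
  have hηc : Continuous η := hφ.mul (continuous_const.sub
    (continuous_finsetSum _ fun i _ => (p i).continuous))
  have hηB : ∀ x, |η x| ≤ B * 1 := fun x => by
    rw [hη, abs_mul]
    refine mul_le_mul (hB x) ?_ (abs_nonneg _) hB0
    have h1 : ∑ i, p i x ≤ 1 := by
      rw [← finsum_eq_sum_of_fintype]; exact p.sum_le_one x
    have h2 : 0 ≤ ∑ i, p i x := Finset.sum_nonneg fun i _ => p.nonneg i x
    rw [abs_of_nonneg (by linarith)]; linarith
  have htail := h.tendsto_tail n Metric.isOpen_thickening
    (Metric.self_subset_thickening hδ S) hηB fun x hx => by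
      simp only [hη]
      rw [hsum1 x (Metric.thickening_subset_cthickening δ S hx), sub_self, mul_zero]
  have hdec : ∀ x, φ x = ∑ i, φ x * p i x + η x := fun x => by
    rw [hη, ← Finset.mul_sum]; ring
  have hlimeq : gaussConst n * ∫ x, φ x * normalHessianDet f S x ^ (-(1 / 2) : ℝ) ∂M =
      ∑ i : t, gaussConst n * ∫ x, (φ x * p i x) * normalHessianDet f S x ^ (-(1 / 2) : ℝ) ∂M +
        0 := by
    rw [add_zero, ← Finset.mul_sum, ← integral_finsetSum _ fun i _ =>
      h.integrable_mul_rpow hk hM (hψc i)]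
    congr 1
    refine integral_congr_ae ?_
    have : ∀ᵐ x ∂M, x ∈ S := mem_ae_iff.2 hM.compl_eq_zero
    filter_upwards [this] with x hx
    rw [← Finset.sum_mul, ← Finset.mul_sum, hsum1 x (Metric.self_subset_cthickening S hx), mul_one]
  rw [hlimeq]
  refine ((tendsto_finsetSum _ fun i _ => hloc i).add htail).congr' ?_
  filter_upwards [self_mem_nhdsWithin] with σ hσ
  rw [← Finset.mul_sum, ← mul_add, ← integral_finsetSum _ fun i _ =>
    hint _ _ (hψc i) (hψB i) σ hσ, ← integral_add (integrable_finsetSum _ fun i _ =>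
    hint _ _ (hψc i) (hψB i) σ hσ) (hint _ _ hηc hηB σ hσ)]
  congr 2
  ext x
  rw [← Finset.sum_mul, ← add_mul, ← hdec]

end IsPLMin

/-! ### The limiting Gibbs measure -/

namespace IsPLMin

variable {k n d : ℕ} {f : EuclideanSpace ℝ (Fin d) → ℝ} {c μ : ℝ} {x : EuclideanSpace ℝ (Fin d)}
  {M : Measure (EuclideanSpace ℝ (Fin d))}

theorem integral_exp_pos (h : IsPLMin f c μ) {lam : ℝ} (hl : 0 < lam) :
    0 < ∫ x, Real.exp (-(f x - c) / lam) :=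
  MeasureTheory.integral_exp_pos (h.integrable_exp hl)

theorem exp_eq (f : EuclideanSpace ℝ (Fin d) → ℝ) (c lam : ℝ) (x : EuclideanSpace ℝ (Fin d)) :
    Real.exp (-f x / lam) = Real.exp (-c / lam) * Real.exp (-(f x - c) / lam) := by
  rw [← Real.exp_add]; congr 1; ring

theorem gibbs_density_eq (f : EuclideanSpace ℝ (Fin d) → ℝ) (c lam : ℝ)
    (x : EuclideanSpace ℝ (Fin d)) :
    Real.exp (-f x / lam) / ∫ z, Real.exp (-f z / lam) =
      Real.exp (-(f x - c) / lam) / ∫ z, Real.exp (-(f z - c) / lam) := by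
  simp_rw [exp_eq f c lam]
  rw [integral_const_mul, mul_div_mul_left _ _ (Real.exp_pos _).ne']

theorem isProbabilityMeasure_gibbs (h : IsPLMin f c μ) {lam : ℝ} (hl : 0 < lam) :
    IsProbabilityMeasure (gibbsMeasure f lam) := by
  refine ⟨?_⟩
  have h1 := h.integral_exp_pos hl
  rw [gibbsMeasure, withDensity_apply _ MeasurableSet.univ, setLIntegral_univ]
  simp_rw [gibbs_density_eq f c lam]
  rw [← ofReal_integral_eq_lintegral_ofReal ((h.integrable_exp hl).div_const _)
    (Eventually.of_forall fun x => by positivity), integral_div, div_self h1.ne', ENNReal.ofReal_one]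

theorem integral_gibbs (h : IsPLMin f c μ) (φ : EuclideanSpace ℝ (Fin d) → ℝ) {lam : ℝ}
    (hl : 0 < lam) : ∫ x, φ x ∂(gibbsMeasure f lam) =
      (∫ x, φ x * Real.exp (-(f x - c) / lam)) / ∫ z, Real.exp (-(f z - c) / lam) := by
  have hfc := h.contDiff.continuous
  have h1 := h.integral_exp_pos hl
  rw [gibbsMeasure]
  simp_rw [gibbs_density_eq f c lam]
  rw [integral_withDensity_eq_integral_toReal_smul (by fun_prop)
    (Eventually.of_forall fun x => ENNReal.ofReal_lt_top), ← integral_div]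
  congr 1
  ext x
  rw [ENNReal.toReal_ofReal (by positivity), smul_eq_mul]
  ring

/-- With `σ = √lam`, the Gibbs expectation of `φ` is a quotient of two Laplace integrals, for `φ`
and for `1`; the powers of `σ` and the Gaussian constants cancel. -/
theorem isLimitGibbsMeasure (h : IsPLMin f c μ)
    (hk : ∀ x, f x = c → Module.finrank ℝ (formKer (hess f x)) = k) (hkn : k + n = d)
    (hM : IsRiemannianVolume k {x | f x = c} M) :
    IsLimitGibbsMeasure f
      (M.withDensity fun x => ENNReal.ofReal (limitDensity f {x | f x = c} M x)) := by
  set S := {x | f x = c} with hS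
  set D : EuclideanSpace ℝ (Fin d) → ℝ := fun x => normalHessianDet f S x ^ (-(1 / 2) : ℝ) with hD
  set Z := ∫ x in S, D x ∂M with hZ
  have hZpos : 0 < Z := h.integral_rpow_pos hk hM
  have hDint : Integrable D M := by
    simpa only [one_mul] using h.integrable_mul_rpow hk hM (φ := fun _ => 1) continuous_const
  have hdens : ∀ x, limitDensity f S M x = D x / Z := fun x => rfl
  have hDpos : ∀ᵐ x ∂M, 0 ≤ D x := by
    have : ∀ᵐ x ∂M, x ∈ S := mem_ae_iff.2 hM.compl_eq_zero
    filter_upwards [this] with x hx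
    exact (Real.rpow_pos_of_pos (h.normalHessianDet_pos hx) _).le
  have hZ' : Z = ∫ x, D x ∂M := by rw [hZ, restrict_eq hM]
  refine ⟨⟨?_⟩, fun lam hl => h.isProbabilityMeasure_gibbs hl, fun φ => ?_⟩
  · rw [withDensity_apply _ MeasurableSet.univ, setLIntegral_univ]
    simp_rw [hdens]
    rw [← ofReal_integral_eq_lintegral_ofReal (hDint.div_const _)
      (hDpos.mono fun x hx => div_nonneg hx hZpos.le), integral_div, ← hZ', div_self hZpos.ne',
      ENNReal.ofReal_one]
  · have hlim : ∀ (ψ : EuclideanSpace ℝ (Fin d) → ℝ) (B : ℝ), Continuous ψ → (∀ x, |ψ x| ≤ B) →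
        Tendsto (fun lam : ℝ => (√lam ^ n)⁻¹ * ∫ x, ψ x * Real.exp (-(f x - c) / lam)) (𝓝[>] 0)
          (𝓝 (gaussConst n * ∫ x, ψ x * D x ∂M)) := fun ψ B hψ hB => by
      have h1 : Tendsto Real.sqrt (𝓝[>] 0) (𝓝[>] 0) := by
        refine tendsto_nhdsWithin_of_tendsto_nhds_of_eventually_within _ ?_ ?_
        · have := Real.continuous_sqrt.tendsto 0
          rw [Real.sqrt_zero] at this
          exact this.mono_left nhdsWithin_le_nhds
        · filter_upwards [self_mem_nhdsWithin] with lam hl using Real.sqrt_pos.2 hl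
      refine ((h.tendsto_laplace hk hkn hM hψ hB).comp h1).congr' ?_
      filter_upwards [self_mem_nhdsWithin] with lam hl
      simp only [Function.comp_apply]
      rw [Real.sq_sqrt (le_of_lt hl)]
    have h1 := hlim φ ‖φ‖ φ.continuous φ.norm_coe_le_norm
    have h2 := hlim (fun _ => 1) 1 continuous_const (by simp)
    simp only [one_mul] at h2
    rw [← hZ'] at h2
    have hG := gaussConst_pos n
    have h3 := h1.div h2 (by positivity)
    have h4 : ∫ x, φ x ∂(M.withDensity fun x => ENNReal.ofReal (limitDensity f S M x)) =
        (gaussConst n * ∫ x, φ x * D x ∂M) / (gaussConst n * Z) := by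
      simp_rw [hdens]
      rw [integral_withDensity_eq_integral_toReal_smul₀
        (hDint.aestronglyMeasurable.aemeasurable.div_const _).ennreal_ofReal
        (Eventually.of_forall fun x => ENNReal.ofReal_lt_top), mul_div_mul_left _ _ hG.ne',
        ← integral_div]
      refine integral_congr_ae (hDpos.mono fun x hx => ?_)
      simp only
      rw [ENNReal.toReal_ofReal (div_nonneg hx hZpos.le), smul_eq_mul]
      ring
    rw [h4]
    refine h3.congr' ?_
    filter_upwards [self_mem_nhdsWithin] with lam hl
    have hl' : 0 < lam := hl
    have : 0 < √lam := Real.sqrt_pos.2 hl'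
    simp only [Pi.div_apply]
    rw [h.integral_gibbs φ hl, mul_div_mul_left _ _ (by positivity)]

end IsPLMin

/-! ### Normal disks along the set of minimizers -/

/-- A lower bound for a form that is positive in one factor of an orthogonal splitting. -/
theorem le_apply_add_of_split {V : Type*} [NormedAddCommGroup V] [NormedSpace ℝ V]
    {H : V →L[ℝ] V →L[ℝ] ℝ} (hH : ∀ v w, H v w = H w v) {a Λ : ℝ} (ha : 0 < a)
    (hΛ : ‖H‖ ≤ Λ) {t v : V} (hv : a / 2 * ‖v‖ ^ 2 ≤ H v v) :
    a / 4 * ‖v‖ ^ 2 - (Λ + 4 * Λ ^ 2 / a) * ‖t‖ ^ 2 ≤ H (t + v) (t + v) := by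
  have h0 : 0 ≤ Λ := (norm_nonneg _).trans hΛ
  have h1 : |H t t| ≤ Λ * ‖t‖ * ‖t‖ := (H.le_opNorm₂ t t).trans (by gcongr)
  have h2 : |H t v| ≤ Λ * ‖t‖ * ‖v‖ := (H.le_opNorm₂ t v).trans (by gcongr)
  have h3 := (abs_le.1 h1).1
  have h4 := (abs_le.1 h2).1
  have h5 : H (t + v) (t + v) = H t t + 2 * H t v + H v v := by
    simp only [map_add, add_apply, hH v t]; ring
  -- Young's inequality, with weights that spend half of the coercivity `a / 2` in `v` on the cross
  -- term.
  have h6 : 2 * (Λ * ‖t‖ * ‖v‖) ≤ a / 4 * ‖v‖ ^ 2 + 4 * Λ ^ 2 / a * ‖t‖ ^ 2 := by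
    have h7 : a / 4 * ‖v‖ ^ 2 + 4 * Λ ^ 2 / a * ‖t‖ ^ 2 - 2 * (Λ * ‖t‖ * ‖v‖) =
        1 / (4 * a) * (a * ‖v‖ - 4 * Λ * ‖t‖) ^ 2 := by field_simp; ring
    have h8 : 0 ≤ 1 / (4 * a) * (a * ‖v‖ - 4 * Λ * ‖t‖) ^ 2 := by positivity
    linarith
  rw [h5]; nlinarith

namespace IsPLMin

variable {k n d : ℕ} {f : EuclideanSpace ℝ (Fin d) → ℝ} {c μ : ℝ}
  {x p q : EuclideanSpace ℝ (Fin d)}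

theorem gap' (h : IsPLMin f c μ) (hx : f x = c) {v : EuclideanSpace ℝ (Fin d)}
    (hv : v ∈ (formKer (hess f x))ᗮ) : 1 / (2 * μ) * ‖v‖ ^ 2 ≤ hess f x v v :=
  h.gap hx fun _ hz => (Submodule.mem_orthogonal _ _).1 hv _ hz

/-- The Hessian only sees the component of `z` orthogonal to its kernel, and the gap bounds it below
there. -/
theorem norm_normal_le (h : IsPLMin f c μ) (hx : f x = c) (z : EuclideanSpace ℝ (Fin d)) :
    1 / (2 * μ) * ‖z - (formKer (hess f x)).starProjection z‖ ≤ ‖hess f x z‖ := by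
  set T := formKer (hess f x)
  set v := z - T.starProjection z with hv
  have h1 := h.gap' hx (T.sub_starProjection_mem_orthogonal z)
  have h2 : hess f x (T.starProjection z) = 0 := mem_formKer.1 (T.starProjection_apply_mem z)
  have h3 : hess f x z = hess f x v := by rw [hv, map_sub, h2, sub_zero]
  rw [h3]
  rcases (norm_nonneg v).eq_or_lt with h0 | h0
  · rw [← h0]; simp
  · have h4 : hess f x v v ≤ ‖hess f x v‖ * ‖v‖ := (le_abs_self _).trans ((hess f x v).le_opNorm v)
    have h5 := h1.trans h4
    rw [sq, ← mul_assoc] at h5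
    exact le_of_mul_le_mul_right h5 h0

/-- A tangent vector at `p` is nearly annihilated by the Hessian at `q`, so its component normal at
`q` is small: the tilt of the tangent spaces is controlled by the variation of the Hessian. -/
theorem inner_tangent_normal_le (h : IsPLMin f c μ) (hq : f q = c)
    {t v : EuclideanSpace ℝ (Fin d)} (ht : t ∈ formKer (hess f p))
    (hv : v ∈ (formKer (hess f q))ᗮ) {ℓ : ℝ} (hℓ : ‖hess f p - hess f q‖ ≤ ℓ) :
    |inner ℝ t v| ≤ 2 * μ * ℓ * ‖t‖ * ‖v‖ := by
  have hμ := h.pos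
  set T := formKer (hess f q)
  have h1 := h.norm_normal_le hq t
  have h2 : hess f q t = (hess f q - hess f p) t := by
    rw [sub_apply, mem_formKer.1 ht, sub_zero]
  have h3 : ‖hess f q t‖ ≤ ℓ * ‖t‖ := by
    rw [h2]
    exact ((hess f q - hess f p).le_opNorm t).trans (by rw [norm_sub_rev]; gcongr)
  have h4 : inner ℝ t v = inner ℝ (t - T.starProjection t) v := by
    rw [inner_sub_left, (Submodule.mem_orthogonal _ _).1 hv _ (T.starProjection_apply_mem t),
      sub_zero]
  rw [h4]
  refine (abs_real_inner_le_norm _ _).trans ?_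
  have h5 : ‖t - T.starProjection t‖ ≤ 2 * μ * ℓ * ‖t‖ := by
    have := h1.trans h3
    rw [one_div, inv_mul_le_iff₀ (by positivity)] at this
    linarith
  gcongr

theorem norm_tangent_of_normal_le (h : IsPLMin f c μ) (hq : f q = c)
    {v : EuclideanSpace ℝ (Fin d)} (hv : v ∈ (formKer (hess f q))ᗮ) {ℓ : ℝ}
    (hℓ : ‖hess f p - hess f q‖ ≤ ℓ) :
    ‖(formKer (hess f p)).starProjection v‖ ≤ 2 * μ * ℓ * ‖v‖ := by
  have hμ := h.pos
  have hℓ0 : 0 ≤ ℓ := (norm_nonneg _).trans hℓ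
  set T := formKer (hess f p)
  set t := T.starProjection v with ht
  have h1 := h.inner_tangent_normal_le hq (T.starProjection_apply_mem v) hv hℓ
  have h2 : inner ℝ t v = ‖t‖ ^ 2 := by
    have h3 : inner ℝ t (v - t) = 0 :=
      (Submodule.mem_orthogonal _ _).1 (T.sub_starProjection_mem_orthogonal v) _
        (T.starProjection_apply_mem v)
    rw [inner_sub_right, real_inner_self_eq_norm_sq] at h3
    linarith
  rw [← ht, h2, abs_of_nonneg (sq_nonneg _)] at h1
  rcases (norm_nonneg t).eq_or_lt with h0 | h0
  · rw [← h0]; positivity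
  · refine le_of_mul_le_mul_right ?_ h0
    nlinarith

/-- The gradient vanishes at both ends of the secant, so the Hessian at `p` applied to it is only
the first-order Taylor error of the gradient. -/
theorem inner_secant_normal_le (h : IsPLMin f c μ) (hp : f p = c) (hq : f q = c)
    {v : EuclideanSpace ℝ (Fin d)} (hv : v ∈ (formKer (hess f p))ᗮ) {ℓ : ℝ}
    {s : Set (EuclideanSpace ℝ (Fin d))} (hs : Convex ℝ s) (hps : p ∈ s) (hqs : q ∈ s)
    (hℓ : ∀ y ∈ s, ‖hess f y - hess f p‖ ≤ ℓ) :
    |inner ℝ (q - p) v| ≤ 2 * μ * ℓ * ‖q - p‖ * ‖v‖ := by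
  have hμ := h.pos
  set T := formKer (hess f p)
  have h1 := hs.norm_image_sub_le_of_norm_hasFDerivWithin_le' (f := fderiv ℝ f)
    (fun y _ => (hasFDerivAt_fderiv_of_contDiff_two h.contDiff y).hasFDerivWithinAt)
    hℓ hps hqs
  rw [h.fderiv_eq_zero hp, h.fderiv_eq_zero hq, sub_zero, zero_sub, norm_neg] at h1
  have h2 := (h.norm_normal_le hp (q - p)).trans h1
  have h4 : inner ℝ (q - p) v = inner ℝ ((q - p) - T.starProjection (q - p)) v := by
    rw [inner_sub_left (q - p), (Submodule.mem_orthogonal _ _).1 hv _ (T.starProjection_apply_mem _),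
      sub_zero]
  rw [h4]
  refine (abs_real_inner_le_norm _ _).trans ?_
  have h5 : ‖(q - p) - T.starProjection (q - p)‖ ≤ 2 * μ * ℓ * ‖q - p‖ := by
    rw [one_div, inv_mul_le_iff₀ (by positivity)] at h2
    linarith
  gcongr

/-- Every tangent vector is the velocity of a curve of minimizers. -/
theorem exists_curve (h : IsPLMin f c μ) (hp : f p = c) {t : EuclideanSpace ℝ (Fin d)}
    (ht : t ∈ formKer (hess f p)) :
    ∃ γ : ℝ → EuclideanSpace ℝ (Fin d), γ 0 = p ∧ HasDerivAt γ t 0 ∧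
      ∀ᶠ s in 𝓝 (0 : ℝ), f (γ s) = c := by
  obtain ⟨F, ρ, r, a, w, C, hC⟩ := h.exists_minChart_ker hp rfl
    (Nat.add_sub_of_le (finrank_formKer_le f p))
  have hu := Metric.mem_ball_self (x := F.I' p) C.ρ_pos
  have h1 := C.range_eq_formKer h hu
  rw [hC] at h1
  rw [← h1] at ht
  obtain ⟨z, rfl⟩ := ht
  have h2 : HasDerivAt (fun s : ℝ => F.I' p + s • z) z 0 := by
    simpa using ((hasDerivAt_id (0 : ℝ)).smul_const z).const_add (F.I' p)
  have h4 : F.I' p + (0 : ℝ) • z = F.I' p := by simp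
  refine ⟨fun s => graphMap F w (F.I' p + s • z), by simp [hC], ?_, ?_⟩
  · have h3 := fderiv_graphMap (F := F) (C.differentiableAt hu)
    rw [← h4] at h3
    have h5 := h3.comp_hasDerivAt (0 : ℝ) h2
    simp only [h4] at h5
    exact h5
  · have h3 : ∀ᶠ s in 𝓝 (0 : ℝ), F.I' p + s • z ∈ Metric.ball (F.I' p) ρ :=
      h2.continuousAt.eventually_mem (by rw [h4]; exact Metric.ball_mem_nhds _ C.ρ_pos)
    exact h3.mono fun s hs => C.mem _ hs

/-- Maximizing over the minimizers of `f` the minimum of `g` over normal disks. -/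
theorem exists_max_min (h : IsPLMin f c μ) {g : EuclideanSpace ℝ (Fin d) → ℝ}
    (hg : Continuous g) {r : ℝ} (hr : 0 ≤ r) :
    ∃ p v, f p = c ∧ v ∈ (formKer (hess f p))ᗮ ∧ ‖v‖ ≤ r ∧
      (∀ v' ∈ (formKer (hess f p))ᗮ, ‖v'‖ ≤ r → g (p + v) ≤ g (p + v')) ∧
      (∀ p', f p' = c → ∃ v' ∈ (formKer (hess f p'))ᗮ, ‖v'‖ ≤ r ∧ g (p' + v') ≤ g p' ∧
        g (p' + v') ≤ g (p + v)) := by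
  have hμ := h.pos
  have hmin : ∀ p, ∃ v ∈ (formKer (hess f p))ᗮ, ‖v‖ ≤ r ∧
      ∀ v' ∈ (formKer (hess f p))ᗮ, ‖v'‖ ≤ r → g (p + v) ≤ g (p + v') := fun p => by
    have hK : IsCompact (((formKer (hess f p))ᗮ : Set (EuclideanSpace ℝ (Fin d))) ∩
        Metric.closedBall 0 r) :=
      (isCompact_closedBall _ _).inter_left (Submodule.isClosed_orthogonal _)
    obtain ⟨v, hv, hvm⟩ := hK.exists_isMinOn
      ⟨0, Submodule.zero_mem _, Metric.mem_closedBall_self hr⟩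
      (f := fun v => g (p + v)) (by fun_prop)
    exact ⟨v, hv.1, by simpa using hv.2, fun v' hv' hr' => hvm ⟨hv', by simpa using hr'⟩⟩
  choose V hVn hVr hVm using hmin
  -- Upper semicontinuity suffices for a maximum. For `p'` near `p`, the projection of `V p` to the
  -- normal space at `p'` is a competitor in the disk at `p'`: projecting does not lengthen it, and
  -- it tends to `V p` because the tangent spaces tilt little.
  have husc : UpperSemicontinuousOn (fun p => g (p + V p)) {x | f x = c} := by
    intro p hp y hy
    set P : EuclideanSpace ℝ (Fin d) → EuclideanSpace ℝ (Fin d) := fun p' =>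
      V p - (formKer (hess f p')).starProjection (V p) with hP
    have h1 : Tendsto (fun p' => 2 * μ * ‖hess f p' - hess f p‖ * ‖V p‖) (𝓝 p) (𝓝 0) := by
      have h2 : Continuous fun p' => 2 * μ * ‖hess f p' - hess f p‖ * ‖V p‖ := by
        have := continuous_hess h.contDiff
        fun_prop
      simpa using h2.tendsto p
    have h2 : Tendsto (fun p' => (formKer (hess f p')).starProjection (V p)) (𝓝 p) (𝓝 0) :=
      squeeze_zero_norm (fun p' => h.norm_tangent_of_normal_le hp (hVn p) le_rfl) h1
    have h3 : Tendsto (fun p' => g (p' + P p')) (𝓝 p) (𝓝 (g (p + V p))) := by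
      refine (hg.tendsto _).comp (tendsto_id.add ?_)
      simpa using tendsto_const_nhds.sub h2
    refine mem_nhdsWithin_of_mem_nhds ?_
    filter_upwards [h3.eventually_lt_const hy] with p' hp'
    refine (hVm p' (P p') (Submodule.sub_starProjection_mem_orthogonal _) ?_).trans_lt hp'
    refine le_trans ?_ (hVr p)
    have h5 := (formKer (hess f p'))ᗮ.norm_starProjection_apply_le (V p)
    rwa [Submodule.starProjection_orthogonal'] at h5
  obtain ⟨p, hp, hpm⟩ := husc.exists_isMaxOn h.nonempty h.isCompact
  refine ⟨p, V p, hp, hVn p, hVr p, hVm p, fun p' hp' => ⟨V p', hVn p', hVr p', ?_, hpm hp'⟩⟩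
  simpa using hVm p' 0 (Submodule.zero_mem _) (by simpa using hr)

end IsPLMin

/-! ### Perturbation of the set of minimizers -/

section Perturbation

variable {k n d : ℕ}

/-- `f` is close to `f₀` near the set of minimizers of `f₀`: its Hessian is bounded, and bounded
below in the directions normal to that set, and its minima on the normal disks of radius `r` lie
within `η` of the centre, where `η` is small compared to the Lipschitz constant `L` of the Hessian
of `f₀`. -/
structure NearMin (f₀ : EuclideanSpace ℝ (Fin d) → ℝ) (c₀ μ₀ : ℝ)
    (f : EuclideanSpace ℝ (Fin d) → ℝ) (c μ a r Λ L η : ℝ) : Prop where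
  base : IsPLMin f₀ c₀ μ₀
  pert : IsPLMin f c μ
  a_pos : 0 < a
  r_pos : 0 < r
  η_nonneg : 0 ≤ η
  two_η_le : 2 * η < r
  lower : ∀ p, f₀ p = c₀ → ∀ y, ‖y - p‖ ≤ r → ∀ v ∈ (formKer (hess f₀ p))ᗮ,
    a / 2 * ‖v‖ ^ 2 ≤ hess f y v v
  upper : ∀ p, f₀ p = c₀ → ∀ y, ‖y - p‖ ≤ r → ‖hess f y‖ ≤ Λ
  small : ∀ p, f₀ p = c₀ → ∀ v ∈ (formKer (hess f₀ p))ᗮ, ‖v‖ ≤ r → f (p + v) ≤ f p → ‖v‖ ≤ η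
  lip : ∀ p, f₀ p = c₀ → ∀ y y', ‖y - p‖ ≤ r → ‖y' - p‖ ≤ r →
    ‖hess f₀ y - hess f₀ y'‖ ≤ L * ‖y - y'‖
  L_nonneg : 0 ≤ L
  L_le : 2 * μ₀ * L * η ≤ 1 / 4
  subset : {x | f x = c} ⊆ Metric.thickening (r / 4) {x | f₀ x = c₀}

namespace NearMin

variable {f₀ f : EuclideanSpace ℝ (Fin d) → ℝ} {c₀ μ₀ c μ a r Λ L η : ℝ}
  {p p' : EuclideanSpace ℝ (Fin d)}

/-- The second-order term is split along the tangent and normal spaces of `f₀` at `p`: convexity in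
the normal part, at a bounded cost in the tangent part. -/
theorem taylor_lower (h : NearMin f₀ c₀ μ₀ f c μ a r Λ L η) (hp : f₀ p = c₀)
    {x z : EuclideanSpace ℝ (Fin d)} (hx : ‖x - p‖ ≤ r) (hxz : ‖x + z - p‖ ≤ r) :
    f x + fderiv ℝ f x z +
      (a / 4 * ‖z - (formKer (hess f₀ p)).starProjection z‖ ^ 2 -
        (Λ + 4 * Λ ^ 2 / a) * ‖(formKer (hess f₀ p)).starProjection z‖ ^ 2) / 2 ≤ f (x + z) := by
  refine taylor_two_lower h.pert.contDiff fun ξ hξ => ?_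
  have hy : ‖x + ξ • z - p‖ ≤ r := by
    have h1 : x + ξ • z ∈ Metric.closedBall p r :=
      add_smul_mem_of_convex (convex_closedBall p r) (by simpa [dist_eq_norm] using hx)
        (by simpa [dist_eq_norm] using hxz) hξ
    simpa [dist_eq_norm] using h1
  have h1 := le_apply_add_of_split (hess_comm h.pert.contDiff (x + ξ • z)) h.a_pos
    (h.upper p hp _ hy) (t := (formKer (hess f₀ p)).starProjection z)
    (h.lower p hp _ hy _ ((formKer (hess f₀ p)).sub_starProjection_mem_orthogonal z))
  rwa [add_sub_cancel] at h1

theorem fderiv_normal_eq_zero (h : NearMin f₀ c₀ μ₀ f c μ a r Λ L η)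
    {v : EuclideanSpace ℝ (Fin d)} (hvr : ‖v‖ < r)
    (hmin : ∀ v' ∈ (formKer (hess f₀ p))ᗮ, ‖v'‖ ≤ r → f (p + v) ≤ f (p + v'))
    (hv : v ∈ (formKer (hess f₀ p))ᗮ) {z : EuclideanSpace ℝ (Fin d)}
    (hz : z ∈ (formKer (hess f₀ p))ᗮ) : fderiv ℝ f (p + v) z = 0 := by
  have h1 := hasDerivAt_comp_add_smul (h.pert.contDiff.differentiable (by norm_num)) (p + v) z 0
  rw [zero_smul, add_zero] at h1
  refine IsLocalMin.hasDerivAt_eq_zero ?_ h1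
  have h2 : ∀ᶠ s in 𝓝 (0 : ℝ), ‖v + s • z‖ < r := by
    have h3 : Continuous fun s : ℝ => ‖v + s • z‖ := by fun_prop
    refine h3.continuousAt.eventually_lt continuousAt_const (by simpa using hvr)
  filter_upwards [h2] with s hs
  simp only [zero_smul, add_zero]
  rw [add_assoc]
  exact hmin _ (Submodule.add_mem _ hv (Submodule.smul_mem _ _ hz)) hs.le

/-- At the largest of the minima of `f` over normal disks, the derivative of `f` is small along
secants of the set of minimizers of `f₀`. -/
theorem fderiv_secant_le (h : NearMin f₀ c₀ μ₀ f c μ a r Λ L η) (hp : f₀ p = c₀)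
    {v : EuclideanSpace ℝ (Fin d)} (hv : v ∈ (formKer (hess f₀ p))ᗮ) (hvη : ‖v‖ ≤ η)
    (hD : ∀ z ∈ (formKer (hess f₀ p))ᗮ, fderiv ℝ f (p + v) z = 0)
    (hp' : f₀ p' = c₀) (hpp : ‖p' - p‖ ≤ r / 2)
    {v' : EuclideanSpace ℝ (Fin d)} (hv' : v' ∈ (formKer (hess f₀ p'))ᗮ) (hvη' : ‖v'‖ ≤ η)
    (hle : f (p' + v') ≤ f (p + v)) :
    fderiv ℝ f (p + v) (p' - p) ≤ 1 / 4 * ‖fderiv ℝ f (p + v)‖ * ‖p' - p‖ +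
      2 * (Λ + 4 * Λ ^ 2 / a) * ‖p' - p‖ ^ 2 := by
  have ha := h.a_pos
  have hr := h.r_pos
  have hη := h.two_η_le
  have hμ := h.base.pos
  set T := formKer (hess f₀ p) with hT
  set ℓ := fderiv ℝ f (p + v) with hℓ
  set C := Λ + 4 * Λ ^ 2 / a with hC
  have hC0 : 0 ≤ C := by
    have : 0 ≤ Λ := (norm_nonneg _).trans (h.upper p hp p (by simpa using hr.le))
    positivity
  set z := (p' + v') - (p + v) with hz
  have h1 := h.taylor_lower hp (x := p + v) (z := z) (by simp; linarith) (by
    rw [hz, add_sub_cancel]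
    calc ‖p' + v' - p‖ = ‖(p' - p) + v'‖ := by congr 1; abel
      _ ≤ ‖p' - p‖ + ‖v'‖ := norm_add_le _ _
      _ ≤ r := by linarith)
  rw [hz, add_sub_cancel, ← hz, ← hT, ← hℓ, ← hC] at h1
  have hPv : T.starProjection v = 0 := (Submodule.starProjection_apply_eq_zero_iff T).2 hv
  have hPz : T.starProjection z = T.starProjection (p' - p) + T.starProjection v' := by
    rw [← map_add, ← sub_zero (T.starProjection (p' - p + v')), ← hPv, ← map_sub]
    congr 1; rw [hz]; abel
  -- The vector `v'` is normal at `p'`, so its part tangent at `p` is of order `L ‖p' - p‖ η`; `η`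
  -- was required to be small relative to `L` exactly for this factor `1/4`.
  have hsmall : ‖T.starProjection v'‖ ≤ 1 / 4 * ‖p' - p‖ := by
    have h2 := h.base.norm_tangent_of_normal_le (p := p) hp' hv'
      (h.lip p hp p p' (by simpa using hr.le) (by linarith))
    refine h2.trans ?_
    rw [norm_sub_rev p p']
    have := h.L_le
    calc 2 * μ₀ * (L * ‖p' - p‖) * ‖v'‖ ≤ 2 * μ₀ * (L * ‖p' - p‖) * η := by
          have := h.L_nonneg; gcongr
      _ = (2 * μ₀ * L * η) * ‖p' - p‖ := by ring
      _ ≤ _ := by gcongr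
  have hℓz : ∀ y, ℓ y = ℓ (T.starProjection y) := fun y => by
    have := hD _ (T.sub_starProjection_mem_orthogonal y)
    rw [map_sub] at this; linarith
  have h3 : ℓ z = ℓ (p' - p) + ℓ (T.starProjection v') := by
    rw [hℓz z, hPz, map_add, ← hℓz]
  have h4 : -(1 / 4 * ‖ℓ‖ * ‖p' - p‖) ≤ ℓ (T.starProjection v') := by
    have h5 := (abs_le.1 (ℓ.le_opNorm (T.starProjection v'))).1
    have h6 : ‖ℓ‖ * ‖T.starProjection v'‖ ≤ ‖ℓ‖ * (1 / 4 * ‖p' - p‖) := by gcongr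
    linarith
  have h7 : ‖T.starProjection z‖ ^ 2 ≤ 4 * ‖p' - p‖ ^ 2 := by
    have h8 : ‖T.starProjection z‖ ≤ 2 * ‖p' - p‖ := by
      rw [hPz]
      refine (norm_add_le _ _).trans ?_
      have := T.norm_starProjection_apply_le (p' - p)
      have := norm_nonneg (p' - p)
      linarith
    nlinarith [norm_nonneg (T.starProjection z)]
  have h9 : 0 ≤ a / 4 * ‖z - T.starProjection z‖ ^ 2 := by positivity
  have h10 : C * ‖T.starProjection z‖ ^ 2 ≤ C * (4 * ‖p' - p‖ ^ 2) := by gcongr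
  linarith

theorem exists_normal_ne_zero (h : IsPLMin f₀ c₀ μ₀) (hd : 0 < d) (hp : f₀ p = c₀) :
    ∃ z ∈ (formKer (hess f₀ p))ᗮ, z ≠ 0 := by
  refine (Submodule.ne_bot_iff _).1 fun h0 => ?_
  have h1 := (formKer (hess f₀ p)).finrank_add_finrank_orthogonal
  rw [h0, finrank_bot] at h1
  have h2 := h.finrank_lt hd hp
  simp only [finrank_euclideanSpace, Fintype.card_fin] at h1
  omega

/-- Every normal disk along the minimizers of `f₀` contains a minimizer of `f`. -/
theorem exists_mem_disk (h : NearMin f₀ c₀ μ₀ f c μ a r Λ L η) (hd : 0 < d) (hp : f₀ p = c₀) :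
    ∃ v ∈ (formKer (hess f₀ p))ᗮ, ‖v‖ ≤ η ∧ f (p + v) = c := by
  have hr := h.r_pos
  obtain ⟨q, v, hq, hv, hvr, hmin, hmax⟩ := h.base.exists_max_min h.pert.contDiff.continuous hr.le
  have hvη : ‖v‖ ≤ η := h.small q hq v hv hvr (by
    simpa using hmin 0 (Submodule.zero_mem _) (by simpa using hr.le))
  have hηr := h.two_η_le
  have hη0 := h.η_nonneg
  have hD : ∀ z ∈ (formKer (hess f₀ q))ᗮ, fderiv ℝ f (q + v) z = 0 := fun z hz =>
    h.fderiv_normal_eq_zero (by linarith) hmin hv hz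
  set ℓ := fderiv ℝ f (q + v) with hℓ
  have hsec : ∀ p', f₀ p' = c₀ → ‖p' - q‖ ≤ r / 2 → ℓ (p' - q) ≤ 1 / 4 * ‖ℓ‖ * ‖p' - q‖ +
      2 * (Λ + 4 * Λ ^ 2 / a) * ‖p' - q‖ ^ 2 := fun p' hp' hpq => by
    obtain ⟨v', hv', hvr', hle, hle'⟩ := hmax p' hp'
    exact h.fderiv_secant_le hq hv hvη hD hp' hpq hv' (h.small p' hp' v' hv' hvr' hle) hle'
  -- The secant estimate along a curve of minimizers of `f₀`, divided by `s`, loses its quadratic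
  -- term as `s ↓ 0`. No differentiability of the disk minimum in its centre is needed.
  have htan : ∀ t ∈ formKer (hess f₀ q), ℓ t ≤ 1 / 4 * ‖ℓ‖ * ‖t‖ := fun t ht => by
    obtain ⟨γ, hγ0, hγ, hγc⟩ := h.base.exists_curve hq ht
    have h1 : Tendsto (fun s : ℝ => s⁻¹ • (γ s - q)) (𝓝[>] 0) (𝓝 t) := by
      have := hγ.tendsto_slope_zero_right
      simpa [hγ0] using this
    have h2 : Tendsto (fun s : ℝ => γ s - q) (𝓝[>] 0) (𝓝 0) := by
      have := (hγ.continuousAt.tendsto.sub_const q).mono_left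
        (nhdsWithin_le_nhds (s := Ioi (0 : ℝ)))
      simpa [hγ0] using this
    have h3 : Tendsto (fun s : ℝ => ℓ (s⁻¹ • (γ s - q))) (𝓝[>] 0) (𝓝 (ℓ t)) :=
      (ℓ.continuous.tendsto t).comp h1
    have h4 : Tendsto (fun s : ℝ => 1 / 4 * ‖ℓ‖ * ‖s⁻¹ • (γ s - q)‖ +
        2 * (Λ + 4 * Λ ^ 2 / a) * (‖s⁻¹ • (γ s - q)‖ * ‖γ s - q‖)) (𝓝[>] 0)
        (𝓝 (1 / 4 * ‖ℓ‖ * ‖t‖ + 2 * (Λ + 4 * Λ ^ 2 / a) * (‖t‖ * ‖(0 : EuclideanSpace ℝ (Fin d))‖)))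
        := (h1.norm.const_mul _).add ((h1.norm.mul h2.norm).const_mul _)
    rw [norm_zero, mul_zero, mul_zero, add_zero] at h4
    refine le_of_tendsto_of_tendsto h3 h4 ?_
    have h5 : ∀ᶠ s in 𝓝[>] (0 : ℝ), ‖γ s - q‖ < r / 2 :=
      h2.norm.eventually_lt_const (by simpa using hr)
    filter_upwards [h5, nhdsWithin_le_nhds hγc, self_mem_nhdsWithin] with s hs1 hs2 hs3
    have hs : 0 < s := hs3
    have h6 := mul_le_mul_of_nonneg_left (hsec (γ s) hs2 hs1.le) (inv_pos.2 hs).le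
    rw [map_smul, smul_eq_mul, norm_smul, Real.norm_eq_abs, abs_of_pos (inv_pos.2 hs)]
    linarith
  -- Since `ℓ` vanishes on normal vectors, the tangential estimate gives `‖ℓ‖ ≤ ‖ℓ‖ / 4`.
  have hℓ0 : ℓ = 0 := by
    have h1 : ‖ℓ‖ ≤ 1 / 4 * ‖ℓ‖ := by
      have key : ∀ y, ℓ y ≤ 1 / 4 * ‖ℓ‖ * ‖y‖ := fun y => by
        have h2 := hD _ ((formKer (hess f₀ q)).sub_starProjection_mem_orthogonal y)
        rw [map_sub] at h2
        have h3 := htan _ ((formKer (hess f₀ q)).starProjection_apply_mem y)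
        have h4 : 1 / 4 * ‖ℓ‖ * ‖(formKer (hess f₀ q)).starProjection y‖ ≤ 1 / 4 * ‖ℓ‖ * ‖y‖ := by
          gcongr; exact Submodule.norm_starProjection_apply_le _ _
        linarith
      refine ℓ.opNorm_le_bound (by positivity) fun y => abs_le.2 ⟨?_, key y⟩
      have := key (-y)
      rw [map_neg, norm_neg] at this
      linarith
    have := norm_nonneg ℓ
    exact norm_eq_zero.1 (by linarith)
  have hval : f (q + v) = c := by
    rcases h.pert.crit _ hℓ0 with h1 | h1
    · exact h1
    -- The other kind of critical point is a nondegenerate maximum, which is impossible where `f` is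
    -- convex in a nonzero normal direction.
    · exfalso
      obtain ⟨z, hz, hz0⟩ := exists_normal_ne_zero h.base hd hq
      have h2 := h.lower q hq (q + v) (by simp; linarith) z hz
      have h3 := h1 z hz0
      have := h.a_pos
      have : 0 ≤ a / 2 * ‖z‖ ^ 2 := by positivity
      linarith
  -- The largest of the disk minima equals `c`, so the minimum on any other disk is at most `c`,
  -- hence equal to `c`.
  obtain ⟨v', hv', hvr', hle, hle'⟩ := hmax p hp
  exact ⟨v', hv', h.small p hp v' hv' hvr' hle, le_antisymm (hle'.trans hval.le) (h.pert.le _)⟩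

end NearMin

end Perturbation

/-! ### A uniform lower bound for the Laplace integrals of perturbations -/

/-- The inverse map is Lipschitz, and volume is a multiple of Hausdorff measure. Neither `s` nor `φ`
has to be measurable, which matters because `φ` will come from a choice of minimizers. -/
theorem volume_le_of_forall_dist_le {k : ℕ} {s : Set (EuclideanSpace ℝ (Fin k))}
    {φ : EuclideanSpace ℝ (Fin k) → EuclideanSpace ℝ (Fin k)} {K : NNReal}
    (h : ∀ u ∈ s, ∀ u' ∈ s, dist u u' ≤ K * dist (φ u) (φ u')) :
    volume s ≤ (K : ENNReal) ^ k * volume (φ '' s) := by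
  have hinj : InjOn φ s := fun u hu u' hu' he => by
    have := h u hu u' hu'
    rw [he, dist_self, mul_zero] at this
    exact dist_le_zero.1 this
  have hinv : LipschitzOnWith K (Function.invFunOn φ s) (φ '' s) := by
    refine LipschitzOnWith.of_dist_le_mul ?_
    rintro _ ⟨u, hu, rfl⟩ _ ⟨u', hu', rfl⟩
    rw [hinj.leftInvOn_invFunOn hu, hinj.leftInvOn_invFunOn hu']
    exact h u hu u' hu'
  have himg : Function.invFunOn φ s '' (φ '' s) = s := hinj.leftInvOn_invFunOn.image_image
  have hH : (Measure.hausdorffMeasure k : Measure (EuclideanSpace ℝ (Fin k))).IsAddHaarMeasure := by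
    have := isAddHaarMeasure_hausdorffMeasure (E := EuclideanSpace ℝ (Fin k))
    rwa [finrank_euclideanSpace, Fintype.card_fin] at this
  have hle := hinv.hausdorffMeasure_image_le (d := (k : ℝ)) (Nat.cast_nonneg k)
  rw [himg, ENNReal.rpow_natCast] at hle
  rw [Measure.isAddLeftInvariant_eq_smul (volume : Measure (EuclideanSpace ℝ (Fin k)))
    (Measure.hausdorffMeasure k), Measure.smul_apply, Measure.smul_apply]
  refine (smul_le_smul_of_nonneg_left hle (zero_le)).trans_eq ?_
  rw [mul_smul_comm]

section Perturbation

variable {k n d : ℕ}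

theorem starProjection_eq {F : OrthFrame k n d}
    {H : EuclideanSpace ℝ (Fin d) →L[ℝ] EuclideanSpace ℝ (Fin d) →L[ℝ] ℝ}
    (hF : ∀ y, H y = 0 ↔ F.J' y = 0) (z : EuclideanSpace ℝ (Fin d)) :
    (formKer H).starProjection z = F.I (F.I' z) := by
  refine (Submodule.eq_starProjection_of_mem_orthogonal ?_ ?_)
  · exact mem_formKer.2 ((hF _).2 (F.J'_I _))
  · rw [Submodule.mem_orthogonal]
    intro y hy
    have h1 : z - F.I (F.I' z) = F.J (F.J' z) := by
      conv_lhs => rw [← F.sum_eq z]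
      simp [F.I'_I, F.I'_J]
    rw [h1, real_inner_comm, F.inner_J, (hF y).1 (mem_formKer.1 hy), inner_zero_right]

theorem J_mem_orthogonal {F : OrthFrame k n d}
    {H : EuclideanSpace ℝ (Fin d) →L[ℝ] EuclideanSpace ℝ (Fin d) →L[ℝ] ℝ}
    (hF : ∀ y, H y = 0 ↔ F.J' y = 0) (v : EuclideanSpace ℝ (Fin n)) :
    F.J v ∈ (formKer H)ᗮ := by
  rw [Submodule.mem_orthogonal]
  intro y hy
  rw [real_inner_comm, F.inner_J, (hF y).1 (mem_formKer.1 hy), inner_zero_right]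

namespace NearMin

variable {f₀ f : EuclideanSpace ℝ (Fin d) → ℝ} {c₀ μ₀ c μ a r Λ L η : ℝ}
  {p q : EuclideanSpace ℝ (Fin d)}

/-- Short normal vectors at either end are nearly orthogonal to the secant: each contributes at most
`‖q - p‖² / 4` to the inner product of the two differences, leaving half of `‖q - p‖²`. So points
picked in normal disks spread out as much as the centres do. -/
theorem norm_secant_le (h : NearMin f₀ c₀ μ₀ f c μ a r Λ L η) (hp : f₀ p = c₀) (hq : f₀ q = c₀)
    (hpq : ‖q - p‖ ≤ r) {v v' : EuclideanSpace ℝ (Fin d)} (hv : v ∈ (formKer (hess f₀ p))ᗮ)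
    (hv' : v' ∈ (formKer (hess f₀ q))ᗮ) (hvη : ‖v‖ ≤ η) (hvη' : ‖v'‖ ≤ η) :
    ‖q - p‖ ≤ 2 * ‖(q + v') - (p + v)‖ := by
  have hμ := h.base.pos
  have hr := h.r_pos
  have key : ∀ p q v : EuclideanSpace ℝ (Fin d), f₀ p = c₀ → f₀ q = c₀ → ‖q - p‖ ≤ r →
      v ∈ (formKer (hess f₀ p))ᗮ → ‖v‖ ≤ η → |inner ℝ (q - p) v| ≤ 1 / 4 * ‖q - p‖ ^ 2 := by
    intro p q v hp hq hpq hv hvη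
    have h1 := h.base.inner_secant_normal_le hp hq hv (ℓ := L * ‖q - p‖)
      (convex_closedBall p ‖q - p‖) (Metric.mem_closedBall_self (norm_nonneg _))
      (by simp [dist_eq_norm]) fun y hy => by
        have hy' : ‖y - p‖ ≤ ‖q - p‖ := by simpa [dist_eq_norm] using hy
        have := h.L_nonneg
        exact (h.lip p hp y p (hy'.trans hpq) (by simpa using hr.le)).trans (by gcongr)
    refine h1.trans ?_
    have h2 := h.L_le
    have h3 := h.L_nonneg
    calc 2 * μ₀ * (L * ‖q - p‖) * ‖q - p‖ * ‖v‖
        ≤ 2 * μ₀ * (L * ‖q - p‖) * ‖q - p‖ * η := by gcongr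
      _ = (2 * μ₀ * L * η) * ‖q - p‖ ^ 2 := by ring
      _ ≤ _ := by gcongr
  have h1 := key p q v hp hq hpq hv hvη
  have h2 := key q p v' hq hp (by rwa [norm_sub_rev]) hv' hvη'
  rw [← neg_sub q p, inner_neg_left, abs_neg, norm_neg] at h2
  have h3 : inner ℝ (q - p) ((q + v') - (p + v)) =
      ‖q - p‖ ^ 2 + inner ℝ (q - p) v' - inner ℝ (q - p) v := by
    rw [← real_inner_self_eq_norm_sq, ← inner_add_right, ← inner_sub_right]
    congr 1; abel
  have h4 := real_inner_le_norm (q - p) ((q + v') - (p + v))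
  rw [h3] at h4
  have h5 := (abs_le.1 h1).2
  have h6 := (abs_le.1 h2).1
  rcases (norm_nonneg (q - p)).eq_or_lt with h0 | h0
  · rw [← h0]; positivity
  · refine le_of_mul_le_mul_left ?_ h0
    nlinarith

/-- Between two minimizers of `f` the first-order term and the difference of values vanish in
`taylor_lower`, so the normal part of the secant is controlled by the tangent part: the minimizers
lie on a Lipschitz graph over the tangent space at `p`. -/
theorem norm_sub_le_of_mem (h : NearMin f₀ c₀ μ₀ f c μ a r Λ L η) (hp : f₀ p = c₀)
    {F : OrthFrame k n d} (hF : ∀ y, hess f₀ p y = 0 ↔ F.J' y = 0)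
    {x x' : EuclideanSpace ℝ (Fin d)} (hx : f x = c) (hx' : f x' = c) (hxp : ‖x - p‖ ≤ r)
    (hxp' : ‖x' - p‖ ≤ r) :
    ‖x' - x‖ ≤ √(1 + 4 * (Λ + 4 * Λ ^ 2 / a) / a) * ‖F.I' x' - F.I' x‖ := by
  have ha := h.a_pos
  have h1 := h.taylor_lower hp hxp (z := x' - x) (by rwa [add_sub_cancel])
  rw [add_sub_cancel, hx, hx', h.pert.fderiv_eq_zero hx, starProjection_eq hF, F.norm_I] at h1
  simp only [zero_apply] at h1
  set z := x' - x with hz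
  have h2 : z - F.I (F.I' z) = F.J (F.J' z) := by
    conv_lhs => rw [← F.sum_eq z]
    simp [F.I'_I, F.I'_J]
  rw [h2, F.norm_J] at h1
  have h3 := F.norm_sq z
  rw [← map_sub, ← hz]
  set C := Λ + 4 * Λ ^ 2 / a with hC
  have h4 : ‖F.J' z‖ ^ 2 ≤ 4 * C / a * ‖F.I' z‖ ^ 2 := by
    rw [div_mul_eq_mul_div, le_div_iff₀ ha]; linarith
  rw [← Real.sqrt_sq (norm_nonneg (F.I' z)), ← Real.sqrt_mul' _ (sq_nonneg _)]
  refine Real.le_sqrt_of_sq_le ?_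
  linarith

/-- Within distance `σ` of a minimizer, `f - c ≤ Λ σ² / 2`, so the integrand is at least `exp
(-Λ/2)`. Each point of the projected set of minimizers thus contributes a fibre ball of radius `σ`.
-/
theorem lintegral_lower (h : NearMin f₀ c₀ μ₀ f c μ a r Λ L η) (hp : f₀ p = c₀)
    (F : OrthFrame k n d) {σ : ℝ} (hσ : 0 < σ) (hσr : σ ≤ r / 4) :
    ENNReal.ofReal (Real.exp (-(Λ / 2))) *
      (ENNReal.ofReal (σ ^ n) * volume (Metric.closedBall (0 : EuclideanSpace ℝ (Fin n)) 1)) *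
      volume (F.I' '' ({x | f x = c} ∩ Metric.closedBall p (3 * r / 4))) ≤
      ∫⁻ x, ENNReal.ofReal (Real.exp (-(f x - c) / σ ^ 2)) := by
  have hfc := h.pert.contDiff.continuous
  have hQ : MeasurableSet (F.I' '' ({x | f x = c} ∩ Metric.closedBall p (3 * r / 4))) :=
    ((h.pert.isCompact.inter_right Metric.isClosed_closedBall).image
      F.I'.continuous).isClosed.measurableSet
  have hmeas : Measurable fun x => ENNReal.ofReal (Real.exp (-(f x - c) / σ ^ 2)) := by fun_prop
  rw [F.lintegral_eq hmeas, ← setLIntegral_const]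
  refine le_trans ?_ (setLIntegral_le_lintegral
    (F.I' '' ({x | f x = c} ∩ Metric.closedBall p (3 * r / 4))) _)
  refine setLIntegral_mono' hQ ?_
  rintro _ ⟨x, ⟨hx, hxp⟩, rfl⟩
  rw [mem_closedBall_iff_norm] at hxp
  refine le_trans ?_ (setLIntegral_le_lintegral (Metric.closedBall (F.J' x) σ) _)
  have hvol := Measure.addHaar_closedBall' volume (F.J' x) hσ.le
  rw [finrank_euclideanSpace, Fintype.card_fin] at hvol
  rw [← hvol, ← setLIntegral_const]
  refine setLIntegral_mono' measurableSet_closedBall fun v hv => ?_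
  rw [mem_closedBall_iff_norm] at hv
  refine ENNReal.ofReal_le_ofReal (Real.exp_le_exp.2 ?_)
  have hy : F.I (F.I' x) + F.J v = x + F.J (v - F.J' x) := by
    conv_rhs => rw [← F.sum_eq x]
    simp [F.J'_I, F.J'_J]
  rw [hy]
  set z := F.J (v - F.J' x) with hz
  have hzn : ‖z‖ ≤ σ := by rw [hz, F.norm_J]; exact hv
  have h1 := taylor_two_upper h.pert.contDiff (x := x) (z := z) (m := Λ * ‖z‖ ^ 2) fun ξ hξ => by
    have h2 : ‖x + ξ • z - p‖ ≤ r := by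
      calc ‖x + ξ • z - p‖ = ‖(x - p) + ξ • z‖ := by congr 1; abel
        _ ≤ ‖x - p‖ + ‖ξ • z‖ := norm_add_le _ _
        _ ≤ 3 * r / 4 + ‖z‖ := by
          rw [norm_smul, Real.norm_eq_abs, abs_of_pos hξ.1]
          exact add_le_add hxp (mul_le_of_le_one_left (norm_nonneg _) hξ.2.le)
        _ ≤ r := by linarith
    refine (hess_apply_le _ _ _).trans ?_
    rw [mul_assoc, ← sq]
    have := h.upper p hp _ h2
    gcongr
  rw [show f x = c from hx, h.pert.fderiv_eq_zero hx] at h1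
  simp only [zero_apply, add_zero] at h1
  have hΛ : 0 ≤ Λ := (norm_nonneg _).trans (h.upper p hp p (by simpa using h.r_pos.le))
  have h3 : Λ * ‖z‖ ^ 2 ≤ Λ * σ ^ 2 := by gcongr
  rw [neg_div, neg_le_neg_iff, div_le_iff₀ (by positivity)]
  linarith

end NearMin

/-- It remains to bound below the volume of the projected set of minimizers in `lintegral_lower`.
Over a chart of `f₀`, pick a minimizer of `f` in each normal disk and project to the tangent space
at `p₀`; `norm_secant_le` and `norm_sub_le_of_mem` show that this map contracts distances at most by
the factor `2K`. -/
theorem IsPLMin.exists_integral_lower {f₀ : EuclideanSpace ℝ (Fin d) → ℝ} {c₀ μ₀ : ℝ}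
    (h₀ : IsPLMin f₀ c₀ μ₀) (hd : 0 < d)
    (hk : ∀ x, f₀ x = c₀ → Module.finrank ℝ (formKer (hess f₀ x)) = k) (hkn : k + n = d)
    {a r : ℝ} (hr : 0 < r) (ha : 0 < a) (Λ : ℝ) (hΛ : 0 ≤ Λ) :
    ∃ m > 0, ∀ f c μ L η, NearMin f₀ c₀ μ₀ f c μ a r Λ L η → ∀ σ : ℝ, 0 < σ → σ ≤ r / 4 →
      m * σ ^ n ≤ ∫ x, Real.exp (-(f x - c) / σ ^ 2) := by
  obtain ⟨p₀, hp₀⟩ := h₀.nonempty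
  obtain ⟨F, hF, hF2⟩ := h₀.exists_frame hp₀ (hk p₀ hp₀) hkn
  obtain ⟨ρ, r', a', w, C, hC⟩ := h₀.exists_minChart hp₀ F (h₀.pos_of_lower hF2) (hk p₀ hp₀)
  have hcont : ContinuousAt (graphMap F w) (F.I' p₀) :=
    (contDiffOn_graphMap C.contDiffOn).continuousOn.continuousAt (Metric.ball_mem_nhds _ C.ρ_pos)
  have hev : ∀ᶠ u in 𝓝 (F.I' p₀), graphMap F w u ∈ Metric.ball p₀ (r / 4) ∧
      u ∈ Metric.ball (F.I' p₀) ρ :=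
    (hcont.eventually_mem (by rw [hC]; exact Metric.ball_mem_nhds _ (by positivity))).and
      (Metric.ball_mem_nhds _ C.ρ_pos)
  obtain ⟨ρ₁, hρ₁, hb⟩ := Metric.eventually_nhds_iff_ball.1 hev
  set K := √(1 + 4 * (Λ + 4 * Λ ^ 2 / a) / a) with hK
  have hKpos : 0 < K := Real.sqrt_pos.2 (by positivity)
  set B := Metric.ball (F.I' p₀) ρ₁ with hB
  set b := (volume (Metric.closedBall (0 : EuclideanSpace ℝ (Fin n)) 1)).toReal with hbdef
  have hbpos : 0 < b := ENNReal.toReal_pos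
    (Metric.measure_closedBall_pos volume _ one_pos).ne' measure_closedBall_lt_top.ne
  have hBpos : 0 < (volume B).toReal :=
    ENNReal.toReal_pos (Metric.measure_ball_pos volume _ hρ₁).ne' measure_ball_lt_top.ne
  refine ⟨Real.exp (-(Λ / 2)) * b * ((volume B).toReal / (2 * K) ^ k), by positivity, ?_⟩
  intro f c μ L η h σ hσ hσr
  choose! V hVn hVη hVc using fun p (hp : f₀ p = c₀) => h.exists_mem_disk hd hp
  set ψ := graphMap F w with hψ
  set φ : EuclideanSpace ℝ (Fin k) → EuclideanSpace ℝ (Fin k) :=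
    fun u => F.I' (ψ u + V (ψ u)) with hφ
  have hη := h.two_η_le
  have hψc : ∀ u ∈ B, f₀ (ψ u) = c₀ := fun u hu => C.mem u (hb u hu).2
  have hψn : ∀ u ∈ B, ‖ψ u - p₀‖ < r / 4 := fun u hu => by
    have := (hb u hu).1
    rwa [mem_ball_iff_norm] at this
  have hxn : ∀ u ∈ B, ‖ψ u + V (ψ u) - p₀‖ ≤ 3 * r / 4 := fun u hu => by
    calc ‖ψ u + V (ψ u) - p₀‖ = ‖(ψ u - p₀) + V (ψ u)‖ := by congr 1; abel
      _ ≤ ‖ψ u - p₀‖ + ‖V (ψ u)‖ := norm_add_le _ _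
      _ ≤ 3 * r / 4 := by linarith [hψn u hu, hVη _ (hψc u hu)]
  have hanti : ∀ u ∈ B, ∀ u' ∈ B, dist u u' ≤ (2 * K).toNNReal * dist (φ u) (φ u') := by
    intro u hu u' hu'
    rw [Real.coe_toNNReal _ (by positivity), dist_eq_norm, dist_eq_norm]
    have h1 : ‖u - u'‖ ≤ ‖ψ u - ψ u'‖ := by
      have := F.norm_I'_le (ψ u - ψ u')
      rwa [map_sub, I'_graphMap, I'_graphMap] at this
    have h2 := h.norm_secant_le (hψc u' hu') (hψc u hu) (by
      calc ‖ψ u - ψ u'‖ = ‖(ψ u - p₀) - (ψ u' - p₀)‖ := by congr 1; abel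
        _ ≤ ‖ψ u - p₀‖ + ‖ψ u' - p₀‖ := norm_sub_le _ _
        _ ≤ r := by linarith [hψn u hu, hψn u' hu']) (hVn _ (hψc u' hu')) (hVn _ (hψc u hu))
      (hVη _ (hψc u' hu')) (hVη _ (hψc u hu))
    have h3 := h.norm_sub_le_of_mem hp₀ hF (hVc _ (hψc u' hu')) (hVc _ (hψc u hu))
      ((hxn u' hu').trans (by linarith)) ((hxn u hu).trans (by linarith))
    linarith
  have hvol := volume_le_of_forall_dist_le hanti
  have hsub : φ '' B ⊆ F.I' '' ({x | f x = c} ∩ Metric.closedBall p₀ (3 * r / 4)) := by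
    rintro _ ⟨u, hu, rfl⟩
    exact ⟨_, ⟨hVc _ (hψc u hu), mem_closedBall_iff_norm.2 (hxn u hu)⟩, rfl⟩
  have hlow := h.lintegral_lower hp₀ F hσ hσr
  have hint := h.pert.integrable_exp (lam := σ ^ 2) (by positivity)
  rw [← ofReal_integral_eq_lintegral_ofReal hint (Eventually.of_forall fun x => by positivity)]
    at hlow
  set Q := F.I' '' ({x | f x = c} ∩ Metric.closedBall p₀ (3 * r / 4)) with hQ
  have hQfin : volume Q ≠ ⊤ :=
    ((h.pert.isCompact.inter_right Metric.isClosed_closedBall).image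
      F.I'.continuous).measure_lt_top.ne
  have h1 := ENNReal.toReal_mono ENNReal.ofReal_ne_top hlow
  rw [ENNReal.toReal_ofReal (by positivity), ENNReal.toReal_mul, ENNReal.toReal_mul,
    ENNReal.toReal_mul, ENNReal.toReal_ofReal (by positivity), ENNReal.toReal_ofReal (by positivity),
    ← hbdef] at h1
  have h2 : (volume B).toReal ≤ (2 * K) ^ k * (volume Q).toReal := by
    have := ENNReal.toReal_mono (ENNReal.mul_ne_top (by simp) hQfin)
      (hvol.trans (mul_le_mul_right (measure_mono hsub) _))
    rw [ENNReal.toReal_mul, ENNReal.toReal_pow, ENNReal.coe_toReal,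
      Real.coe_toNNReal _ (by positivity)] at this
    exact this
  have h3 : (volume B).toReal / (2 * K) ^ k ≤ (volume Q).toReal := by
    rw [div_le_iff₀ (by positivity)]; linarith
  calc _ = Real.exp (-(Λ / 2)) * (σ ^ n * b) * ((volume B).toReal / (2 * K) ^ k) := by ring
    _ ≤ Real.exp (-(Λ / 2)) * (σ ^ n * b) * (volume Q).toReal := by gcongr
    _ ≤ _ := h1

end Perturbation

/-! ### A uniform upper bound for the Laplace integrals of perturbations -/

section Perturbation

variable {k n d : ℕ}

namespace NearMin

variable {f₀ f : EuclideanSpace ℝ (Fin d) → ℝ} {c₀ μ₀ c μ a r Λ L η : ℝ}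
  {p q : EuclideanSpace ℝ (Fin d)}

/-- On a fibre disk `f` is uniformly convex and at least `c`, so it grows quadratically away from
its minimum `v₀` on the disk. -/
theorem exists_fiber_lower (h : NearMin f₀ c₀ μ₀ f c μ a r Λ L η) (hp : f₀ p = c₀)
    {F : OrthFrame k n d} (hF : ∀ y, hess f₀ p y = 0 ↔ F.J' y = 0)
    {u : EuclideanSpace ℝ (Fin k)} (hu : ‖u - F.I' p‖ ≤ r / 2) :
    ∃ v₀, ∀ v, ‖v - F.J' p‖ ≤ r / 2 → a / 8 * ‖v - v₀‖ ^ 2 ≤ f (F.I u + F.J v) - c := by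
  have hr := h.r_pos
  have hfc := h.pert.contDiff.continuous
  obtain ⟨v₀, hv₀, hmin⟩ := (isCompact_closedBall (F.J' p) (r / 2)).exists_isMinOn
    ⟨F.J' p, Metric.mem_closedBall_self (by positivity)⟩ (f := fun v => f (F.I u + F.J v))
    (by fun_prop)
  refine ⟨v₀, fun v hv => ?_⟩
  have hv' : v ∈ Metric.closedBall (F.J' p) (r / 2) := mem_closedBall_iff_norm.2 hv
  have hconv := convex_closedBall (F.J' p) (r / 2)
  set e : EuclideanSpace ℝ (Fin n) := (1 / 2 : ℝ) • (v - v₀) with he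
  -- Expanding at the midpoint in the directions `e` and `-e` cancels the first-order term, so no
  -- optimality condition at `v₀` is needed, even if `v₀` lies on the boundary of the disk.
  set mid := v₀ + e with hmid
  have hm1 : mid + e = v := by rw [hmid, he]; module
  have hm2 : mid + -e = v₀ := by rw [hmid]; abel
  have hmB : mid ∈ Metric.closedBall (F.J' p) (r / 2) := by
    have h1 : v₀ + (v - v₀) ∈ Metric.closedBall (F.J' p) (r / 2) := by rwa [add_sub_cancel]
    exact add_smul_mem_of_convex hconv hv₀ h1 ⟨by norm_num, by norm_num⟩
  have key : ∀ e', mid + e' ∈ Metric.closedBall (F.J' p) (r / 2) →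
      f (F.I u + F.J mid) + fderiv ℝ f (F.I u + F.J mid) (F.J e') + a / 2 * ‖e'‖ ^ 2 / 2 ≤
        f (F.I u + F.J (mid + e')) := by
    intro e' he'
    have h1 := taylor_two_lower h.pert.contDiff (x := F.I u + F.J mid) (z := F.J e')
      (m := a / 2 * ‖e'‖ ^ 2) fun ξ hξ => by
        have h2 : mid + ξ • e' ∈ Metric.closedBall (F.J' p) (r / 2) :=
          add_smul_mem_of_convex hconv hmB he' hξ
        rw [mem_closedBall_iff_norm] at h2
        have h3 : ‖F.I u + F.J mid + ξ • F.J e' - p‖ ≤ r := by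
          have h4 : F.I u + F.J mid + ξ • F.J e' - p =
              F.I (u - F.I' p) + F.J (mid + ξ • e' - F.J' p) := by
            conv_lhs => rw [← F.sum_eq p]
            simp only [map_add, map_sub, map_smul]; abel
          rw [h4]
          refine (norm_add_le _ _).trans ?_
          rw [F.norm_I, F.norm_J]; linarith
        have h5 := h.lower p hp _ h3 _ (J_mem_orthogonal hF e')
        rwa [F.norm_J] at h5
    rwa [add_assoc (F.I u), ← map_add] at h1
  have h1 := key e (by rwa [hm1])
  have h2 := key (-e) (by rwa [hm2])
  rw [hm1] at h1
  rw [hm2, map_neg, map_neg, norm_neg] at h2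
  have h3 : f (F.I u + F.J v₀) ≤ f (F.I u + F.J mid) := hmin hmB
  have h4 := h.pert.le (F.I u + F.J v₀)
  have h5 : ‖e‖ ^ 2 = 1 / 4 * ‖v - v₀‖ ^ 2 := by
    rw [he, norm_smul, mul_pow]; norm_num
  rw [h5] at h1 h2
  linarith

theorem lintegral_fiber_upper (h : NearMin f₀ c₀ μ₀ f c μ a r Λ L η) (hp : f₀ p = c₀)
    {F : OrthFrame k n d} (hF : ∀ y, hess f₀ p y = 0 ↔ F.J' y = 0)
    {u : EuclideanSpace ℝ (Fin k)} (hu : ‖u - F.I' p‖ ≤ r / 2) {σ : ℝ} (hσ : 0 < σ) :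
    ∫⁻ v in Metric.closedBall (F.J' p) (r / 2),
        ENNReal.ofReal (Real.exp (-(f (F.I u + F.J v) - c) / σ ^ 2)) ≤
      ENNReal.ofReal (σ ^ n *
        ∫ s : EuclideanSpace ℝ (Fin n), Real.exp (-(a / 8) * ‖s‖ ^ 2)) := by
  have ha := h.a_pos
  obtain ⟨v₀, hv₀⟩ := h.exists_fiber_lower hp hF hu
  set φ : EuclideanSpace ℝ (Fin n) → ℝ := fun v => Real.exp (-(a / 8) * ‖v - v₀‖ ^ 2 / σ ^ 2)
    with hφ
  have h1 := integral_comp_add_smul φ v₀ hσ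
  have h2 : ∀ s, φ (v₀ + σ • s) = Real.exp (-(a / 8) * ‖s‖ ^ 2) := fun s => by
    simp only [hφ]
    rw [add_sub_cancel_left, norm_smul, mul_pow, Real.norm_eq_abs, sq_abs]
    congr 1; field_simp
  simp_rw [h2] at h1
  rw [inv_mul_eq_iff_eq_mul₀ (by positivity)] at h1
  have hint : Integrable φ := by
    refine Integrable.of_integral_ne_zero ?_
    rw [h1]
    have := MeasureTheory.integral_exp_pos
      (integrable_exp_neg_mul_norm_sq (n := n) (b := a / 8) (by positivity))
    positivity
  rw [← h1, ofReal_integral_eq_lintegral_ofReal hint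
    (Eventually.of_forall fun x => (Real.exp_pos _).le)]
  refine le_trans (setLIntegral_mono' measurableSet_closedBall fun v hv => ?_)
    (setLIntegral_le_lintegral _ _)
  refine ENNReal.ofReal_le_ofReal (Real.exp_le_exp.2 ?_)
  have h3 := hv₀ v (by rwa [mem_closedBall_iff_norm] at hv)
  gcongr
  linarith

theorem setLIntegral_ball_upper (h : NearMin f₀ c₀ μ₀ f c μ a r Λ L η) (hp : f₀ p = c₀)
    {F : OrthFrame k n d} (hF : ∀ y, hess f₀ p y = 0 ↔ F.J' y = 0) {σ : ℝ} (hσ : 0 < σ) :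
    ∫⁻ x in Metric.ball p (r / 2), ENNReal.ofReal (Real.exp (-(f x - c) / σ ^ 2)) ≤
      ENNReal.ofReal (σ ^ n *
        ∫ s : EuclideanSpace ℝ (Fin n), Real.exp (-(a / 8) * ‖s‖ ^ 2)) *
        volume (Metric.closedBall (0 : EuclideanSpace ℝ (Fin k)) (r / 2)) := by
  have hfc := h.pert.contDiff.continuous
  have hmeas : Measurable fun x => ENNReal.ofReal (Real.exp (-(f x - c) / σ ^ 2)) := by fun_prop
  rw [← lintegral_indicator measurableSet_ball, F.lintegral_eq (hmeas.indicator measurableSet_ball),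
    ← Measure.addHaar_closedBall_center volume (F.I' p), ← setLIntegral_const,
    ← lintegral_indicator measurableSet_closedBall]
  refine lintegral_mono fun u => ?_
  have hmem : ∀ v, F.I u + F.J v ∈ Metric.ball p (r / 2) →
      ‖u - F.I' p‖ ≤ r / 2 ∧ ‖v - F.J' p‖ ≤ r / 2 := fun v hv => by
    rw [mem_ball_iff_norm] at hv
    have h1 := F.norm_I'_le (F.I u + F.J v - p)
    have h2 := F.norm_J'_le (F.I u + F.J v - p)
    simp only [map_sub, map_add, F.I'_I, F.I'_J, F.J'_I, F.J'_J, add_zero, zero_add] at h1 h2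
    exact ⟨by linarith, by linarith⟩
  by_cases hu : u ∈ Metric.closedBall (F.I' p) (r / 2)
  · rw [indicator_of_mem hu]
    rw [mem_closedBall_iff_norm] at hu
    refine le_trans ?_ (h.lintegral_fiber_upper hp hF hu hσ)
    rw [← lintegral_indicator measurableSet_closedBall]
    refine lintegral_mono fun v => ?_
    by_cases hv : F.I u + F.J v ∈ Metric.ball p (r / 2)
    · rw [indicator_of_mem hv, indicator_of_mem (mem_closedBall_iff_norm.2 (hmem v hv).2)]
    · rw [indicator_of_notMem hv]; exact zero_le
  · rw [indicator_of_notMem hu]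
    refine le_of_eq ?_
    rw [← lintegral_zero (μ := (volume : Measure (EuclideanSpace ℝ (Fin n))))]
    congr 1
    ext1 v
    refine indicator_of_notMem (fun hv => hu (mem_closedBall_iff_norm.2 (hmem v hv).1)) _

end NearMin

/-- Finitely many balls centred at minimizers of `f₀` cover the neighbourhood, and their number does
not depend on `f`. In each ball every fibre contributes at most a Gaussian integral of width `σ`. -/
theorem IsPLMin.exists_integral_upper {f₀ : EuclideanSpace ℝ (Fin d) → ℝ} {c₀ μ₀ : ℝ}
    (h₀ : IsPLMin f₀ c₀ μ₀)
    (hk : ∀ x, f₀ x = c₀ → Module.finrank ℝ (formKer (hess f₀ x)) = k) (hkn : k + n = d)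
    {a r : ℝ} (hr : 0 < r) :
    ∃ m, ∀ f c μ Λ L η, NearMin f₀ c₀ μ₀ f c μ a r Λ L η → ∀ σ : ℝ, 0 < σ →
      ∫ x in Metric.thickening (r / 4) {x | f₀ x = c₀}, Real.exp (-(f x - c) / σ ^ 2) ≤
        m * σ ^ n := by
  obtain ⟨t, htS, htfin, ht⟩ := h₀.isCompact.finite_cover_balls (e := r / 4) (by positivity)
  set G := ∫ s : EuclideanSpace ℝ (Fin n), Real.exp (-(a / 8) * ‖s‖ ^ 2) with hG
  set b := volume (Metric.closedBall (0 : EuclideanSpace ℝ (Fin k)) (r / 2)) with hb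
  have hG0 : 0 ≤ G := integral_nonneg fun _ => (Real.exp_pos _).le
  have hbfin : b ≠ ⊤ := measure_closedBall_lt_top.ne
  refine ⟨htfin.toFinset.card * (G * b.toReal), fun f c μ Λ L η h σ hσ => ?_⟩
  have hfc := h.pert.contDiff.continuous
  set V := Metric.thickening (r / 4) {x | f₀ x = c₀} with hV
  set ν := (volume : Measure (EuclideanSpace ℝ (Fin d))).withDensity
    fun x => ENNReal.ofReal (Real.exp (-(f x - c) / σ ^ 2)) with hν
  have hsub : V ⊆ ⋃ p ∈ htfin.toFinset, Metric.ball p (r / 2) := by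
    intro x hx
    obtain ⟨y, hy, hxy⟩ := Metric.mem_thickening_iff.1 hx
    obtain ⟨p, hp, hyp⟩ := mem_iUnion₂.1 (ht hy)
    refine mem_iUnion₂.2 ⟨p, by simpa using hp, ?_⟩
    rw [Metric.mem_ball] at hyp ⊢
    linarith [dist_triangle x y p]
  have h1 : ν V ≤ ∑ p ∈ htfin.toFinset, ENNReal.ofReal (σ ^ n * G) * b := by
    refine (measure_mono hsub).trans ((measure_biUnion_finset_le _ _).trans ?_)
    refine Finset.sum_le_sum fun p hp => ?_
    have hpS : f₀ p = c₀ := htS (by simpa using hp)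
    obtain ⟨F, hF, _⟩ := h₀.exists_frame hpS (hk p hpS) hkn
    rw [hν, withDensity_apply _ measurableSet_ball]
    exact h.setLIntegral_ball_upper hpS hF hσ
  rw [Finset.sum_const, nsmul_eq_mul] at h1
  have hVm : MeasurableSet V := Metric.isOpen_thickening.measurableSet
  rw [hν, withDensity_apply _ hVm, ← ofReal_integral_eq_lintegral_ofReal
    (h.pert.integrable_exp (by positivity)).integrableOn
    (Eventually.of_forall fun x => (Real.exp_pos _).le)] at h1
  have h2 := ENNReal.toReal_mono (by finiteness) h1
  rw [ENNReal.toReal_ofReal (integral_nonneg fun _ => (Real.exp_pos _).le), ENNReal.toReal_mul,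
    ENNReal.toReal_mul, ENNReal.toReal_ofReal (by positivity), ENNReal.toReal_natCast] at h2
  refine h2.trans_eq ?_
  ring

end Perturbation

/-! ### Uniform bounds for the limiting density -/

section Perturbation

variable {k n d : ℕ}

namespace NearMin

variable {f₀ f : EuclideanSpace ℝ (Fin d) → ℝ} {c₀ μ₀ c μ a r Λ L η : ℝ}
  {x : EuclideanSpace ℝ (Fin d)}

theorem exists_frame_lower (h : NearMin f₀ c₀ μ₀ f c μ a r Λ L η)
    (hk : ∀ x, f₀ x = c₀ → Module.finrank ℝ (formKer (hess f₀ x)) = k) (hkn : k + n = d)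
    (hx : f x = c) :
    ∃ F : OrthFrame k n d, (∀ v, a / 2 * ‖v‖ ^ 2 ≤ hess f x (F.J v) (F.J v)) ∧
      ‖hess f x‖ ≤ Λ := by
  have hr := h.r_pos
  obtain ⟨p, hp, hxp⟩ := Metric.mem_thickening_iff.1 (h.subset hx)
  have hpS : f₀ p = c₀ := hp
  have hxp' : ‖x - p‖ ≤ r := by rw [← dist_eq_norm]; linarith
  obtain ⟨F, hF, _⟩ := h.base.exists_frame hpS (hk p hpS) hkn
  refine ⟨F, fun v => ?_, h.upper p hpS x hxp'⟩
  have := h.lower p hpS x hxp' _ (J_mem_orthogonal hF v)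
  rwa [F.norm_J] at this

theorem finrank_le (h : NearMin f₀ c₀ μ₀ f c μ a r Λ L η)
    (hk : ∀ x, f₀ x = c₀ → Module.finrank ℝ (formKer (hess f₀ x)) = k) (hkn : k + n = d)
    (hx : f x = c) : Module.finrank ℝ (formKer (hess f x)) ≤ k := by
  have ha := h.a_pos
  obtain ⟨F, hF, _⟩ := h.exists_frame_lower hk hkn hx
  refine finrank_ker_le F fun v hv => lt_of_lt_of_le ?_ (hF v)
  have := norm_pos_iff.2 hv
  positivity

end NearMin

theorem tendsto_integral_exp {f : EuclideanSpace ℝ (Fin d) → ℝ} {c μ : ℝ} (h : IsPLMin f c μ)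
    (hk : ∀ x, f x = c → Module.finrank ℝ (formKer (hess f x)) = k) (hkn : k + n = d)
    {M : Measure (EuclideanSpace ℝ (Fin d))} (hM : IsRiemannianVolume k {x | f x = c} M) :
    Tendsto (fun σ : ℝ => (σ ^ n)⁻¹ * ∫ x, Real.exp (-(f x - c) / σ ^ 2)) (𝓝[>] 0)
      (𝓝 (gaussConst n *
        ∫ x in {x | f x = c}, normalHessianDet f {x | f x = c} x ^ (-(1 / 2) : ℝ) ∂M)) := by
  have h1 := h.tendsto_laplace hk hkn hM (φ := fun _ => 1) continuous_const (B := 1) (by simp)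
  simp only [one_mul] at h1
  rwa [IsPLMin.restrict_eq hM]

/-- Positivity in the normal directions of `f₀` prevents the nullity from going up. If it went down,
the Laplace integral of `f` would decay like a higher power of `σ` than `σⁿ`, against the lower
bound. -/
theorem NearMin.finrank_eq {f₀ f : EuclideanSpace ℝ (Fin d) → ℝ} {c₀ μ₀ c μ a r Λ L η m : ℝ}
    (h : NearMin f₀ c₀ μ₀ f c μ a r Λ L η)
    (hk : ∀ x, f₀ x = c₀ → Module.finrank ℝ (formKer (hess f₀ x)) = k) (hkn : k + n = d)
    (hm : 0 < m)
    (hlow : ∀ σ : ℝ, 0 < σ → σ ≤ r / 4 → m * σ ^ n ≤ ∫ x, Real.exp (-(f x - c) / σ ^ 2)) :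
    ∀ x, f x = c → Module.finrank ℝ (formKer (hess f x)) = k := by
  have hr := h.r_pos
  obtain ⟨k', hk'd, hk'⟩ := h.pert.exists_finrank_eq
  suffices hkk : k' = k by rwa [hkk] at hk'
  obtain ⟨x, hx⟩ := h.pert.nonempty
  refine le_antisymm (by rw [← hk' x hx]; exact h.finrank_le hk hkn hx) ?_
  by_contra! hlt
  obtain ⟨M, hM⟩ := exists_isRiemannianVolume (h.pert.isEmbeddedSubmanifold hk')
    h.pert.isCompact.isClosed.measurableSet
  obtain ⟨l, hl⟩ := Nat.exists_eq_add_of_lt hlt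
  have h1 := tendsto_integral_exp h.pert hk' (n := n + (l + 1)) (by omega) hM
  have h2 : Tendsto (fun σ : ℝ => σ ^ (l + 1)) (𝓝[>] 0) (𝓝 0) := by
    have h3 : Continuous fun σ : ℝ => σ ^ (l + 1) := by fun_prop
    have := (h3.tendsto 0).mono_left (nhdsWithin_le_nhds (s := Ioi (0 : ℝ)))
    simpa using this
  have h4 := h1.mul h2
  rw [mul_zero] at h4
  have h5 : m ≤ 0 := by
    refine ge_of_tendsto h4 ?_
    filter_upwards [Ioo_mem_nhdsGT (show (0 : ℝ) < r / 4 by positivity)] with σ hσ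
    have hσ0 := hσ.1
    have h6 := hlow σ hσ.1 hσ.2.le
    have h7 : ∀ I : ℝ, (σ ^ (n + (l + 1)))⁻¹ * I * σ ^ (l + 1) = (σ ^ n)⁻¹ * I := fun I => by
      rw [pow_add]; field_simp
    rw [h7]
    rw [le_inv_mul_iff₀ (by positivity)]
    linarith
  linarith

/-- The numerator of the density lies between powers of the Hessian bounds `Λ` and `a / 2`. The
normalization `Z` is, up to the Gaussian constant, the limit of rescaled Laplace integrals, so their
uniform bounds pass to it. -/
theorem IsPLMin.exists_perturbation_bounds {f₀ : EuclideanSpace ℝ (Fin d) → ℝ} {c₀ μ₀ : ℝ}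
    (h₀ : IsPLMin f₀ c₀ μ₀) (hd : 0 < d)
    (hk : ∀ x, f₀ x = c₀ → Module.finrank ℝ (formKer (hess f₀ x)) = k) (hkn : k + n = d)
    {a r Λ : ℝ} (hr : 0 < r) (ha : 0 < a) (hΛ : 0 < Λ) :
    ∃ κ > 0, ∀ f c μ L η, NearMin f₀ c₀ μ₀ f c μ a r Λ L η →
      (∀ x, f x = c → Module.finrank ℝ (formKer (hess f x)) = k) ∧
      ∀ M, IsRiemannianVolume k {x | f x = c} M → ∀ x, f x = c →
        κ ≤ limitDensity f {x | f x = c} M x ∧ limitDensity f {x | f x = c} M x ≤ 1 / κ := by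
  obtain ⟨m₁, hm₁, hlow⟩ := h₀.exists_integral_lower hd hk hkn hr ha Λ hΛ.le
  obtain ⟨m₂, hup⟩ := h₀.exists_integral_upper hk hkn (a := a) hr
  have hG := gaussConst_pos n
  -- `max m₂ 1` stands in for `m₂`, whose sign is not known beforehand.
  set lo := (Λ ^ n) ^ (-(1 / 2) : ℝ) / (max m₂ 1 / gaussConst n) with hlo
  set hi := ((a / 2) ^ n) ^ (-(1 / 2) : ℝ) / (m₁ / gaussConst n) with hhi
  have hm₂ : 0 < max m₂ 1 := lt_max_of_lt_right one_pos
  have hlopos : 0 < lo := by positivity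
  have hhipos : 0 < hi := by positivity
  refine ⟨min lo (1 / hi), lt_min hlopos (by positivity), fun f c μ L η h => ?_⟩
  have hkf := h.finrank_eq hk hkn hm₁ (hlow f c μ L η h)
  refine ⟨hkf, fun M hM x hx => ?_⟩
  have hlim := tendsto_integral_exp h.pert hkf hkn hM
  set Z := ∫ x in {x | f x = c}, normalHessianDet f {x | f x = c} x ^ (-(1 / 2) : ℝ) ∂M with hZ
  have hZ1 : m₁ ≤ gaussConst n * Z := by
    refine ge_of_tendsto hlim ?_
    filter_upwards [Ioo_mem_nhdsGT (show (0 : ℝ) < r / 4 by positivity)] with σ hσ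
    have hσ0 := hσ.1
    rw [le_inv_mul_iff₀ (by positivity)]
    linarith [hlow f c μ L η h σ hσ.1 hσ.2.le]
  have hZ2 : gaussConst n * Z ≤ m₂ := by
    set V := Metric.thickening (r / 4) {x | f₀ x = c₀} with hV
    have hVm : MeasurableSet V := Metric.isOpen_thickening.measurableSet
    -- The uniform upper bound only covers `V`. Outside `V` the rescaled integral tends to zero for
    -- each fixed `f`, which suffices because only the limit is compared with `m₂`.
    have htail := h.pert.tendsto_tail n Metric.isOpen_thickening h.subset
      (φ := Vᶜ.indicator fun _ => 1) (B := 1) (fun x => by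
        by_cases hx : x ∈ Vᶜ
        · simp [indicator_of_mem hx]
        · simp [indicator_of_notMem hx]) (fun x hx => indicator_of_notMem (by simpa using hx) _)
    have hsum := htail.const_add m₂
    rw [add_zero] at hsum
    refine le_of_tendsto_of_tendsto hlim hsum ?_
    filter_upwards [self_mem_nhdsWithin] with σ hσ
    have hσ0 : 0 < σ := hσ
    have hint := h.pert.integrable_exp (lam := σ ^ 2) (by positivity)
    have h1 : ∫ x, (Vᶜ.indicator fun _ => (1 : ℝ)) x * Real.exp (-(f x - c) / σ ^ 2) =
        ∫ x in Vᶜ, Real.exp (-(f x - c) / σ ^ 2) := by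
      rw [← integral_indicator hVm.compl]
      congr 1
      ext x
      by_cases hx : x ∈ Vᶜ
      · simp [indicator_of_mem hx]
      · simp [indicator_of_notMem hx]
    rw [h1, ← integral_add_compl hVm hint, mul_add]
    gcongr
    rw [inv_mul_le_iff₀ (by positivity)]
    linarith [hup f c μ Λ L η h σ hσ0]
  have hZl : m₁ / gaussConst n ≤ Z := by rw [div_le_iff₀ hG]; linarith
  have hZu : Z ≤ max m₂ 1 / gaussConst n := by
    rw [le_div_iff₀ hG]; linarith [le_max_left m₂ 1]
  have hZpos : 0 < Z := lt_of_lt_of_le (by positivity) hZl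
  obtain ⟨F, hF, hΛx⟩ := h.exists_frame_lower hk hkn hx
  obtain ⟨hD1, hD2⟩ := h.pert.normalHessianDet_bounds hx (hkf x hx) hkn (a := a / 2) (Λ := Λ)
    (by positivity) (fun y hy => le_of_forall_ker_orthogonal F (hess_comm h.pert.contDiff x)
      (by positivity) hF (hkf x hx) hy) fun y => (hess_apply_le x y y).trans (by
        rw [mul_assoc, ← sq]; gcongr)
  have hDpos := h.pert.normalHessianDet_pos hx
  set D := normalHessianDet f {x | f x = c} x with hD
  have hR1 : (Λ ^ n) ^ (-(1 / 2) : ℝ) ≤ D ^ (-(1 / 2) : ℝ) :=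
    Real.rpow_le_rpow_of_nonpos hDpos hD2 (by norm_num)
  have hR2 : D ^ (-(1 / 2) : ℝ) ≤ ((a / 2) ^ n) ^ (-(1 / 2) : ℝ) :=
    Real.rpow_le_rpow_of_nonpos (by positivity) hD1 (by norm_num)
  have hdens : limitDensity f {x | f x = c} M x = D ^ (-(1 / 2) : ℝ) / Z := rfl
  rw [hdens]
  constructor
  · refine (min_le_left _ _).trans ?_
    exact div_le_div₀ (Real.rpow_nonneg hDpos.le _) hR1 hZpos hZu
  · have h1 : D ^ (-(1 / 2) : ℝ) / Z ≤ hi :=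
      div_le_div₀ (Real.rpow_nonneg (by positivity) _) hR2 (by positivity) hZl
    refine h1.trans ?_
    rw [le_one_div hhipos (lt_min hlopos (by positivity))]
    exact min_le_right _ _

end Perturbation

/-! ### Small perturbations -/

namespace IsPLMin

variable {d : ℕ} {f₀ : EuclideanSpace ℝ (Fin d) → ℝ} {c₀ μ₀ : ℝ}

/-- Near each minimizer `f₀` is `C⁴`, so its Hessian is locally Lipschitz; compactness makes the
constant and the radius uniform. -/
theorem exists_lipschitz_hess (h : IsPLMin f₀ c₀ μ₀) :
    ∃ L δ : ℝ, 0 ≤ L ∧ 0 < δ ∧ ∀ p, f₀ p = c₀ → ∀ y y', ‖y - p‖ ≤ δ → ‖y' - p‖ ≤ δ →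
      ‖hess f₀ y - hess f₀ y'‖ ≤ L * ‖y - y'‖ := by
  refine h.isCompact.induction_on
    (p := fun A => ∃ L δ : ℝ, 0 ≤ L ∧ 0 < δ ∧ ∀ p ∈ A, ∀ y y', ‖y - p‖ ≤ δ → ‖y' - p‖ ≤ δ →
      ‖hess f₀ y - hess f₀ y'‖ ≤ L * ‖y - y'‖) ⟨0, 1, le_rfl, one_pos, by simp⟩ ?_ ?_ ?_
  · rintro A B hAB ⟨L, δ, hL, hδ, hB⟩
    exact ⟨L, δ, hL, hδ, fun p hp => hB p (hAB hp)⟩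
  · rintro A B ⟨L, δ, hL, hδ, hA⟩ ⟨L', δ', hL', hδ', hB⟩
    refine ⟨max L L', min δ δ', le_max_of_le_left hL, lt_min hδ hδ', ?_⟩
    rintro p (hp | hp) y y' hy hy'
    · exact (hA p hp y y' (hy.trans (min_le_left _ _)) (hy'.trans (min_le_left _ _))).trans
        (by gcongr; exact le_max_left _ _)
    · exact (hB p hp y y' (hy.trans (min_le_right _ _)) (hy'.trans (min_le_right _ _))).trans
        (by gcongr; exact le_max_right _ _)
  · intro p hp
    obtain ⟨W, hW, hpW, hC, -⟩ := h.localPL p hp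
    have h1 : ContDiffAt ℝ 1 (hess f₀) p := by
      have h2 : ContDiffAt ℝ 4 f₀ p := hC.contDiffAt (hW.mem_nhds hpW)
      exact (h2.fderiv_right (m := 2) (by norm_num)).fderiv_right (m := 1) (by norm_num)
    obtain ⟨K, s, hs, hK⟩ := h1.exists_lipschitzOnWith
    obtain ⟨δ, hδ, hb⟩ := Metric.mem_nhds_iff.1 hs
    refine ⟨Metric.ball p (δ / 2), mem_nhdsWithin_of_mem_nhds (Metric.ball_mem_nhds _ (by positivity)),
      K, δ / 4, K.2, by positivity, fun q hq y y' hy hy' => ?_⟩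
    rw [mem_ball_iff_norm] at hq
    have key : ∀ y, ‖y - q‖ ≤ δ / 4 → y ∈ s := fun y hy => hb (by
      rw [mem_ball_iff_norm]
      calc ‖y - p‖ = ‖(y - q) + (q - p)‖ := by congr 1; abel
        _ ≤ ‖y - q‖ + ‖q - p‖ := norm_add_le _ _
        _ < δ := by linarith)
    have := hK.dist_le_mul y (key y hy) y' (key y' hy')
    rwa [dist_eq_norm, dist_eq_norm] at this

/-- A perturbation of `f₀` has all its minimizers close to those of `f₀`. -/
theorem subset_thickening (h : IsPLMin f₀ c₀ μ₀) {ρ : ℝ} (hρ : 0 < ρ) :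
    ∃ ε > 0, ∀ f c μ, IsPLMin f c μ →
      (∀ y ∈ Metric.cthickening ρ {x | f₀ x = c₀}, |f y - f₀ y| ≤ ε) →
      {x | f x = c} ⊆ Metric.thickening ρ {x | f₀ x = c₀} := by
  set S := {x | f₀ x = c₀} with hS
  obtain ⟨ε, hε, hgap⟩ := h.exists_gap_off_nhds (V := Metric.thickening ρ S)
    Metric.isOpen_thickening (Metric.self_subset_thickening hρ S)
  refine ⟨ε / 4, by positivity, fun f c μ hf hclose => ?_⟩
  obtain ⟨p, hp⟩ := h.nonempty
  have hpK : p ∈ Metric.cthickening ρ S := Metric.self_subset_cthickening S hp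
  have hfp : f p ≤ c₀ + ε / 4 := by
    have := (abs_le.1 (hclose p hpK)).2
    rw [hp] at this; linarith
  -- On the boundary shell `f` exceeds its value at a minimizer of `f₀`, so its minimum over the
  -- closed thickening is interior, hence a local and therefore global minimum of `f`.
  have hbd : ∀ x ∈ Metric.cthickening ρ S, x ∉ Metric.thickening ρ S → c₀ + 3 * ε / 4 ≤ f x :=
    fun x hx hx' => by
      have := (abs_le.1 (hclose x hx)).1
      linarith [hgap x hx']
  obtain ⟨y, hy, hmin⟩ := (h.isCompact.cthickening (r := ρ)).exists_isMinOn ⟨p, hpK⟩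
    hf.contDiff.continuous.continuousOn
  have hyp : f y ≤ f p := hmin hpK
  have hyV : y ∈ Metric.thickening ρ S := by
    by_contra hyV
    linarith [hbd y hy hyV]
  have hyc : f y = c := by
    refine hf.eq_of_isLocalMin y ?_
    filter_upwards [Metric.isOpen_thickening.mem_nhds hyV] with z hz
    exact hmin (Metric.thickening_subset_cthickening ρ S hz)
  -- The connected set of minimizers of `f` meets the thickening and avoids the shell, so it cannot
  -- have points far away. This replaces any growth bound uniform in the parameter.
  refine hf.preconnected.subset_left_of_subset_union Metric.isOpen_thickening
    (Metric.isClosed_cthickening (δ := ρ) (E := S)).isOpen_compl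
    (disjoint_compl_right.mono_left (Metric.thickening_subset_cthickening ρ S)) ?_ ⟨y, hyc, hyV⟩
  intro x hx
  by_cases hxK : x ∈ Metric.cthickening ρ S
  · left
    by_contra hxV
    have h1 := hbd x hxK hxV
    have h2 : f x = c := hx
    linarith
  · exact Or.inr hxK

/-- The constants are chosen in the order `a`, `r`, `η`, `ε`. The gap gives coercivity `a` at the
minimizers; `r` is small enough to keep `3a/4` nearby, `η` makes the tilt factor at most `1/4`, and
`ε` leaves coercivity `a/2` for `f`. -/
theorem exists_nearMin (h : IsPLMin f₀ c₀ μ₀) :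
    ∃ a r Λ L η ε : ℝ, 0 < a ∧ 0 < r ∧ 0 < Λ ∧ 0 < ε ∧ ∀ f c μ, IsPLMin f c μ →
      (∀ y ∈ Metric.cthickening 1 {x | f₀ x = c₀}, |f y - f₀ y| ≤ ε ∧
        ‖hess f y - hess f₀ y‖ ≤ ε) → NearMin f₀ c₀ μ₀ f c μ a r Λ L η := by
  set S := {x | f₀ x = c₀} with hS
  have hμ := h.pos
  obtain ⟨L, δ, hL, hδ, hlip⟩ := h.exists_lipschitz_hess
  obtain ⟨Λ, hΛ⟩ := (h.isCompact.cthickening (r := 1)).exists_bound_of_continuousOn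
    (f := fun x => ‖hess f₀ x‖) (continuous_hess h.contDiff).norm.continuousOn
  simp only [norm_norm] at hΛ
  set a := 1 / (2 * μ₀) with ha
  have hapos : 0 < a := by positivity
  set r := min δ (min 1 (a / (4 * (L + 1)))) with hr
  have hrpos : 0 < r := lt_min hδ (lt_min one_pos (by positivity))
  have hr1 : r ≤ 1 := (min_le_right _ _).trans (min_le_left _ _)
  have hrL : L * r ≤ a / 4 := by
    have h1 : r ≤ a / (4 * (L + 1)) := (min_le_right _ _).trans (min_le_right _ _)
    rw [le_div_iff₀ (by positivity)] at h1
    nlinarith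
  set η := min (r / 4) (1 / (8 * μ₀ * (L + 1))) with hη
  have hηpos : 0 < η := lt_min (by positivity) (by positivity)
  have hηr : η ≤ r / 4 := min_le_left _ _
  have hηL : 2 * μ₀ * L * η ≤ 1 / 4 := by
    have h1 : η ≤ 1 / (8 * μ₀ * (L + 1)) := min_le_right _ _
    rw [le_div_iff₀ (by positivity)] at h1
    nlinarith [mul_pos hμ hηpos]
  obtain ⟨ε₁, hε₁, hsub⟩ := h.subset_thickening (ρ := r / 4) (by positivity)
  -- The last entry confines disk minima: `f (p + v) ≤ f p` and the quadratic growth of `f₀` give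
  -- `(3/8) a ‖v‖² ≤ 2ε`, hence `‖v‖ ≤ η`.
  set ε := min (min 1 (a / 4)) (min ε₁ (a * η ^ 2 / 8)) with hε
  have hε1 : ε ≤ 1 := (min_le_left _ _).trans (min_le_left _ _)
  have hεa : ε ≤ a / 4 := (min_le_left _ _).trans (min_le_right _ _)
  have hεε : ε ≤ ε₁ := (min_le_right _ _).trans (min_le_left _ _)
  have hεη : ε ≤ a * η ^ 2 / 8 := (min_le_right _ _).trans (min_le_right _ _)
  have hεpos : 0 < ε := lt_min (lt_min one_pos (by positivity)) (lt_min hε₁ (by positivity))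
  have hmemK : ∀ p, f₀ p = c₀ → ∀ y, ‖y - p‖ ≤ r → y ∈ Metric.cthickening 1 S := fun p hp y hy =>
    Metric.mem_cthickening_of_dist_le y p 1 S hp (by rw [dist_eq_norm]; exact hy.trans hr1)
  have hlow₀ : ∀ p, f₀ p = c₀ → ∀ y, ‖y - p‖ ≤ r → ∀ v ∈ (formKer (hess f₀ p))ᗮ,
      3 / 4 * a * ‖v‖ ^ 2 ≤ hess f₀ y v v := fun p hp y hy v hv => by
    have h1 := h.gap' hp hv
    rw [← ha] at h1
    have h2 := hlip p hp p y (by simpa using hδ.le) (hy.trans (min_le_left _ _))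
    have h3 : ‖hess f₀ p - hess f₀ y‖ ≤ a / 4 := by
      refine h2.trans (le_trans ?_ hrL)
      rw [norm_sub_rev]; gcongr
    have h4 : (hess f₀ p - hess f₀ y) v v ≤ a / 4 * ‖v‖ ^ 2 := by
      refine (le_abs_self _).trans (((hess f₀ p - hess f₀ y).le_opNorm₂ v v).trans ?_)
      rw [mul_assoc, ← sq]; gcongr
    simp only [sub_apply] at h4
    linarith
  refine ⟨a, r, max Λ 0 + 1, L, η, ε, hapos, hrpos, by positivity, hεpos, fun f c μ hf hclose => ?_⟩
  refine ⟨h, hf, hapos, hrpos, hηpos.le, by linarith, fun p hp y hy v hv => ?_,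
    fun p hp y hy => ?_, fun p hp v hv hvr hle => ?_, fun p hp y y' hy hy' =>
      hlip p hp y y' (hy.trans (min_le_left _ _)) (hy'.trans (min_le_left _ _)), hL, hηL,
    hsub f c μ hf fun y hy => ((hclose y (Metric.cthickening_mono (by linarith) S hy)).1.trans hεε)⟩
  · have h1 := hlow₀ p hp y hy v hv
    have h2 := (hclose y (hmemK p hp y hy)).2.trans hεa
    have h4 : (hess f₀ y - hess f y) v v ≤ a / 4 * ‖v‖ ^ 2 := by
      refine (le_abs_self _).trans (((hess f₀ y - hess f y).le_opNorm₂ v v).trans ?_)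
      rw [mul_assoc, ← sq, norm_sub_rev]; gcongr
    simp only [sub_apply] at h4
    linarith
  · have h1 := hΛ y (hmemK p hp y hy)
    have h2 := (hclose y (hmemK p hp y hy)).2.trans hε1
    have h3 := norm_sub_norm_le (hess f y) (hess f₀ y)
    linarith [le_max_left Λ 0]
  · have h1 := taylor_two_lower h.contDiff (x := p) (z := v) (m := 3 / 4 * a * ‖v‖ ^ 2)
      fun ξ hξ => hlow₀ p hp _ (by
        rw [add_sub_cancel_left, norm_smul, Real.norm_eq_abs, abs_of_pos hξ.1]
        exact (mul_le_of_le_one_left (norm_nonneg _) hξ.2.le).trans hvr) v hv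
    rw [hp, h.fderiv_eq_zero hp] at h1
    simp only [zero_apply] at h1
    have h2 := (abs_le.1 (hclose (p + v) (hmemK p hp _ (by simpa using hvr))).1).1
    have h3 := (abs_le.1 (hclose p (hmemK p hp p (by simpa using hrpos.le))).1).2
    rw [hp] at h3
    have h4 : a * ‖v‖ ^ 2 ≤ a * η ^ 2 := by nlinarith [sq_nonneg ‖v‖]
    exact le_of_sq_le_sq (le_of_mul_le_mul_left h4 hapos) hηpos.le

end IsPLMin

/-! ### Dependence on the parameter -/

/-- A tube-lemma argument, relative to `Θ`: joint continuity at each `(θ₀, y)` becomes uniform over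
the compact set of `y`. -/
theorem eventually_forall_norm_sub_le {X Y E : Type*} [TopologicalSpace X] [TopologicalSpace Y]
    [SeminormedAddCommGroup E] {F : X × Y → E} {Θ : Set X} (hF : ContinuousOn F (Θ ×ˢ univ))
    {K : Set Y} (hK : IsCompact K) {θ₀ : X} (hθ₀ : θ₀ ∈ Θ) {ε : ℝ} (hε : 0 < ε) :
    ∀ᶠ θ in 𝓝[Θ] θ₀, ∀ y ∈ K, ‖F (θ, y) - F (θ₀, y)‖ ≤ ε := by
  rw [eventually_nhdsWithin_iff]
  have h1 : ∀ᶠ θ in 𝓝 θ₀, ∀ y ∈ K, θ ∈ Θ → ‖F (θ, y) - F (θ₀, y)‖ ≤ ε := by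
    refine hK.eventually_forall_of_forall_eventually fun y _ => ?_
    have h2 := hF (θ₀, y) ⟨hθ₀, trivial⟩
    have h3 : Tendsto (fun p : X × Y => (θ₀, p.2)) (𝓝[Θ ×ˢ univ] (θ₀, y))
        (𝓝[Θ ×ˢ univ] (θ₀, y)) := by
      refine tendsto_nhdsWithin_of_tendsto_nhds_of_eventually_within _ ?_
        (Eventually.of_forall fun p => ⟨hθ₀, trivial⟩)
      have h4 : Continuous fun p : X × Y => (θ₀, p.2) := by fun_prop
      exact (h4.tendsto (θ₀, y)).mono_left nhdsWithin_le_nhds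
    have h5 : Tendsto (fun p : X × Y => ‖F p - F (θ₀, p.2)‖) (𝓝[Θ ×ˢ univ] (θ₀, y)) (𝓝 0) := by
      have := (Tendsto.sub h2 (Tendsto.comp h2 h3)).norm
      simpa using this
    have h6 := h5.eventually_lt_const hε
    rw [eventually_nhdsWithin_iff] at h6
    filter_upwards [h6] with p hp hpΘ
    exact (hp ⟨hpΘ, trivial⟩).le
  exact h1.mono fun θ hθ hΘ y hy => hθ y hy hΘ

theorem IsPLMin.eventually_bounds {m d : ℕ} (hd : 0 < d) {Θ : Set (EuclideanSpace ℝ (Fin m))}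
    {g : EuclideanSpace ℝ (Fin m) → EuclideanSpace ℝ (Fin d) → ℝ}
    (hg : ContinuousOn (fun p : EuclideanSpace ℝ (Fin m) × EuclideanSpace ℝ (Fin d) => g p.1 p.2)
      (Θ ×ˢ univ))
    (hH : ContinuousOn (fun p : EuclideanSpace ℝ (Fin m) × EuclideanSpace ℝ (Fin d) =>
      hess (g p.1) p.2) (Θ ×ˢ univ))
    {θ₀ : EuclideanSpace ℝ (Fin m)} (hθ₀ : θ₀ ∈ Θ) {c₀ μ₀ : ℝ} (h₀ : IsPLMin (g θ₀) c₀ μ₀) {k : ℕ}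
    (hk : ∀ x, g θ₀ x = c₀ → Module.finrank ℝ (formKer (hess (g θ₀) x)) = k) :
    ∃ κ > 0, ∀ᶠ θ in 𝓝[Θ] θ₀, ∀ c μ, IsPLMin (g θ) c μ →
      (∀ x, g θ x = c → Module.finrank ℝ (formKer (hess (g θ) x)) = k) ∧
      ∀ M, IsRiemannianVolume k {x | g θ x = c} M → ∀ x, g θ x = c →
        κ ≤ limitDensity (g θ) {x | g θ x = c} M x ∧
          limitDensity (g θ) {x | g θ x = c} M x ≤ 1 / κ := by
  obtain ⟨x₀, hx₀⟩ := h₀.nonempty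
  have hkd : k ≤ d := by rw [← hk x₀ hx₀]; exact IsPLMin.finrank_formKer_le _ _
  obtain ⟨a, r, Λ, L, η, ε, ha, hr, hΛ, hε, hnear⟩ := h₀.exists_nearMin
  obtain ⟨κ, hκ, hb⟩ := h₀.exists_perturbation_bounds hd hk (Nat.add_sub_of_le hkd) hr ha hΛ
  have hK := h₀.isCompact.cthickening (r := 1)
  refine ⟨κ, hκ, ?_⟩
  filter_upwards [eventually_forall_norm_sub_le hg hK hθ₀ hε,
    eventually_forall_norm_sub_le hH hK hθ₀ hε] with θ h1 h2 c μ hf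
  exact hb _ _ _ _ _ (hnear _ _ _ hf fun y hy => ⟨h1 y hy, h2 y hy⟩)

theorem mainTheorem9 {m d : ℕ} (hd : 2 ≤ d)
    (Θ : Set (EuclideanSpace ℝ (Fin m))) (hΘ : IsCompact Θ) (hΘconv : Convex ℝ Θ)
    (g : EuclideanSpace ℝ (Fin m) → EuclideanSpace ℝ (Fin d) → ℝ)
    (hPL : ∀ θ ∈ Θ, PLCirc (g θ))
    (hreg : LowerLevelRegular Θ g) :
    ∃ (k : ℕ) (κ : ℝ), 0 < κ ∧ ∀ θ ∈ Θ,
      IsEmbeddedSubmanifold k (argminSet (g θ)) ∧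
      ∃ M ν : Measure (EuclideanSpace ℝ (Fin d)),
        IsRiemannianVolume k (argminSet (g θ)) M ∧
        IsLimitGibbsMeasure (g θ) ν ∧
        ν = M.withDensity
          (fun x => ENNReal.ofReal (limitDensity (g θ) (argminSet (g θ)) M x)) ∧
        ∀ x ∈ argminSet (g θ),
          κ ≤ limitDensity (g θ) (argminSet (g θ)) M x ∧
          limitDensity (g θ) (argminSet (g θ)) M x ≤ 1 / κ := by
  rcases Θ.eq_empty_or_nonempty with rfl | ⟨θ₁, hθ₁⟩
  · exact ⟨0, 1, one_pos, fun θ hθ => hθ.elim⟩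
  have hd0 : 0 < d := by omega
  obtain ⟨ν, hν, hgrowth⟩ := hreg.quadratic_growth
  have hex : ∀ θ ∈ Θ, ∃ c μ, IsPLMin (g θ) c μ ∧ argminSet (g θ) = {x | g θ x = c} := by
    intro θ hθ
    obtain ⟨c, hc, D, _, hD⟩ := hgrowth θ hθ
    obtain ⟨μ, h⟩ := (hPL θ hθ).exists_isPLMin hd hc hν hD
    exact ⟨c, μ, h⟩
  choose! c μ hPLM harg using hex
  have hex2 : ∀ θ ∈ Θ, ∃ k : ℕ, k ≤ d ∧
      ∀ x, g θ x = c θ → Module.finrank ℝ (formKer (hess (g θ) x)) = k := fun θ hθ =>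
    (hPLM θ hθ).exists_finrank_eq
  choose! k hkd hk using hex2
  have hgc : ContinuousOn (fun p : EuclideanSpace ℝ (Fin m) × EuclideanSpace ℝ (Fin d) =>
      g p.1 p.2) (Θ ×ˢ univ) := fun p hp =>
    (hreg.contDiffAt p.1 hp.1 p.2).continuousAt.continuousWithinAt
  have hloc := fun θ₀ (hθ₀ : θ₀ ∈ Θ) => IsPLMin.eventually_bounds hd0 hgc hreg.continuousOn_hess
    hθ₀ (hPLM θ₀ hθ₀) (hk θ₀ hθ₀)
  -- The dimension is locally constant in `θ`; a convex `Θ` is connected, so a single `k` serves for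
  -- all parameters.
  have hkloc : ContinuousOn k Θ := fun θ₀ hθ₀ => by
    obtain ⟨κ, _, hev⟩ := hloc θ₀ hθ₀
    refine tendsto_nhds_of_eventually_eq ?_
    filter_upwards [hev, self_mem_nhdsWithin] with θ hθ hθΘ
    obtain ⟨x, hx⟩ := (hPLM θ hθΘ).nonempty
    rw [← hk θ hθΘ x hx]
    exact (hθ _ _ (hPLM θ hθΘ)).1 x hx
  have hkc : ∀ θ ∈ Θ, k θ = k θ₁ := fun θ hθ => hΘconv.isPreconnected.constant hkloc hθ hθ₁
  have hunif : ∃ κ > 0, ∀ θ ∈ Θ, ∀ M, IsRiemannianVolume (k θ₁) {x | g θ x = c θ} M →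
      ∀ x, g θ x = c θ → κ ≤ limitDensity (g θ) {x | g θ x = c θ} M x ∧
          limitDensity (g θ) {x | g θ x = c θ} M x ≤ 1 / κ := by
    -- The local bounds are patched over `Θ` by compactness; a union of two sets takes the smaller
    -- of the two constants.
    have := hΘ.induction_on (p := fun A => ∃ κ > 0, ∀ θ ∈ A, θ ∈ Θ →
      ∀ M, IsRiemannianVolume (k θ₁) {x | g θ x = c θ} M →
      ∀ x, g θ x = c θ → κ ≤ limitDensity (g θ) {x | g θ x = c θ} M x ∧
          limitDensity (g θ) {x | g θ x = c θ} M x ≤ 1 / κ) ⟨1, one_pos, by simp⟩ ?_ ?_ ?_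
    · obtain ⟨κ, hκ, h⟩ := this
      exact ⟨κ, hκ, fun θ hθ => h θ hθ hθ⟩
    · rintro A B hAB ⟨κ, hκ, hB⟩
      exact ⟨κ, hκ, fun θ hθ => hB θ (hAB hθ)⟩
    · rintro A B ⟨κ, hκ, hA⟩ ⟨κ', hκ', hB⟩
      have hmin : 0 < min κ κ' := lt_min hκ hκ'
      refine ⟨min κ κ', hmin, ?_⟩
      rintro θ (hθ | hθ) hθΘ M hM x hx
      · have h1 := hA θ hθ hθΘ M hM x hx
        exact ⟨(min_le_left _ _).trans h1.1,
          h1.2.trans (one_div_le_one_div_of_le hmin (min_le_left _ _))⟩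
      · have h1 := hB θ hθ hθΘ M hM x hx
        exact ⟨(min_le_right _ _).trans h1.1,
          h1.2.trans (one_div_le_one_div_of_le hmin (min_le_right _ _))⟩
    · intro θ₀ hθ₀
      obtain ⟨κ, hκ, hev⟩ := hloc θ₀ hθ₀
      refine ⟨_, hev, κ, hκ, fun θ hθ hθΘ M hM => ?_⟩
      refine (hθ _ _ (hPLM θ hθΘ)).2 M ?_
      rwa [hkc θ₀ hθ₀]
  obtain ⟨κ, hκ, hbounds⟩ := hunif
  refine ⟨k θ₁, κ, hκ, fun θ hθ => ?_⟩
  have hf := hPLM θ hθ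
  have hkθ : ∀ x, g θ x = c θ → Module.finrank ℝ (formKer (hess (g θ) x)) = k θ₁ := fun x hx => by
    rw [hk θ hθ x hx, hkc θ hθ]
  have hkd₁ := hkd θ₁ hθ₁
  rw [harg θ hθ]
  have hsub := hf.isEmbeddedSubmanifold hkθ
  obtain ⟨M, hM⟩ := exists_isRiemannianVolume hsub hf.isCompact.isClosed.measurableSet
  exact ⟨hsub, M, _, hM, hf.isLimitGibbsMeasure hkθ (Nat.add_sub_of_le hkd₁) hM, rfl,
    hbounds θ hθ M hM⟩

end
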